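/- All graphs are finite, simple and undirected, with vertex set $\{0,\dots,n-1\}$, and are given to an algorithm by $n$ and their adjacency matrix. A clique minor with $h$ vertices in $G$ is a family of $h$ pairwise disjoint vertex sets, each inducing a connected (nonempty) subgraph of $G$, such that any two of them are joined by an edge of $G$; the Hadwiger number $\eta(G)$ is the largest such $h$, and $\chi(G)$ is the chromatic number. A smallest-last greedy coloring of $G$ is obtained from an ordering $v_1,\dots,v_n$ of the vertices in which each $v_i$ has minimum degree in the subgraph induced by $v_1,\dots,v_i$, by giving to $v_1,v_2,\dots$ in turn the smallest color not used on an earlier neighbor. Polynomial time means a number of steps of a (deterministic) random access machine with unit-cost addition, truncated subtraction and halving that is bounded by a polynomial in the binary length of the input. (1) There are a constant $c>0$ and a polynomial-time algorithm that, given any graph $G$, finds a proper coloring of $G$, namely a smallest-last greedy coloring, and a clique minor of $G$ such that, if $k$ is the number of colors used, then the clique minor has at least $c\,k/\sqrt{\log k}$ vertices when $k\ge 2$, and at least one vertex when $k=1$. (2) There are a constant $C>0$ and a polynomial-time algorithm that, given any $n$-vertex graph $G$ and a parameter $0<\varepsilon<1$, finds either a proper coloring of $G$ or a clique minor of $G$,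 such that for $n\ge 2$ the output is an approximation in the following sense: if it is a coloring, it uses at most $C\,n^{\varepsilon}(\log n)^{1/4}\,\chi(G)$ colors; if it is a clique minor, with $h$ vertices, then $\eta(G)\le C\,n^{1-\varepsilon}(\log n)^{1/4}\,h$. Here $C$ and the algorithm do not depend on $\varepsilon$; the parameter is given as a rational number $r$ with $0<r<1$ (numerator and denominator in binary), where $r=\varepsilon$ if $\varepsilon$ is rational, and for real $\varepsilon$ any $r$ with $|\varepsilon-r|\log n\le 1$ may be used. -/

import Mathlib

/-! ### Random access machines

A program works on registers `reg 0, reg 1, …` and on arrays `arr 0, arr 1, …`, all holding natural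
numbers; array cells are addressed by computed indices.  The arithmetic is addition, truncated
subtraction and halving, at unit cost.  An operation lengthens the largest number in the machine by
at most one bit, so that polynomial time here is the same as polynomial time on Turing machines. -/

namespace RAM

structure State where
  reg : ℕ → ℕ
  arr : ℕ → ℕ → ℕ

inductive Expr where
  | const (c : ℕ)
  | reg (i : ℕ)
  | read (a : ℕ) (e : Expr)
  | add (e f : Expr)
  | sub (e f : Expr)
  | half (e : Expr)

def Expr.eval (s : State) : Expr → ℕ
  | .const c => c
  | .reg i => s.reg i
  | .read a e => s.arr a (e.eval s)
  | .add e f => e.eval s + f.eval s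
  | .sub e f => e.eval s - f.eval s
  | .half e => e.eval s / 2

/-- The number of operations in the evaluation of an expression. -/
def Expr.cost : Expr → ℕ
  | .const _ => 1
  | .reg _ => 1
  | .read _ e => e.cost + 1
  | .add e f => e.cost + f.cost + 1
  | .sub e f => e.cost + f.cost + 1
  | .half e => e.cost + 1

inductive Prog where
  | skip
  | set (i : ℕ) (e : Expr)
  | write (a : ℕ) (idx e : Expr)
  | seq (P Q : Prog)
  | ite (e : Expr) (P Q : Prog)
  | loop (e : Expr) (P : Prog)

def State.setReg (s : State) (i v : ℕ) : State :=
  { s with reg := Function.update s.reg i v }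

def State.setArr (s : State) (a idx v : ℕ) : State :=
  { s with arr := Function.update s.arr a (Function.update (s.arr a) idx v) }

/-- `Exec P s t s'`: started in the state `s`, the program `P` halts after exactly `t` steps in the
state `s'`.  A test succeeds if its value is not zero. -/
inductive Exec : Prog → State → ℕ → State → Prop where
  | skip (s : State) : Exec .skip s 1 s
  | set (s : State) (i : ℕ) (e : Expr) : Exec (.set i e) s (e.cost + 1) (s.setReg i (e.eval s))
  | write (s : State) (a : ℕ) (idx e : Expr) :
      Exec (.write a idx e) s (idx.cost + e.cost + 1) (s.setArr a (idx.eval s) (e.eval s))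
  | seq {P Q : Prog} {s s' s'' : State} {t t' : ℕ} :
      Exec P s t s' → Exec Q s' t' s'' → Exec (.seq P Q) s (t + t') s''
  | iteTrue {e : Expr} {P Q : Prog} {s s' : State} {t : ℕ} :
      e.eval s ≠ 0 → Exec P s t s' → Exec (.ite e P Q) s (e.cost + 1 + t) s'
  | iteFalse {e : Expr} {P Q : Prog} {s s' : State} {t : ℕ} :
      e.eval s = 0 → Exec Q s t s' → Exec (.ite e P Q) s (e.cost + 1 + t) s'
  | loopDone {e : Expr} {P : Prog} {s : State} :
      e.eval s = 0 → Exec (.loop e P) s (e.cost + 1) s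
  | loopStep {e : Expr} {P : Prog} {s s' s'' : State} {t t' : ℕ} :
      e.eval s ≠ 0 → Exec P s t s' → Exec (.loop e P) s' t' s'' →
      Exec (.loop e P) s (e.cost + 1 + t + t') s''

/-- The input word stands in array `0` and its length in register `0`; all else is `0`. -/
def init (w : List ℕ) : State where
  reg i := if i = 0 then w.length else 0
  arr a j := if a = 0 then w.getD j 0 else 0

/-- The output word stands in array `1` and its length in register `1`. -/
def output (s : State) : List ℕ :=
  (List.range (s.reg 1)).map (s.arr 1)

/-- The length of a word of natural numbers when these are written in binary with separators. -/
def wordSize (w : List ℕ) : ℕ :=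
  (w.map fun x => Nat.size x + 1).sum

/-- Some program, run on the encoding of any instance `a`, halts within a number of steps that is
polynomial in the size of that encoding, with an output word that solves the instance. -/
def SolvableInPolyTime {α : Type} (enc : α → List ℕ) (Solves : α → List ℕ → Prop) : Prop :=
  ∃ (P : Prog) (p : Polynomial ℕ), ∀ a : α, ∃ (t : ℕ) (s : State),
    Exec P (init (enc a)) t s ∧ t ≤ p.eval (wordSize (enc a)) ∧ Solves a (output s)

end RAM

/-! ### Clique minors -/

/-- A clique minor with `h` vertices: pairwise disjoint connected (in particular nonempty) branch
sets, any two of them joined by an edge. -/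
structure CliqueMinor {V : Type} (G : SimpleGraph V) (h : ℕ) where
  branch : Fin h → Set V
  connected : ∀ i, (G.induce (branch i)).Connected
  disjoint : ∀ i j, i ≠ j → Disjoint (branch i) (branch j)
  adjacent : ∀ i j, i ≠ j → ∃ u ∈ branch i, ∃ v ∈ branch j, G.Adj u v

/-- The largest number of vertices of a clique minor (for finite graphs). -/
noncomputable def hadwigerNumber {V : Type} (G : SimpleGraph V) : ℕ :=
  sSup {h : ℕ | Nonempty (CliqueMinor G h)}

/-! ### Colorings -/

/-- The number of colors that a coloring uses. -/
noncomputable def colorsUsed {V : Type} {G : SimpleGraph V} (col : G.Coloring ℕ) : ℕ :=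
  (Set.range col).ncard

/-- `col` is a greedy coloring along a smallest-last order `σ 0, σ 1, …` of the vertices: each `σ i`
has minimum degree in the subgraph induced by `σ 0, …, σ i`, and it receives the smallest color that
differs from the colors of its neighbors among `σ 0, …, σ (i - 1)`. -/
def IsSmallestLastGreedy {n : ℕ} {G : SimpleGraph (Fin n)} (col : G.Coloring ℕ) : Prop :=
  ∃ σ : Equiv.Perm (Fin n),
    (∀ i j, j ≤ i →
      {l | l ≤ i ∧ G.Adj (σ i) (σ l)}.ncard ≤ {l | l ≤ i ∧ G.Adj (σ j) (σ l)}.ncard) ∧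
    ∀ i, IsLeast {c : ℕ | ∀ j, j < i → G.Adj (σ i) (σ j) → col (σ j) ≠ c} (col (σ i))

/-! ### Encodings as words of natural numbers -/

/-- A graph as an algorithmic input: the number `n` of vertices and a graph on `{0, …, n - 1}`. -/
abbrev InputGraph : Type := Σ n : ℕ, SimpleGraph (Fin n)

open Classical in
/-- The number of vertices, followed by the rows of the adjacency matrix. -/
noncomputable def encodeGraph (G : InputGraph) : List ℕ :=
  G.1 :: (List.finRange G.1).flatMap fun u =>
    (List.finRange G.1).map fun v => if G.2.Adj u v then 1 else 0

/-- The rational number first, as numerator and denominator, then the graph. -/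
noncomputable def encodeGraphParam (x : InputGraph × Set.Ioo (0 : ℚ) 1) : List ℕ :=
  x.2.1.num.toNat :: x.2.1.den :: encodeGraph x.1

/-- The list of the colors of the vertices. -/
def encodeColoring {n : ℕ} {G : SimpleGraph (Fin n)} (col : G.Coloring ℕ) : List ℕ :=
  (List.finRange n).map fun v => col v

open Classical in
/-- The number of branch sets, followed by their indicator vectors. -/
noncomputable def encodeMinor {n h : ℕ} {G : SimpleGraph (Fin n)} (M : CliqueMinor G h) : List ℕ :=
  h :: (List.finRange h).flatMap fun i =>
    (List.finRange n).map fun v => if v ∈ M.branch i then 1 else 0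

/-! ### The two problems -/

/-- The word `out` describes a smallest-last greedy coloring, with `k` colors say, and a clique minor
with at least `c * k / √(log k)` vertices (for `k = 1`, where `log k = 0`, with at least one). -/
def IsColoringAndMinor (c : ℝ) (G : InputGraph) (out : List ℕ) : Prop :=
  ∃ (col : G.2.Coloring ℕ) (h : ℕ) (M : CliqueMinor G.2 h),
    out = encodeColoring col ++ encodeMinor M ∧
    IsSmallestLastGreedy col ∧
    (1 ≤ colorsUsed col → 1 ≤ h) ∧
    (2 ≤ colorsUsed col → c * (colorsUsed col / √(Real.log (colorsUsed col))) ≤ h)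

/-- `col` approximates the chromatic number to within the factor `ρ`. -/
def ApproximatesChromatic {V : Type} {G : SimpleGraph V} (ρ : ℝ) (col : G.Coloring ℕ) : Prop :=
  (colorsUsed col : ℝ) ≤ ρ * (G.chromaticNumber.toNat : ℝ)

/-- A clique minor with `h` vertices approximates the Hadwiger number to within the factor `ρ`. -/
def ApproximatesHadwiger {V : Type} {G : SimpleGraph V} {h : ℕ} (ρ : ℝ) (_M : CliqueMinor G h) :
    Prop :=
  (hadwigerNumber G : ℝ) ≤ ρ * (h : ℝ)

/-- The real parameter `ε` may be presented to the algorithm by the rational number `r` if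
`|ε - r| * log n ≤ 1`.  In particular a rational parameter may be presented by itself. -/
def Presents (n : ℕ) (r : ℚ) (ε : ℝ) : Prop :=
  0 < ε ∧ ε < 1 ∧ |ε - r| * Real.log n ≤ 1

/-- The word `out` describes either (tag `0`) a coloring or (tag `1`) a clique minor, which has the
required approximation ratio. -/
def IsPairedApproximation (C : ℝ) (x : InputGraph × Set.Ioo (0 : ℚ) 1) (out : List ℕ) : Prop :=
  (∃ col : x.1.2.Coloring ℕ, out = 0 :: encodeColoring col ∧
    ∀ ε : ℝ, Presents x.1.1 x.2.1 ε → 2 ≤ x.1.1 →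
      ApproximatesChromatic
        (C * ((x.1.1 : ℝ) ^ ε * (Real.log x.1.1) ^ (1 / 4 : ℝ))) col) ∨
  (∃ (h : ℕ) (M : CliqueMinor x.1.2 h), out = 1 :: encodeMinor M ∧
    ∀ ε : ℝ, Presents x.1.1 x.2.1 ε → 2 ≤ x.1.1 →
      ApproximatesHadwiger
        (C * ((x.1.1 : ℝ) ^ (1 - ε) * (Real.log x.1.1) ^ (1 / 4 : ℝ))) M)

/-! ### Exec with time bounds -/

namespace RAM

/-! Both algorithms rest on one analysis of the input graph. Vertices of minimum degree are removed
one after another, and the greedy coloring is made in the reverse order. Let `v` receive the largest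
color, `K - 1`. Its neighbors that are removed later show all smaller colors, and at its removal `v`
has minimum degree, so the graph on the vertices then present has minimum degree at least `d = K -
1` (`suffixGraph_degree`). It remains to find, deterministically, a clique minor of order `d / √(log
d)` in such a graph.

Mader's contraction comes next: edges in few triangles are contracted as long as the average degree
does not drop (`edges₂_contr`). When no such edge is left, the neighborhood of a vertex of minimum
positive degree has `m > d / 2` vertices and induces a graph in which each vertex is adjacent to
about half of the others or more (`dense_neighborhood`).

In this dense graph, a vertex `x` with few pairs of neighbors of small codegree yields sets `Y`, `Z`
and `R` (`isPrepared`): any root in `R` has many common neighbors with most of `Y`, every vertex of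
`Z` has many neighbors in `Y`, and every root has many neighbors in `Z`. Let `S` be of order `√(log
m)`. A branch set starts with a free root and takes in `O(S)` vertices of `Y`, each linked to the
root by a common neighbor. Each is chosen so as to leave as little of `Z` undominated as possible,
and so disposes of a fixed fraction of what is left (`domStep_undominated`); in the end at most `m /
2 ^ S` vertices of `Z` are undominated. Then `O(S)` neighbors of the root in `Z` are added. Every
earlier branch set misses only `m / 2 ^ S` vertices of `Z`, so the best choice multiplies the number
of unjoined earlier sets by at most `512 / 2 ^ S` (`joinStep_unjoined`); after `O(S)` choices this
number is below `2 ^ (S * S) / 2 ^ (S * S) = 1`. A branch set has `O(S)` vertices, and the process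
continues until a fixed fraction of `m` is used up, which yields of order `m / √(log m)` branch sets
(`growStep_count`). Averaging over all candidates replaces every random choice.

For the second part let `h` be the size of the minor, so that `c * K ≤ h * √(log n)`. If `K * h` is
at most about `n ^ (2 * ε)`, then `c * K ^ 2 ≤ K * h * √(log n)` shows that the coloring is good
enough, since at least one color is needed. Otherwise `c * K * h ≤ h ^ 2 * √(log n)` gives a lower
bound for `h` of order `n ^ ε / (log n) ^ (1 / 4)`, and the Hadwiger number is at most `n = n ^ (1 -
ε) * n ^ ε`. The comparison uses binary lengths only, at the price of constant factors.

The programs are written in a language all of whose loops have length `n`. Compilation provides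
termination and a time bound polynomial in `n` once and for all (`Cmd.correct`), so that only the
results of the programs need to be verified. -/

theorem State.reg_setReg (s : State) (i v r : ℕ) :
    (s.setReg i v).reg r = if r = i then v else s.reg r := by
  simp [State.setReg, Function.update_apply]

@[simp] theorem State.arr_setReg (s : State) (i v : ℕ) : (s.setReg i v).arr = s.arr := rfl

@[simp] theorem State.reg_setArr (s : State) (a i v : ℕ) : (s.setArr a i v).reg = s.reg := rfl

theorem State.arr_setArr (s : State) (a i v b j : ℕ) :
    (s.setArr a i v).arr b j = if b = a ∧ j = i then v else s.arr b j := by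
  by_cases hb : b = a
  · subst hb
    simp [State.setArr, Function.update_apply]
  · simp [State.setArr, hb]

/-- Started in `s`, the program `P` halts within `b` steps in a state that satisfies `Q`. -/
def Within (P : Prog) (s : State) (b : ℕ) (Q : State → Prop) : Prop :=
  ∃ t s', Exec P s t s' ∧ t ≤ b ∧ Q s'

theorem Within.mono {P : Prog} {s : State} {b b' : ℕ} {Q Q' : State → Prop}
    (h : Within P s b Q) (hb : b ≤ b') (hQ : ∀ s', Q s' → Q' s') : Within P s b' Q' := by
  obtain ⟨t, s', he, ht, hq⟩ := h
  exact ⟨t, s', he, ht.trans hb, hQ _ hq⟩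

theorem Within.skip {s : State} {Q : State → Prop} (h : Q s) : Within .skip s 1 Q :=
  ⟨_, _, .skip s, le_rfl, h⟩

theorem Within.set {s : State} {i : ℕ} {e : Expr} {Q : State → Prop}
    (h : Q (s.setReg i (e.eval s))) : Within (.set i e) s (e.cost + 1) Q :=
  ⟨_, _, .set s i e, le_rfl, h⟩

theorem Within.write {s : State} {a : ℕ} {i e : Expr} {Q : State → Prop}
    (h : Q (s.setArr a (i.eval s) (e.eval s))) :
    Within (.write a i e) s (i.cost + e.cost + 1) Q :=
  ⟨_, _, .write s a i e, le_rfl, h⟩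

theorem Within.seq {P P' : Prog} {s : State} {b b' : ℕ} {Q Q' : State → Prop}
    (h : Within P s b Q) (h' : ∀ s', Q s' → Within P' s' b' Q') :
    Within (.seq P P') s (b + b') Q' := by
  obtain ⟨t, s', he, ht, hq⟩ := h
  obtain ⟨t', s'', he', ht', hq'⟩ := h' s' hq
  exact ⟨_, _, .seq he he', by omega, hq'⟩

theorem Within.ite {P P' : Prog} {e : Expr} {s : State} {b b' : ℕ} {Q : State → Prop}
    (h : e.eval s ≠ 0 → Within P s b Q) (h' : e.eval s = 0 → Within P' s b' Q) :
    Within (.ite e P P') s (e.cost + 1 + (b + b')) Q := by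
  by_cases h0 : e.eval s = 0
  · obtain ⟨t, s', he, ht, hq⟩ := h' h0
    exact ⟨_, _, .iteFalse h0 he, by omega, hq⟩
  · obtain ⟨t, s', he, ht, hq⟩ := h h0
    exact ⟨_, _, .iteTrue h0 he, by omega, hq⟩

/-- A loop that counts register `c` up to the value `n` of register `2`. -/
theorem Within.count {P : Prog} {c n b : ℕ} {I : ℕ → State → Prop}
    (hI : ∀ j s, I j s → s.reg 2 = n ∧ s.reg c = j)
    (hP : ∀ j s, j < n → I j s → Within P s b (I (j + 1))) (s : State) (h : I 0 s) :
    Within (.loop (.sub (.reg 2) (.reg c)) P) s (n * (b + 4) + 4) (I n) := by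
  -- The induction is on the number of remaining rounds. A test costs four steps, which accounts for
  -- `b + 4` per round and for the final `4` of the failing test.
  suffices H : ∀ m j s, j + m = n → I j s →
      Within (.loop (.sub (.reg 2) (.reg c)) P) s (m * (b + 4) + 4) (I n) from
    H n 0 s (by omega) h
  intro m
  induction m with
  | zero =>
    intro j s hj hs
    obtain ⟨h1, h2⟩ := hI j s hs
    refine ⟨_, _, .loopDone ?_, ?_, ?_⟩
    · simp [Expr.eval, h1, h2]; omega
    · simp [Expr.cost]
    · have : j = n := by omega
      exact this ▸ hs
  | succ m ih =>
    intro j s hj hs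
    obtain ⟨h1, h2⟩ := hI j s hs
    obtain ⟨t, s', he, ht, hq⟩ := hP j s (by omega) hs
    obtain ⟨t', s'', he', ht', hq'⟩ := ih (j + 1) s' (by omega) hq
    refine ⟨_, _, .loopStep ?_ he he', ?_, hq'⟩
    · simp [Expr.eval, h1, h2]; omega
    · have : (m + 1) * (b + 4) = m * (b + 4) + (b + 4) := by ring
      simp only [Expr.cost]; omega

end RAM

/-! ### A language of bounded loops

Programs of this language work on registers, on matrices and on an output list.  Besides these they
see the number `n`, which bounds every loop and every column index, and the input word.  They are
compiled to random access machines whose running time is bounded by a polynomial in `n`. -/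

namespace Bounded

structure St where
  reg : ℕ → ℕ
  mat : ℕ → ℕ → ℕ → ℕ
  out : List ℕ

def St.setReg (S : St) (i v : ℕ) : St :=
  { S with reg := Function.update S.reg i v }

@[simp] theorem St.reg_setReg (S : St) (i v r : ℕ) :
    (S.setReg i v).reg r = if r = i then v else S.reg r := by
  simp [St.setReg, Function.update_apply]

@[simp] theorem St.mat_setReg (S : St) (i v : ℕ) : (S.setReg i v).mat = S.mat := rfl

@[simp] theorem St.out_setReg (S : St) (i v : ℕ) : (S.setReg i v).out = S.out := rfl

/-- Sums over all values below `n` of a bound register are the only iteration inside expressions;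
quantifiers, counting, searching and products are derived from them. -/
inductive Ex where
  | const (c : ℕ)
  | size
  | reg (i : ℕ)
  | read (a : ℕ) (u v : Ex)
  | input (e : Ex)
  | add (e f : Ex)
  | sub (e f : Ex)
  | half (e : Ex)
  | ite (c e f : Ex)
  | sum (i : ℕ) (e : Ex)

def Ex.eval (n : ℕ) (w : ℕ → ℕ) : Ex → St → ℕ
  | .const c, _ => c
  | .size, _ => n
  | .reg i, S => S.reg i
  | .read a u v, S => S.mat a (u.eval n w S) (v.eval n w S)
  | .input e, S => w (e.eval n w S)
  | .add e f, S => e.eval n w S + f.eval n w S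
  | .sub e f, S => e.eval n w S - f.eval n w S
  | .half e, S => e.eval n w S / 2
  | .ite c e f, S => if c.eval n w S ≠ 0 then e.eval n w S else f.eval n w S
  | .sum i e, S => ∑ j ∈ Finset.range n, e.eval n w (S.setReg i j)

inductive Cmd where
  | skip
  | set (i : ℕ) (e : Ex)
  | write (a : ℕ) (u v e : Ex)
  | emit (e : Ex)
  | seq (P Q : Cmd)
  | ite (e : Ex) (P Q : Cmd)
  | forTo (i : ℕ) (P : Cmd)

/-- Column indices from `n` on are out of range; writing there has no effect. -/
def St.write (n : ℕ) (S : St) (a u v x : ℕ) : St :=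
  { S with mat := fun a' u' v' =>
      if a' = a ∧ u' = u ∧ v' = v ∧ v < n then x else S.mat a' u' v' }

@[simp] theorem St.reg_write (n : ℕ) (S : St) (a u v x : ℕ) : (S.write n a u v x).reg = S.reg := rfl

@[simp] theorem St.out_write (n : ℕ) (S : St) (a u v x : ℕ) : (S.write n a u v x).out = S.out := rfl

theorem St.mat_write (n : ℕ) (S : St) (a u v x a' u' v' : ℕ) :
    (S.write n a u v x).mat a' u' v' =
      if a' = a ∧ u' = u ∧ v' = v ∧ v < n then x else S.mat a' u' v' := rfl

def iter (f : ℕ → St → St) : ℕ → St → St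
  | 0, S => S
  | j + 1, S => f j (iter f j S)

def Cmd.run (n : ℕ) (w : ℕ → ℕ) : Cmd → St → St
  | .skip, S => S
  | .set i e, S => S.setReg i (e.eval n w S)
  | .write a u v e, S => S.write n a (u.eval n w S) (v.eval n w S) (e.eval n w S)
  | .emit e, S => { S with out := S.out ++ [e.eval n w S] }
  | .seq P Q, S => Q.run n w (P.run n w S)
  | .ite e P Q, S => if e.eval n w S ≠ 0 then P.run n w S else Q.run n w S
  | .forTo i P, S => iter (fun j S => P.run n w (S.setReg i j)) n S

/-! #### Compilation -/

/-- The machine register of a program register. -/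
def usr (i : ℕ) : ℕ := 2 * i + 3

/-- The machine registers for intermediate results. -/
def tmp (k : ℕ) : ℕ := 2 * k + 4

/-- The registers 0, 1 and 2 hold the input length, the output length and the bound `n`. Beyond
them, odd numbers serve the program registers and even numbers the intermediate results. -/
theorem usr_ne_tmp (i k : ℕ) : usr i ≠ tmp k := by unfold usr tmp; omega

@[simp] theorem tmp_inj (i k : ℕ) : tmp i = tmp k ↔ i = k := by unfold tmp; omega

@[simp] theorem usr_inj (i k : ℕ) : usr i = usr k ↔ i = k := by unfold usr; omega

/-- From `u` and `v` in the registers `tmp k` and `tmp (k + 1)`, compute `n * u + v` in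
`tmp (k + 3)`. -/
def address (k : ℕ) : RAM.Prog :=
  .seq (.set (tmp (k + 2)) (.const 0)) <|
  .seq (.set (tmp (k + 3)) (.reg (tmp (k + 1)))) <|
  .loop (.sub (.reg 2) (.reg (tmp (k + 2)))) <|
    .seq (.set (tmp (k + 3)) (.add (.reg (tmp (k + 3))) (.reg (tmp k))))
      (.set (tmp (k + 2)) (.add (.reg (tmp (k + 2))) (.const 1)))

/-- The result is in `tmp k`; of the other registers only those for intermediate results from
`tmp k` on are changed. -/
def Ex.compile : Ex → ℕ → RAM.Prog
  | .const c, k => .set (tmp k) (.const c)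
  | .size, k => .set (tmp k) (.reg 2)
  | .reg i, k => .set (tmp k) (.reg (usr i))
  | .read a u v, k =>
    .seq (u.compile k) <| .seq (v.compile (k + 1)) <|
    .ite (.sub (.reg 2) (.reg (tmp (k + 1))))
      (.seq (address k) (.set (tmp k) (.read (a + 2) (.reg (tmp (k + 3))))))
      (.set (tmp k) (.const 0))
  | .input e, k => .seq (e.compile k) (.set (tmp k) (.read 0 (.reg (tmp k))))
  | .add e f, k =>
    .seq (e.compile k) <| .seq (f.compile (k + 1)) <|
    .set (tmp k) (.add (.reg (tmp k)) (.reg (tmp (k + 1))))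
  | .sub e f, k =>
    .seq (e.compile k) <| .seq (f.compile (k + 1)) <|
    .set (tmp k) (.sub (.reg (tmp k)) (.reg (tmp (k + 1))))
  | .half e, k => .seq (e.compile k) (.set (tmp k) (.half (.reg (tmp k))))
  | .ite c e f, k => .seq (c.compile k) (.ite (.reg (tmp k)) (e.compile k) (f.compile k))
  | .sum i e, k =>
    .seq (.set (tmp k) (.const 0)) <|
    .seq (.set (tmp (k + 1)) (.reg (usr i))) <|
    .seq (.set (usr i) (.const 0)) <|
    .seq
      (.loop (.sub (.reg 2) (.reg (usr i))) <|
        .seq (e.compile (k + 2)) <|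
        .seq (.set (tmp k) (.add (.reg (tmp k)) (.reg (tmp (k + 2)))))
          (.set (usr i) (.add (.reg (usr i)) (.const 1))))
      (.set (usr i) (.reg (tmp (k + 1))))

/-- The counter of a loop lives in `tmp k` and is copied to the loop variable in each round, so the
body may overwrite that variable without affecting the number of rounds. -/
def Cmd.compile : Cmd → ℕ → RAM.Prog
  | .skip, _ => .skip
  | .set i e, k => .seq (e.compile k) (.set (usr i) (.reg (tmp k)))
  | .write a u v e, k =>
    .seq (e.compile k) <| .seq (u.compile (k + 1)) <| .seq (v.compile (k + 2)) <|
    .ite (.sub (.reg 2) (.reg (tmp (k + 2))))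
      (.seq (address (k + 1)) (.write (a + 2) (.reg (tmp (k + 4))) (.reg (tmp k))))
      .skip
  | .emit e, k =>
    .seq (e.compile k) <| .seq (.write 1 (.reg 1) (.reg (tmp k))) <|
    .set 1 (.add (.reg 1) (.const 1))
  | .seq P Q, k => .seq (P.compile k) (Q.compile k)
  | .ite e P Q, k => .seq (e.compile k) (.ite (.reg (tmp k)) (P.compile k) (Q.compile k))
  | .forTo i P, k =>
    .seq (.set (tmp k) (.const 0)) <|
    .loop (.sub (.reg 2) (.reg (tmp k))) <|
      .seq (.set (usr i) (.reg (tmp k))) <|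
      .seq (P.compile (k + 1)) (.set (tmp k) (.add (.reg (tmp k)) (.const 1)))

/-! #### Correctness of the compilation -/

/-- The machine state `s` represents the state `S`. -/
structure Represents (n : ℕ) (w : ℕ → ℕ) (S : St) (s : RAM.State) : Prop where
  size : s.reg 2 = n
  reg : ∀ r, s.reg (usr r) = S.reg r
  mat : ∀ a u v, v < n → s.arr (a + 2) (n * u + v) = S.mat a u v
  mat_zero : ∀ a u v, n ≤ v → S.mat a u v = 0
  input : s.arr 0 = w
  out : RAM.output s = S.out

/-- `s` and `s'` differ at most in the registers for intermediate results from `tmp k` on. -/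
def Agree (k : ℕ) (s s' : RAM.State) : Prop :=
  s'.arr = s.arr ∧ ∀ r, (∀ j, k ≤ j → r ≠ tmp j) → s'.reg r = s.reg r

theorem Agree.trans {k : ℕ} {s s' s'' : RAM.State} (h : Agree k s s') (h' : Agree k s' s'') :
    Agree k s s'' :=
  ⟨h'.1.trans h.1, fun r hr => (h'.2 r hr).trans (h.2 r hr)⟩

theorem Agree.mono {k k' : ℕ} {s s' : RAM.State} (h : Agree k s s') (hk : k' ≤ k) :
    Agree k' s s' :=
  ⟨h.1, fun r hr => h.2 r fun j hj => hr j (hk.trans hj)⟩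

theorem Agree.setTmp (k j : ℕ) (hj : k ≤ j) (s : RAM.State) (v : ℕ) :
    Agree k s (s.setReg (tmp j) v) :=
  ⟨rfl, fun r hr => by rw [RAM.State.reg_setReg, if_neg (hr j hj)]⟩

theorem Agree.usr {k : ℕ} {s s' : RAM.State} (h : Agree k s s') (r : ℕ) :
    s'.reg (Bounded.usr r) = s.reg (Bounded.usr r) :=
  h.2 _ fun j _ => usr_ne_tmp r j

theorem Agree.tmp {k : ℕ} {s s' : RAM.State} (h : Agree k s s') (j : ℕ) (hj : j < k) :
    s'.reg (Bounded.tmp j) = s.reg (Bounded.tmp j) :=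
  h.2 _ fun i hi he => by rw [tmp_inj] at he; omega

theorem Agree.one {k : ℕ} {s s' : RAM.State} (h : Agree k s s') : s'.reg 1 = s.reg 1 :=
  h.2 _ fun j _ => by unfold Bounded.tmp; omega

theorem Agree.two {k : ℕ} {s s' : RAM.State} (h : Agree k s s') : s'.reg 2 = s.reg 2 :=
  h.2 _ fun j _ => by unfold Bounded.tmp; omega

theorem Represents.agree {n : ℕ} {w : ℕ → ℕ} {S : St} {s s' : RAM.State} {k : ℕ}
    (h : Represents n w S s) (ha : Agree k s s') : Represents n w S s' where
  size := ha.two.trans h.size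
  reg r := (ha.usr r).trans (h.reg r)
  mat a u v hv := by rw [ha.1]; exact h.mat a u v hv
  mat_zero := h.mat_zero
  input := by rw [ha.1]; exact h.input
  out := by rw [← h.out, RAM.output, RAM.output, ha.1, ha.one]

theorem within_address (n k u v : ℕ) (s : RAM.State) (hn : s.reg 2 = n) (hu : s.reg (tmp k) = u)
    (hv : s.reg (tmp (k + 1)) = v) :
    RAM.Within (address k) s (n * 12 + 8)
      fun s' => Agree (k + 2) s s' ∧ s'.reg (tmp (k + 3)) = n * u + v := by
  have hloop := RAM.Within.count (n := n) (c := tmp (k + 2)) (b := 8)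
    (P := .seq (.set (tmp (k + 3)) (.add (.reg (tmp (k + 3))) (.reg (tmp k))))
      (.set (tmp (k + 2)) (.add (.reg (tmp (k + 2))) (.const 1))))
    (I := fun j s' => Agree (k + 2) s s' ∧ s'.reg (tmp (k + 2)) = j ∧
      s'.reg (tmp (k + 3)) = j * u + v)
    (fun j s' h => ⟨h.1.two.trans hn, h.2.1⟩)
    (by
      rintro j s' hj ⟨h1, h2, h3⟩
      refine ((RAM.Within.set (Q := fun t => Agree (k + 2) s t ∧ t.reg (tmp (k + 2)) = j ∧
        t.reg (tmp (k + 3)) = (j + 1) * u + v) ?_).seq (fun t ht => RAM.Within.set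
        (Q := fun t => Agree (k + 2) s t ∧ t.reg (tmp (k + 2)) = j + 1 ∧
        t.reg (tmp (k + 3)) = (j + 1) * u + v) ?_)).mono (by simp [RAM.Expr.cost]) (fun _ h => h)
      · refine ⟨h1.trans (Agree.setTmp _ _ (by omega) _ _), ?_, ?_⟩
        · rw [RAM.State.reg_setReg, if_neg (by simp), h2]
        · rw [RAM.State.reg_setReg, if_pos rfl]
          simp only [RAM.Expr.eval]
          rw [h3, h1.tmp k (by omega), hu]
          ring
      · refine ⟨ht.1.trans (Agree.setTmp _ _ (by omega) _ _), ?_, ?_⟩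
        · rw [RAM.State.reg_setReg, if_pos rfl]
          simp [RAM.Expr.eval, ht.2.1]
        · rw [RAM.State.reg_setReg, if_neg (by simp), ht.2.2])
  refine (RAM.Within.seq (RAM.Within.set (Q := fun t => Agree (k + 2) s t ∧
      t.reg (tmp (k + 2)) = 0) ?_) fun t ht => RAM.Within.seq (RAM.Within.set
      (Q := fun t => Agree (k + 2) s t ∧ t.reg (tmp (k + 2)) = 0 ∧ t.reg (tmp (k + 3)) = v) ?_)
      fun t ht => hloop t ?_).mono (by simp [RAM.Expr.cost]; omega) ?_
  · refine ⟨Agree.setTmp _ _ (by omega) _ _, ?_⟩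
    rw [RAM.State.reg_setReg, if_pos rfl]
    rfl
  · refine ⟨ht.1.trans (Agree.setTmp _ _ (by omega) _ _), ?_, ?_⟩
    · rw [RAM.State.reg_setReg, if_neg (by simp), ht.2]
    · rw [RAM.State.reg_setReg, if_pos rfl]
      simp only [RAM.Expr.eval]
      rw [ht.1.tmp _ (by omega), hv]
  · simpa using ht
  · rintro t ⟨h1, -, h3⟩
    exact ⟨h1, h3⟩

theorem Represents.setReg {n : ℕ} {w : ℕ → ℕ} {S : St} {s : RAM.State}
    (h : Represents n w S s) (i v : ℕ) : Represents n w (S.setReg i v) (s.setReg (usr i) v) where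
  size := by rw [RAM.State.reg_setReg, if_neg (by unfold usr; omega)]; exact h.size
  reg r := by
    rw [RAM.State.reg_setReg, St.reg_setReg]
    simp [h.reg]
  mat := h.mat
  mat_zero := h.mat_zero
  input := h.input
  out := by
    rw [RAM.output, RAM.State.reg_setReg, if_neg (by unfold usr; omega)]
    exact h.out

theorem St.setReg_setReg (S : St) (i u v : ℕ) : (S.setReg i u).setReg i v = S.setReg i v := by
  simp [St.setReg]

/-- The specification of the program compiled from an expression. -/
def Ex.Correct (e : Ex) : Prop :=
  ∀ k, ∃ p : Polynomial ℕ, ∀ n w S s, Represents n w S s →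
    RAM.Within (e.compile k) s (p.eval n)
      fun s' => Agree k s s' ∧ s'.reg (tmp k) = e.eval n w S

theorem Ex.correct_of_set (e : Ex) (e' : RAM.Expr) (k : ℕ)
    (h : e.compile k = .set (tmp k) e')
    (h' : ∀ n w S s, Represents n w S s → e'.eval s = e.eval n w S) :
    ∃ p : Polynomial ℕ, ∀ n w S s, Represents n w S s →
    RAM.Within (e.compile k) s (p.eval n)
      fun s' => Agree k s s' ∧ s'.reg (tmp k) = e.eval n w S := by
  refine ⟨Polynomial.C (e'.cost + 1), fun n w S s hs => ?_⟩
  rw [h, Polynomial.eval_C]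
  refine RAM.Within.set ⟨Agree.setTmp _ _ le_rfl _ _, ?_⟩
  rw [RAM.State.reg_setReg, if_pos rfl, h' n w S s hs]

theorem Ex.correct_unary (e f : Ex) (e' : RAM.Expr) (hf : f.Correct) (k : ℕ)
    (h : e.compile k = .seq (f.compile k) (.set (tmp k) e'))
    (h' : ∀ n w S s, Represents n w S s → s.reg (tmp k) = f.eval n w S →
      e'.eval s = e.eval n w S) :
    ∃ p : Polynomial ℕ, ∀ n w S s, Represents n w S s →
    RAM.Within (e.compile k) s (p.eval n)
      fun s' => Agree k s s' ∧ s'.reg (tmp k) = e.eval n w S := by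
  obtain ⟨p, hp⟩ := hf k
  refine ⟨p + Polynomial.C (e'.cost + 1), fun n w S s hs => ?_⟩
  rw [h, Polynomial.eval_add, Polynomial.eval_C]
  refine (hp n w S s hs).seq fun t ht => RAM.Within.set
    ⟨ht.1.trans (Agree.setTmp _ _ le_rfl _ _), ?_⟩
  rw [RAM.State.reg_setReg, if_pos rfl, h' n w S t (hs.agree ht.1) ht.2]

theorem Ex.within_pair {e f : Ex} {k : ℕ} {p q : Polynomial ℕ} {n : ℕ} {w : ℕ → ℕ} {S : St}
    {s : RAM.State} (hs : Represents n w S s)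
    (hp : ∀ n w S s, Represents n w S s → RAM.Within (e.compile k) s (p.eval n)
      fun s' => Agree k s s' ∧ s'.reg (tmp k) = e.eval n w S)
    (hq : ∀ n w S s, Represents n w S s → RAM.Within (f.compile (k + 1)) s (q.eval n)
      fun s' => Agree (k + 1) s s' ∧ s'.reg (tmp (k + 1)) = f.eval n w S)
    {P : RAM.Prog} {b : ℕ} {Q : RAM.State → Prop}
    (hP : ∀ t, Agree k s t → t.reg (tmp k) = e.eval n w S →
      t.reg (tmp (k + 1)) = f.eval n w S → RAM.Within P t b Q) :
    RAM.Within (.seq (e.compile k) (.seq (f.compile (k + 1)) P)) s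
      (p.eval n + (q.eval n + b)) Q := by
  refine (hp n w S s hs).seq fun t ht => (hq n w S t (hs.agree ht.1)).seq fun t' ht' =>
    hP t' (ht.1.trans (ht'.1.mono (by omega))) ?_ ht'.2
  rw [ht'.1.tmp k (by omega), ht.2]

theorem Ex.correct_binary (e f g : Ex) (e' : RAM.Expr) (hf : f.Correct) (hg : g.Correct) (k : ℕ)
    (h : e.compile k = .seq (f.compile k) (.seq (g.compile (k + 1)) (.set (tmp k) e')))
    (h' : ∀ n w S s, s.reg (tmp k) = f.eval n w S → s.reg (tmp (k + 1)) = g.eval n w S →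
      e'.eval s = e.eval n w S) :
    ∃ p : Polynomial ℕ, ∀ n w S s, Represents n w S s →
    RAM.Within (e.compile k) s (p.eval n)
      fun s' => Agree k s s' ∧ s'.reg (tmp k) = e.eval n w S := by
  obtain ⟨p, hp⟩ := hf k
  obtain ⟨q, hq⟩ := hg (k + 1)
  refine ⟨p + (q + Polynomial.C (e'.cost + 1)), fun n w S s hs => ?_⟩
  rw [h, Polynomial.eval_add, Polynomial.eval_add, Polynomial.eval_C]
  refine Ex.within_pair hs hp hq fun t h1 h2 h3 => RAM.Within.set
    ⟨h1.trans (Agree.setTmp _ _ le_rfl _ _), ?_⟩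
  rw [RAM.State.reg_setReg, if_pos rfl, h' n w S t h2 h3]

/-- With row-major storage, a column index from `n` on would hit a cell of a later row. The range
test returns `0` instead, in accordance with the field `mat_zero`. -/
theorem Ex.correct_read (a : ℕ) (u v : Ex) (hu : u.Correct) (hv : v.Correct) :
    (Ex.read a u v).Correct := by
  intro k
  obtain ⟨p, hp⟩ := hu k
  obtain ⟨q, hq⟩ := hv (k + 1)
  refine ⟨p + (q + (Polynomial.X * 12 + 20)), fun n w S s hs => ?_⟩
  have hev : (p + (q + (Polynomial.X * 12 + 20))).eval n =
      p.eval n + (q.eval n + (n * 12 + 20)) := by simp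
  rw [hev]
  refine Ex.within_pair hs hp hq fun t h1 h2 h3 => ?_
  have ht := hs.agree h1
  refine (RAM.Within.ite (b := n * 12 + 8 + 3) (b' := 2) (fun h0 => ?_) fun h0 => ?_).mono
    (by simp [RAM.Expr.cost]; omega) fun _ h => h
  · refine (within_address n k _ _ t ht.size h2 h3).seq fun t' ht' => RAM.Within.set
      ⟨(h1.trans (ht'.1.mono (by omega))).trans (Agree.setTmp _ _ le_rfl _ _), ?_⟩
    rw [RAM.State.reg_setReg, if_pos rfl]
    simp only [RAM.Expr.eval, ht'.2, Ex.eval] at h0 ⊢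
    rw [ht'.1.1]
    exact ht.mat _ _ _ (by rw [ht.size, h3] at h0; omega)
  · refine RAM.Within.set ⟨h1.trans (Agree.setTmp _ _ le_rfl _ _), ?_⟩
    rw [RAM.State.reg_setReg, if_pos rfl]
    simp only [RAM.Expr.eval, Ex.eval] at h0 ⊢
    rw [ht.size, h3] at h0
    exact (hs.mat_zero _ _ _ (by omega)).symm

theorem Ex.correct_sum (i : ℕ) (e : Ex) (he : e.Correct) : (Ex.sum i e).Correct := by
  intro k
  obtain ⟨p, hp⟩ := he (k + 2)
  refine ⟨Polynomial.X * (p + 12) + 20, fun n w S s hs => ?_⟩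
  have hev : (Polynomial.X * (p + 12) + 20).eval n = n * (p.eval n + 12) + 20 := by simp
  rw [hev]
  -- During the loop the bound register itself is the counter, so the machine represents `S.setReg i
  -- j`; the old content waits in `tmp (k + 1)` and is restored at the end.
  set I : ℕ → RAM.State → Prop := fun j t => Represents n w (S.setReg i j) t ∧ t.arr = s.arr ∧
    (∀ r, r ≠ usr i → (∀ j, k ≤ j → r ≠ tmp j) → t.reg r = s.reg r) ∧
    t.reg (tmp k) = ∑ x ∈ Finset.range j, e.eval n w (S.setReg i x) ∧
    t.reg (tmp (k + 1)) = S.reg i with hI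
  have hloop := RAM.Within.count (n := n) (c := usr i) (b := p.eval n + 8) (I := I)
    (P := .seq (e.compile (k + 2)) <|
        .seq (.set (tmp k) (.add (.reg (tmp k)) (.reg (tmp (k + 2)))))
          (.set (usr i) (.add (.reg (usr i)) (.const 1))))
    (fun j t h => ⟨h.1.size, by rw [h.1.reg]; simp⟩)
    (by
      rintro j t hj ⟨h1, h2, h3, h4, h5⟩
      refine ((hp n w _ t h1).seq fun t' ht' => (RAM.Within.set (Q := fun t =>
        Represents n w (S.setReg i j) t ∧ t.arr = s.arr ∧
        (∀ r, r ≠ usr i → (∀ j, k ≤ j → r ≠ tmp j) → t.reg r = s.reg r) ∧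
        t.reg (tmp k) = ∑ x ∈ Finset.range (j + 1), e.eval n w (S.setReg i x) ∧
        t.reg (tmp (k + 1)) = S.reg i) ?_).seq fun t'' ht'' => RAM.Within.set (Q := I (j + 1)) ?_).mono
        (by simp [RAM.Expr.cost]) fun _ h => h
      · refine ⟨(h1.agree ht'.1).agree (Agree.setTmp k _ le_rfl _ _), ?_, ?_, ?_, ?_⟩
        · rw [RAM.State.arr_setReg, ht'.1.1, h2]
        · intro r hr hr'
          rw [RAM.State.reg_setReg, if_neg (hr' k le_rfl), ht'.1.2 r fun j hj => hr' j (by omega),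
            h3 r hr hr']
        · rw [RAM.State.reg_setReg, if_pos rfl, Finset.sum_range_succ]
          simp only [RAM.Expr.eval]
          rw [ht'.1.tmp k (by omega), h4, ht'.2]
        · rw [RAM.State.reg_setReg, if_neg (by simp), ht'.1.tmp _ (by omega), h5]
      · obtain ⟨g1, g2, g3, g4, g5⟩ := ht''
        have hr : RAM.Expr.eval t'' (.add (.reg (usr i)) (.const 1)) = j + 1 := by
          simp only [RAM.Expr.eval, g1.reg]; simp
        rw [hr]
        refine ⟨?_, g2, ?_, ?_, ?_⟩
        · have := g1.setReg i (j + 1)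
          rwa [St.setReg_setReg] at this
        · intro r hr hr'
          rw [RAM.State.reg_setReg, if_neg hr, g3 r hr hr']
        · rw [RAM.State.reg_setReg, if_neg (usr_ne_tmp i k).symm, g4]
        · rw [RAM.State.reg_setReg, if_neg (usr_ne_tmp i _).symm, g5])
  refine (RAM.Within.seq (RAM.Within.set (Q := fun t => Agree k s t ∧ t.reg (tmp k) = 0) ?_)
    fun t ht => RAM.Within.seq (RAM.Within.set (Q := fun t => Agree k s t ∧ t.reg (tmp k) = 0 ∧
      t.reg (tmp (k + 1)) = S.reg i) ?_) fun t ht => RAM.Within.seq (RAM.Within.set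
      (Q := I 0) ?_) fun t ht => (hloop t ht).seq fun t ht => RAM.Within.set ?_).mono
      (by simp [RAM.Expr.cost]; ring_nf; omega) fun _ h => h
  · refine ⟨Agree.setTmp _ _ le_rfl _ _, ?_⟩
    rw [RAM.State.reg_setReg, if_pos rfl]; rfl
  · refine ⟨ht.1.trans (Agree.setTmp _ _ (by omega) _ _), ?_, ?_⟩
    · rw [RAM.State.reg_setReg, if_neg (by simp), ht.2]
    · rw [RAM.State.reg_setReg, if_pos rfl]
      simp only [RAM.Expr.eval]
      rw [(hs.agree ht.1).reg]
  · obtain ⟨h1, h2, h3⟩ := ht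
    simp only [RAM.Expr.eval]
    refine ⟨(hs.agree h1).setReg i 0, h1.1, ?_, ?_, ?_⟩
    · intro r hr hr'
      rw [RAM.State.reg_setReg, if_neg hr, h1.2 r hr']
    · rw [RAM.State.reg_setReg, if_neg (usr_ne_tmp i k).symm, h2]; simp
    · rw [RAM.State.reg_setReg, if_neg (usr_ne_tmp i _).symm, h3]
  · obtain ⟨h1, h2, h3, h4, h5⟩ := ht
    refine ⟨⟨h2, fun r hr => ?_⟩, ?_⟩
    · rw [RAM.State.reg_setReg]
      split_ifs with h
      · simp only [RAM.Expr.eval]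
        rw [h5, h, hs.reg]
      · exact h3 r h hr
    · rw [RAM.State.reg_setReg, if_neg (usr_ne_tmp i k).symm, h4]
      rfl

theorem Ex.correct (e : Ex) : e.Correct := by
  induction e with
  | const c => exact fun k => Ex.correct_of_set _ _ k rfl fun _ _ _ _ _ => rfl
  | size => exact fun k => Ex.correct_of_set _ _ k rfl fun _ _ _ _ h => h.size
  | reg i => exact fun k => Ex.correct_of_set _ _ k rfl fun _ _ _ _ h => h.reg i
  | read a u v hu hv => exact Ex.correct_read a u v hu hv
  | input e he =>
    refine fun k => Ex.correct_unary _ _ _ he k rfl fun n w S s h h' => ?_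
    simp only [RAM.Expr.eval, Ex.eval]
    rw [h.input, h']
  | add e f he hf =>
    refine fun k => Ex.correct_binary _ _ _ _ he hf k rfl fun n w S s h h' => ?_
    simp only [RAM.Expr.eval, Ex.eval, h, h']
  | sub e f he hf =>
    refine fun k => Ex.correct_binary _ _ _ _ he hf k rfl fun n w S s h h' => ?_
    simp only [RAM.Expr.eval, Ex.eval, h, h']
  | half e he =>
    refine fun k => Ex.correct_unary _ _ _ he k rfl fun n w S s h h' => ?_
    simp only [RAM.Expr.eval, Ex.eval, h']
  | ite c e f hc he hf =>
    intro k
    obtain ⟨p, hp⟩ := hc k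
    obtain ⟨q, hq⟩ := he k
    obtain ⟨r, hr⟩ := hf k
    refine ⟨p + (2 + (q + r)), fun n w S s hs => ?_⟩
    have hev : (p + (2 + (q + r))).eval n = p.eval n + (2 + (q.eval n + r.eval n)) := by simp
    rw [hev]
    refine (hp n w S s hs).seq fun t ht => RAM.Within.ite (e := .reg (tmp k)) (fun h0 => ?_)
      fun h0 => ?_
    · refine (hq n w S t (hs.agree ht.1)).mono le_rfl fun t' ht' => ⟨ht.1.trans ht'.1, ?_⟩
      simp only [RAM.Expr.eval, ht.2] at h0
      simp only [Ex.eval, if_pos h0, ht'.2]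
    · refine (hr n w S t (hs.agree ht.1)).mono le_rfl fun t' ht' => ⟨ht.1.trans ht'.1, ?_⟩
      simp only [RAM.Expr.eval, ht.2] at h0
      simp only [Ex.eval, h0, ne_eq, not_true_eq_false, if_false, ht'.2]
  | sum i e he => exact Ex.correct_sum i e he

/-- The specification of the program compiled from a command. -/
def Cmd.Correct (P : Cmd) : Prop :=
  ∀ k, ∃ p : Polynomial ℕ, ∀ n w S s, Represents n w S s →
    RAM.Within (P.compile k) s (p.eval n)
      fun s' => Represents n w (P.run n w S) s' ∧ ∀ j < k, s'.reg (tmp j) = s.reg (tmp j)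

/-- For columns below `n` the address determines row and column, as its quotient and remainder
modulo `n`, so a write changes a single entry. -/
theorem Represents.setArr {n : ℕ} {w : ℕ → ℕ} {S : St} {s : RAM.State}
    (h : Represents n w S s) (a u v x : ℕ) (hv : v < n) :
    Represents n w (S.write n a u v x) (s.setArr (a + 2) (n * u + v) x) where
  size := h.size
  reg := h.reg
  mat a' u' v' hv' := by
    rw [RAM.State.arr_setArr, St.mat_write]
    have : (a' + 2 = a + 2 ∧ n * u' + v' = n * u + v) ↔ (a' = a ∧ u' = u ∧ v' = v ∧ v < n) := by
      constructor
      · rintro ⟨h1, h2⟩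
        have hdiv := congrArg (· / n) h2
        have hmod := congrArg (· % n) h2
        simp only [Nat.mul_add_mod, Nat.mod_eq_of_lt hv, Nat.mod_eq_of_lt hv',
          Nat.mul_add_div (by omega : n > 0), Nat.div_eq_of_lt hv, Nat.div_eq_of_lt hv'] at hdiv hmod
        omega
      · rintro ⟨rfl, rfl, rfl, -⟩
        exact ⟨rfl, rfl⟩
    simp only [this, h.mat a' u' v' hv']
  mat_zero a' u' v' hv' := by
    rw [St.mat_write, if_neg (by omega), h.mat_zero a' u' v' hv']
  input := by
    rw [← h.input]
    funext j
    rw [RAM.State.arr_setArr, if_neg (by omega)]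
  out := by
    rw [St.out_write, ← h.out]
    simp only [RAM.output, RAM.State.reg_setArr]
    refine List.map_congr_left fun j _ => ?_
    rw [RAM.State.arr_setArr, if_neg (by omega)]

theorem St.write_of_le (n : ℕ) (S : St) (a u v x : ℕ) (hv : n ≤ v) : S.write n a u v x = S := by
  have : ¬ v < n := by omega
  simp [St.write, this]

theorem Represents.emit {n : ℕ} {w : ℕ → ℕ} {S : St} {s : RAM.State}
    (h : Represents n w S s) (x : ℕ) :
    Represents n w { S with out := S.out ++ [x] }
      ((s.setArr 1 (s.reg 1) x).setReg 1 (s.reg 1 + 1)) where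
  size := by rw [RAM.State.reg_setReg, if_neg (by omega)]; exact h.size
  reg r := by rw [RAM.State.reg_setReg, if_neg (by unfold usr; omega)]; exact h.reg r
  mat a u v hv := by
    rw [RAM.State.arr_setReg, RAM.State.arr_setArr, if_neg (by omega)]
    exact h.mat a u v hv
  mat_zero := h.mat_zero
  input := by
    rw [← h.input]
    funext j
    rw [RAM.State.arr_setReg, RAM.State.arr_setArr, if_neg (by omega)]
  out := by
    have h1 : ((s.setArr 1 (s.reg 1) x).setReg 1 (s.reg 1 + 1)).reg 1 = s.reg 1 + 1 := by
      rw [RAM.State.reg_setReg, if_pos rfl]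
    rw [RAM.output, h1, List.range_succ, List.map_append]
    simp only [List.map_cons, List.map_nil, RAM.State.arr_setReg]
    congr 1
    · rw [← h.out, RAM.output]
      refine List.map_congr_left fun j hj => ?_
      rw [List.mem_range] at hj
      rw [RAM.State.arr_setArr, if_neg (by omega)]
    · rw [RAM.State.arr_setArr, if_pos ⟨rfl, rfl⟩]

theorem Cmd.correct_write (a : ℕ) (u v e : Ex) : (Cmd.write a u v e).Correct := by
  intro k
  obtain ⟨r, hr⟩ := e.correct k
  obtain ⟨p, hp⟩ := u.correct (k + 1)
  obtain ⟨q, hq⟩ := v.correct (k + 2)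
  refine ⟨r + (p + (q + (Polynomial.X * 12 + 20))), fun n w S s hs => ?_⟩
  have hev : (r + (p + (q + (Polynomial.X * 12 + 20)))).eval n =
      r.eval n + (p.eval n + (q.eval n + (n * 12 + 20))) := by simp
  rw [hev]
  refine (hr n w S s hs).seq fun t' ht' =>
    Ex.within_pair (hs.agree ht'.1) hp hq fun t h1 h2 h3 => ?_
  have hst : Agree k s t := ht'.1.trans (h1.mono (by omega))
  have ht := hs.agree hst
  have h4 : t.reg (tmp k) = e.eval n w S := by rw [h1.tmp _ (by omega), ht'.2]
  refine (RAM.Within.ite (b := n * 12 + 8 + 3) (b' := 1) (fun h0 => ?_) fun h0 => ?_).mono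
    (by simp [RAM.Expr.cost]; omega) fun _ h => h
  · simp only [RAM.Expr.eval] at h0
    rw [ht.size, h3] at h0
    refine (within_address n (k + 1) _ _ t ht.size h2 h3).seq fun z hz => RAM.Within.write ?_
    simp only [RAM.Expr.eval]
    rw [hz.2, hz.1.tmp k (by omega), h4]
    refine ⟨(ht.agree hz.1).setArr _ _ _ _ (by omega), fun j hj => ?_⟩
    rw [RAM.State.reg_setArr, hz.1.tmp j (by omega), hst.tmp j hj]
  · simp only [RAM.Expr.eval] at h0
    rw [ht.size, h3] at h0
    refine RAM.Within.skip ⟨?_, fun j hj => hst.tmp j hj⟩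
    simp only [Cmd.run]
    rw [St.write_of_le _ _ _ _ _ _ (by omega)]
    exact ht

theorem Cmd.correct_forTo (i : ℕ) (P : Cmd) (hP : P.Correct) : (Cmd.forTo i P).Correct := by
  intro k
  obtain ⟨p, hp⟩ := hP (k + 1)
  refine ⟨Polynomial.X * (p + 12) + 20, fun n w S s hs => ?_⟩
  have hev : (Polynomial.X * (p + 12) + 20).eval n = n * (p.eval n + 12) + 20 := by simp
  rw [hev]
  set I : ℕ → RAM.State → Prop := fun j t =>
    Represents n w (iter (fun j S => P.run n w (S.setReg i j)) j S) t ∧ t.reg (tmp k) = j ∧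
    ∀ j < k, t.reg (tmp j) = s.reg (tmp j) with hI
  have hloop := RAM.Within.count (n := n) (c := tmp k) (b := p.eval n + 8) (I := I)
    (P := .seq (.set (usr i) (.reg (tmp k))) <|
      .seq (P.compile (k + 1)) (.set (tmp k) (.add (.reg (tmp k)) (.const 1))))
    (fun j t h => ⟨h.1.size, h.2.1⟩)
    (by
      rintro j t hj ⟨h1, h2, h3⟩
      refine ((RAM.Within.set (Q := fun t => Represents n w
        ((iter (fun j S => P.run n w (S.setReg i j)) j S).setReg i j) t ∧ t.reg (tmp k) = j ∧
        ∀ j < k, t.reg (tmp j) = s.reg (tmp j)) ?_).seq fun t' ht' => (hp n w _ t' ht'.1).seq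
        fun t'' ht'' => RAM.Within.set (Q := I (j + 1)) ?_).mono
        (by simp [RAM.Expr.cost]; omega) fun _ h => h
      · simp only [RAM.Expr.eval]
        rw [h2]
        refine ⟨h1.setReg i j, ?_, fun l hl => ?_⟩
        · rw [RAM.State.reg_setReg, if_neg (usr_ne_tmp _ _).symm, h2]
        · rw [RAM.State.reg_setReg, if_neg (usr_ne_tmp _ _).symm, h3 l hl]
      · refine ⟨ht''.1.agree (Agree.setTmp k k le_rfl _ _), ?_, fun l hl => ?_⟩
        · rw [RAM.State.reg_setReg, if_pos rfl]
          simp only [RAM.Expr.eval]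
          rw [ht''.2 k (by omega), ht'.2.1]
        · rw [RAM.State.reg_setReg, if_neg (by simp; omega), ht''.2 l (by omega), ht'.2.2 l hl])
  refine (RAM.Within.seq (RAM.Within.set (Q := I 0) ?_) fun t ht => (hloop t ht)).mono
      (by simp [RAM.Expr.cost]; ring_nf; omega) fun t ht => ⟨ht.1, ht.2.2⟩
  refine ⟨hs.agree (Agree.setTmp k k le_rfl _ _), ?_, fun l hl => ?_⟩
  · rw [RAM.State.reg_setReg, if_pos rfl]; rfl
  · rw [RAM.State.reg_setReg, if_neg (by simp; omega)]

theorem Cmd.correct (P : Cmd) : P.Correct := by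
  induction P with
  | skip => exact fun k => ⟨1, fun n w S s hs => by
      rw [Polynomial.eval_one]
      exact RAM.Within.skip ⟨hs, fun _ _ => rfl⟩⟩
  | set i e =>
    intro k
    obtain ⟨p, hp⟩ := e.correct k
    refine ⟨p + 2, fun n w S s hs => ?_⟩
    have hev : (p + 2).eval n = p.eval n + 2 := by simp
    rw [hev]
    refine (hp n w S s hs).seq fun t ht => RAM.Within.set ?_
    simp only [RAM.Expr.eval]
    rw [ht.2]
    refine ⟨(hs.agree ht.1).setReg _ _, fun j hj => ?_⟩
    rw [RAM.State.reg_setReg, if_neg (usr_ne_tmp _ _).symm, ht.1.tmp j hj]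
  | write a u v e => exact Cmd.correct_write a u v e
  | emit e =>
    intro k
    obtain ⟨p, hp⟩ := e.correct k
    refine ⟨p + 7, fun n w S s hs => ?_⟩
    have hev : (p + 7).eval n = p.eval n + (3 + 4) := by simp
    rw [hev]
    refine (hp n w S s hs).seq fun t ht => (RAM.Within.write (Q := fun t' =>
      t' = t.setArr 1 (t.reg 1) (e.eval n w S)) ?_).seq fun t' ht' => RAM.Within.set ?_
    · simp only [RAM.Expr.eval]
      rw [ht.2]
    · subst ht'
      simp only [RAM.Expr.eval, RAM.State.reg_setArr]
      refine ⟨(hs.agree ht.1).emit _, fun j hj => ?_⟩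
      rw [RAM.State.reg_setReg, if_neg (by unfold tmp; omega), RAM.State.reg_setArr,
        ht.1.tmp j hj]
  | seq P Q hP hQ =>
    intro k
    obtain ⟨p, hp⟩ := hP k
    obtain ⟨q, hq⟩ := hQ k
    refine ⟨p + q, fun n w S s hs => ?_⟩
    rw [Polynomial.eval_add]
    exact (hp n w S s hs).seq fun t ht => (hq n w _ t ht.1).mono le_rfl fun t' ht' =>
      ⟨ht'.1, fun j hj => (ht'.2 j hj).trans (ht.2 j hj)⟩
  | ite e P Q hP hQ =>
    intro k
    obtain ⟨r, hr⟩ := e.correct k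
    obtain ⟨p, hp⟩ := hP k
    obtain ⟨q, hq⟩ := hQ k
    refine ⟨r + (2 + (p + q)), fun n w S s hs => ?_⟩
    have hev : (r + (2 + (p + q))).eval n = r.eval n + (2 + (p.eval n + q.eval n)) := by simp
    rw [hev]
    refine (hr n w S s hs).seq fun t ht => RAM.Within.ite (e := .reg (tmp k)) (fun h0 => ?_)
      fun h0 => ?_
    · refine (hp n w S t (hs.agree ht.1)).mono le_rfl fun t' ht' => ?_
      simp only [RAM.Expr.eval, ht.2] at h0
      simp only [Cmd.run, if_pos h0]
      exact ⟨ht'.1, fun j hj => (ht'.2 j hj).trans (ht.1.tmp j hj)⟩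
    · refine (hq n w S t (hs.agree ht.1)).mono le_rfl fun t' ht' => ?_
      simp only [RAM.Expr.eval, ht.2] at h0
      simp only [Cmd.run, h0, ne_eq, not_true_eq_false, if_false]
      exact ⟨ht'.1, fun j hj => (ht'.2 j hj).trans (ht.1.tmp j hj)⟩
  | forTo i P hP => exact Cmd.correct_forTo i P hP

def St.init : St where
  reg _ := 0
  mat _ _ _ := 0
  out := []

theorem polynomial_eval_mono (p : Polynomial ℕ) {a b : ℕ} (h : a ≤ b) : p.eval a ≤ p.eval b := by
  rw [Polynomial.eval_eq_sum, Polynomial.eval_eq_sum]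
  exact Finset.sum_le_sum fun i _ => Nat.mul_le_mul_left _ (Nat.pow_le_pow_left h i)

/-- A problem is solvable in polynomial time if it is solved by a command whose loops are bounded by
an entry `n` of the input word, at the fixed position `p`, that does not exceed its size. -/
theorem solvableInPolyTime_of_run {α : Type} {enc : α → List ℕ} {Solves : α → List ℕ → Prop}
    (P : Cmd) (p : ℕ) (hsize : ∀ a, (enc a).getD p 0 ≤ RAM.wordSize (enc a))
    (h : ∀ a, Solves a (P.run ((enc a).getD p 0) (fun j => (enc a).getD j 0) St.init).out) :
    RAM.SolvableInPolyTime enc Solves := by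
  obtain ⟨q, hq⟩ := P.correct 0
  -- One initial instruction, of three steps, loads the loop bound from its position in the input.
  refine ⟨.seq (.set 2 (.read 0 (.const p))) (P.compile 0), q + 3, fun a => ?_⟩
  set n := (enc a).getD p 0 with hn
  set w := fun j => (enc a).getD j 0 with hw
  have h0 : Represents n w St.init ((RAM.init (enc a)).setReg 2 n) := by
    refine ⟨?_, fun r => ?_, fun _ _ _ _ => rfl, fun _ _ _ _ => rfl, rfl, ?_⟩
    · rw [RAM.State.reg_setReg, if_pos rfl]
    · rw [RAM.State.reg_setReg, if_neg (by unfold usr; omega)]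
      simp [RAM.init, St.init, usr]
    · rw [RAM.output, RAM.State.reg_setReg, if_neg (by omega)]
      simp [RAM.init, St.init]
  obtain ⟨t, s, he, ht, hs⟩ := (RAM.Within.set (e := .read 0 (.const p)) (i := 2)
    (s := RAM.init (enc a)) (Q := fun s => Represents n w St.init s) h0).seq
    fun s hs => (hq n w St.init s hs).mono le_rfl (Q' := Represents n w (P.run n w St.init))
      fun _ h => h.1
  refine ⟨t, s, he, ht.trans ?_, ?_⟩
  · have h1 : q.eval n ≤ q.eval (RAM.wordSize (enc a)) := polynomial_eval_mono q (hsize a)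
    have h2 : (RAM.Expr.read 0 (.const p)).cost + 1 = 3 := rfl
    rw [h2, Polynomial.eval_add, Polynomial.eval_ofNat]
    omega
  · rw [hs.out]
    exact h a

end Bounded

/-! ### Derived expressions and commands -/

open Classical in
/-- The number of `j < n` with the property `p`. -/
noncomputable def cnt (n : ℕ) (p : ℕ → Prop) : ℕ := ((Finset.range n).filter p).card

theorem cnt_congr {n : ℕ} {p q : ℕ → Prop} (h : ∀ j < n, (p j ↔ q j)) : cnt n p = cnt n q := by
  classical
  unfold cnt
  congr 1
  refine Finset.filter_congr fun j hj => h j (Finset.mem_range.1 hj)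

theorem cnt_le (n : ℕ) (p : ℕ → Prop) : cnt n p ≤ n := by
  classical
  unfold cnt
  exact (Finset.card_filter_le _ _).trans (by simp)

theorem cnt_of_forall {n : ℕ} {p : ℕ → Prop} (h : ∀ j < n, p j) : cnt n p = n := by
  classical
  unfold cnt
  rw [Finset.filter_true_of_mem, Finset.card_range]
  exact fun j hj => h j (Finset.mem_range.1 hj)

open Classical in
theorem cnt_eq_sum (n : ℕ) (p : ℕ → Prop) :
    cnt n p = ∑ j ∈ Finset.range n, if p j then 1 else 0 := by
  rw [cnt, Finset.card_filter]

theorem cnt_mono {n : ℕ} {p q : ℕ → Prop} (h : ∀ j < n, p j → q j) : cnt n p ≤ cnt n q := by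
  unfold cnt
  refine Finset.card_le_card fun j hj => ?_
  simp only [Finset.mem_filter, Finset.mem_range] at hj ⊢
  exact ⟨hj.1, h j hj.1 hj.2⟩

theorem cnt_pos {n : ℕ} {p : ℕ → Prop} : 0 < cnt n p ↔ ∃ j < n, p j := by
  unfold cnt
  rw [Finset.card_pos]
  simp [Finset.Nonempty]

theorem cnt_eq_zero {n : ℕ} {p : ℕ → Prop} : cnt n p = 0 ↔ ∀ j < n, ¬ p j := by
  have := cnt_pos (n := n) (p := p)
  constructor
  · intro h j hj hp
    have := this.2 ⟨j, hj, hp⟩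
    omega
  · intro h
    by_contra h0
    obtain ⟨j, hj, hp⟩ := this.1 (by omega)
    exact h j hj hp

/-- The least `j < n` with the property `p`, and `n` if there is none. -/
noncomputable def findN (n : ℕ) (p : ℕ → Prop) : ℕ := cnt n fun i => ¬ ∃ j < n, j ≤ i ∧ p j

/-- The indices without a witness at or below them are those below the least witness, so their
number is this witness. In this form a search is a sum. -/
theorem findN_eq_of_least {n a : ℕ} {p : ℕ → Prop} (ha : a < n) (hp : p a)
    (hmin : ∀ j < a, ¬ p j) : findN n p = a := by
  classical
  have : ((Finset.range n).filter fun i => ¬ ∃ j < n, j ≤ i ∧ p j) = Finset.range a := by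
    ext i
    simp only [Finset.mem_filter, Finset.mem_range]
    constructor
    · rintro ⟨hi, h⟩
      by_contra h'
      exact h ⟨a, ha, by omega, hp⟩
    · intro hi
      refine ⟨by omega, ?_⟩
      rintro ⟨j, -, hj, hpj⟩
      exact hmin j (by omega) hpj
  unfold findN cnt
  rw [← Finset.card_range a, ← this]
  congr

theorem findN_eq_of_not {n : ℕ} {p : ℕ → Prop} (h : ∀ j < n, ¬ p j) : findN n p = n := by
  refine cnt_of_forall ?_
  rintro i - ⟨j, hj, -, hp⟩
  exact h j hj hp

theorem findN_spec {n : ℕ} {p : ℕ → Prop} (h : ∃ j < n, p j) :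
    findN n p < n ∧ p (findN n p) ∧ ∀ j < findN n p, ¬ p j := by
  classical
  have hf : ∃ j, j < n ∧ p j := h
  have := Nat.find_spec hf
  rw [findN_eq_of_least this.1 this.2 fun j hj hp => Nat.find_min hf hj ⟨by omega, hp⟩]
  exact ⟨this.1, this.2, fun j hj hp => Nat.find_min hf hj ⟨by omega, hp⟩⟩

theorem findN_lt {n : ℕ} {p : ℕ → Prop} (h : findN n p < n) : p (findN n p) := by
  by_contra h'
  by_cases hex : ∃ j < n, p j
  · exact h' (findN_spec hex).2.1
  · push Not at hex
    rw [findN_eq_of_not hex] at h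
    omega

/-- The least `j < n` that minimizes `f` under the condition `c`, and `n` if there is none. -/
noncomputable def argminN (n : ℕ) (c : ℕ → Prop) (f : ℕ → ℕ) : ℕ :=
  findN n fun v => c v ∧ ∀ u < n, c u → f v ≤ f u

theorem argminN_spec {n : ℕ} {c : ℕ → Prop} {f : ℕ → ℕ} (h : ∃ j < n, c j) :
    argminN n c f < n ∧ c (argminN n c f) ∧ ∀ u < n, c u → f (argminN n c f) ≤ f u := by
  classical
  obtain ⟨j, hj, hc⟩ := h
  obtain ⟨v, hv, hmin⟩ := Finset.exists_min_image ((Finset.range n).filter c) f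
    ⟨j, by simp [hj, hc]⟩
  simp only [Finset.mem_filter, Finset.mem_range] at hv hmin
  have := findN_spec (n := n) (p := fun v => c v ∧ ∀ u < n, c u → f v ≤ f u)
    ⟨v, hv.1, hv.2, fun u hu hcu => hmin u ⟨hu, hcu⟩⟩
  exact ⟨this.1, this.2.1.1, this.2.1.2⟩

theorem argminN_lt {n : ℕ} {c : ℕ → Prop} {f : ℕ → ℕ} (h : argminN n c f < n) :
    c (argminN n c f) := (findN_lt h).1

/-! ### Conditions, quantifiers and searches as expressions. -/

namespace Bounded

/-- An expression used as a condition holds if its value is not zero. -/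
def Ex.holds (n : ℕ) (w : ℕ → ℕ) (e : Ex) (S : St) : Prop := e.eval n w S ≠ 0

/-- Truth is a nonzero value. A truncated difference is nonzero exactly for a strict inequality, and
a sum is nonzero exactly if some summand is. -/
def Ex.lt (e f : Ex) : Ex := .sub f e
def Ex.le (e f : Ex) : Ex := .sub (.add f (.const 1)) e
def Ex.not (e : Ex) : Ex := .sub (.const 1) e
def Ex.and (e f : Ex) : Ex := .ite e f (.const 0)
def Ex.imp (e f : Ex) : Ex := .ite e f (.const 1)
def Ex.eq (e f : Ex) : Ex := .and (.le e f) (.le f e)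
def Ex.all (i : ℕ) (e : Ex) : Ex := .not (.sum i (.not e))
def Ex.ex (i : ℕ) (e : Ex) : Ex := .sum i e
def Ex.ind (e : Ex) : Ex := .ite e (.const 1) (.const 0)
def Ex.cnt (i : ℕ) (e : Ex) : Ex := .sum i (.ind e)
def Ex.find (i j : ℕ) (e : Ex) : Ex := .sum i (.not (.ex j (.and (.le (.reg j) (.reg i)) e)))
def Ex.vec (a : ℕ) (v : Ex) : Ex := .read a (.const 0) v

/-- Here `c` and `f` are a condition and a value that depend on the content of a register. -/
def Ex.argmin (i j k : ℕ) (c f : ℕ → Ex) : Ex :=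
  .find i j (.and (c j) (.all k (.imp (c k) (.le (f j) (f k)))))

section Eval

variable (n : ℕ) (w : ℕ → ℕ) (S : St)

@[simp] theorem Ex.eval_const (c : ℕ) : (Ex.const c).eval n w S = c := rfl
@[simp] theorem Ex.eval_size : Ex.size.eval n w S = n := rfl
@[simp] theorem Ex.eval_reg (i : ℕ) : (Ex.reg i).eval n w S = S.reg i := rfl
@[simp] theorem Ex.eval_read (a : ℕ) (u v : Ex) :
    (Ex.read a u v).eval n w S = S.mat a (u.eval n w S) (v.eval n w S) := rfl
@[simp] theorem Ex.eval_input (e : Ex) : (Ex.input e).eval n w S = w (e.eval n w S) := rfl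
@[simp] theorem Ex.eval_add (e f : Ex) :
    (Ex.add e f).eval n w S = e.eval n w S + f.eval n w S := rfl
@[simp] theorem Ex.eval_half (e : Ex) : (Ex.half e).eval n w S = e.eval n w S / 2 := rfl
@[simp] theorem Ex.eval_sum (i : ℕ) (e : Ex) :
    (Ex.sum i e).eval n w S = ∑ j ∈ Finset.range n, e.eval n w (S.setReg i j) := rfl
@[simp] theorem Ex.eval_vec (a : ℕ) (v : Ex) :
    (Ex.vec a v).eval n w S = S.mat a 0 (v.eval n w S) := rfl

open Classical in
@[simp] theorem Ex.eval_ite (c e f : Ex) :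
    (Ex.ite c e f).eval n w S = if c.holds n w S then e.eval n w S else f.eval n w S := by
  simp only [Ex.eval, Ex.holds]
  congr

@[simp] theorem Ex.holds_reg (i : ℕ) : (Ex.reg i).holds n w S ↔ S.reg i ≠ 0 := Iff.rfl
@[simp] theorem Ex.holds_read (a : ℕ) (u v : Ex) :
    (Ex.read a u v).holds n w S ↔ S.mat a (u.eval n w S) (v.eval n w S) ≠ 0 := Iff.rfl
@[simp] theorem Ex.holds_vec (a : ℕ) (v : Ex) :
    (Ex.vec a v).holds n w S ↔ S.mat a 0 (v.eval n w S) ≠ 0 := Iff.rfl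
@[simp] theorem Ex.holds_lt (e f : Ex) :
    (Ex.lt e f).holds n w S ↔ e.eval n w S < f.eval n w S := by
  simp only [Ex.holds, Ex.lt, Ex.eval]; omega
@[simp] theorem Ex.holds_le (e f : Ex) :
    (Ex.le e f).holds n w S ↔ e.eval n w S ≤ f.eval n w S := by
  simp only [Ex.holds, Ex.le, Ex.eval]; omega
@[simp] theorem Ex.holds_not (e : Ex) : (Ex.not e).holds n w S ↔ ¬ e.holds n w S := by
  simp only [Ex.holds, Ex.not, Ex.eval]; omega
@[simp] theorem Ex.holds_and (e f : Ex) :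
    (Ex.and e f).holds n w S ↔ e.holds n w S ∧ f.holds n w S := by
  by_cases h : e.eval n w S = 0 <;> simp [Ex.holds, Ex.and, h]
@[simp] theorem Ex.holds_imp (e f : Ex) :
    (Ex.imp e f).holds n w S ↔ (e.holds n w S → f.holds n w S) := by
  by_cases h : e.eval n w S = 0 <;> simp [Ex.holds, Ex.imp, h]
@[simp] theorem Ex.holds_eq (e f : Ex) :
    (Ex.eq e f).holds n w S ↔ e.eval n w S = f.eval n w S := by
  simp only [Ex.eq, Ex.holds_and, Ex.holds_le]; omega
@[simp] theorem Ex.holds_ex (i : ℕ) (e : Ex) :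
    (Ex.ex i e).holds n w S ↔ ∃ j < n, e.holds n w (S.setReg i j) := by
  simp [Ex.holds, Ex.ex, Finset.sum_eq_zero_iff]
@[simp] theorem Ex.holds_all (i : ℕ) (e : Ex) :
    (Ex.all i e).holds n w S ↔ ∀ j < n, e.holds n w (S.setReg i j) := by
  have : (Ex.all i e).holds n w S ↔ ¬ (Ex.ex i (Ex.not e)).holds n w S := Ex.holds_not n w S _
  rw [this]
  simp
open Classical in
@[simp] theorem Ex.eval_ind (e : Ex) :
    (Ex.ind e).eval n w S = if e.holds n w S then 1 else 0 := by
  simp [Ex.ind]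
@[simp] theorem Ex.holds_ind (e : Ex) : (Ex.ind e).holds n w S ↔ e.holds n w S := by
  by_cases h : e.holds n w S
  · simp [Ex.holds] at h ⊢; simp [h]
  · simp [Ex.holds] at h ⊢; simp [h]
@[simp] theorem Ex.eval_cnt (i : ℕ) (e : Ex) :
    (Ex.cnt i e).eval n w S = _root_.cnt n fun j => e.holds n w (S.setReg i j) := by
  classical
  simp only [Ex.cnt, Ex.eval_sum, Ex.eval_ind, _root_.cnt, Finset.card_filter]

/-- The search runs through register `j` inside a count over register `i`, so the condition has to
mean the same for every content `x` of register `i`. -/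
theorem Ex.eval_find {i j : ℕ} {e : Ex} (hij : i ≠ j) (p : ℕ → Prop)
    (hp : ∀ x, ∀ v < n, e.holds n w ((S.setReg i x).setReg j v) ↔ p v) :
    (Ex.find i j e).eval n w S = findN n p := by
  classical
  have h1 : ∀ T, ((Ex.ex j (.and (.le (.reg j) (.reg i)) e)).not).eval n w T =
      if ((Ex.ex j (.and (.le (.reg j) (.reg i)) e)).not).holds n w T then 1 else 0 := by
    intro T
    by_cases h : ((Ex.ex j (.and (.le (.reg j) (.reg i)) e)).not).holds n w T
    · rw [if_pos h]
      simp only [Ex.holds, Ex.not, Ex.eval] at h ⊢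
      omega
    · rw [if_neg h]
      simpa [Ex.holds] using h
  simp only [Ex.find, Ex.eval_sum, h1, findN, cnt_eq_sum]
  refine Finset.sum_congr rfl fun x hx => ?_
  have : ((Ex.ex j (.and (.le (.reg j) (.reg i)) e)).not).holds n w (S.setReg i x) ↔
      ¬ ∃ j < n, j ≤ x ∧ p j := by
    simp only [Ex.holds_not, Ex.holds_ex, Ex.holds_and, Ex.holds_le, Ex.eval_reg, St.reg_setReg]
    refine not_congr <| exists_congr fun v => and_congr_right fun hv => ?_
    rw [hp x v hv]
    simp [hij]
  simp only [this]
  congr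

theorem Ex.eval_argmin {i j k : ℕ} {c f : ℕ → Ex} (hij : i ≠ j) (C : ℕ → Prop) (F : ℕ → ℕ)
    (hC : ∀ x, ∀ v < n, (c j).holds n w ((S.setReg i x).setReg j v) ↔ C v)
    (hC' : ∀ x, ∀ v < n, ∀ u < n,
      (c k).holds n w (((S.setReg i x).setReg j v).setReg k u) ↔ C u)
    (hF : ∀ x, ∀ v < n, ∀ u < n, (f j).eval n w (((S.setReg i x).setReg j v).setReg k u) = F v)
    (hF' : ∀ x, ∀ v < n, ∀ u < n,
      (f k).eval n w (((S.setReg i x).setReg j v).setReg k u) = F u) :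
    (Ex.argmin i j k c f).eval n w S = argminN n C F := by
  refine Ex.eval_find n w S hij _ fun x v hv => ?_
  simp only [Ex.holds_and, Ex.holds_all, Ex.holds_imp, Ex.holds_le]
  refine and_congr (hC x v hv) (forall₂_congr fun u hu => ?_)
  rw [hC' x v hv u hu, hF x v hv u hu, hF' x v hv u hu]

end Eval

/-! #### What a command does not change -/

/-- These tests are syntactic and computable; for a concrete program they are settled by `rfl`. -/
def Ex.readsMat (a : ℕ) : Ex → Bool
  | .const _ => false
  | .size => false
  | .reg _ => false
  | .read b u v => a == b || u.readsMat a || v.readsMat a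
  | .input e => e.readsMat a
  | .add e f => e.readsMat a || f.readsMat a
  | .sub e f => e.readsMat a || f.readsMat a
  | .half e => e.readsMat a
  | .ite c e f => c.readsMat a || e.readsMat a || f.readsMat a
  | .sum _ e => e.readsMat a

theorem Ex.eval_congr (n : ℕ) (w : ℕ → ℕ) (a : ℕ) (e : Ex) (h : e.readsMat a = false) (S S' : St)
    (hr : S.reg = S'.reg) (hm : ∀ b ≠ a, S.mat b = S'.mat b) : e.eval n w S = e.eval n w S' := by
  induction e generalizing S S' with
  | const c => rfl
  | size => rfl
  | reg i => simp [hr]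
  | read b u v hu hv =>
    simp only [Ex.readsMat, Bool.or_eq_false_iff, beq_eq_false_iff_ne] at h
    simp only [Ex.eval_read, hu h.1.2 S S' hr hm, hv h.2 S S' hr hm, hm b (Ne.symm h.1.1)]
  | input e he => simp [he h S S' hr hm]
  | add e f he hf =>
    simp only [Ex.readsMat, Bool.or_eq_false_iff] at h
    simp [he h.1 S S' hr hm, hf h.2 S S' hr hm]
  | sub e f he hf =>
    simp only [Ex.readsMat, Bool.or_eq_false_iff] at h
    simp [Ex.eval, he h.1 S S' hr hm, hf h.2 S S' hr hm]
  | half e he => simp [he h S S' hr hm]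
  | ite c e f hc he hf =>
    simp only [Ex.readsMat, Bool.or_eq_false_iff] at h
    simp only [Ex.eval, hc h.1.1 S S' hr hm, he h.1.2 S S' hr hm, hf h.2 S S' hr hm]
  | sum i e he =>
    simp only [Ex.eval_sum]
    refine Finset.sum_congr rfl fun j _ => he h _ _ ?_ hm
    funext r
    simp [hr]

def Cmd.setsReg (r : ℕ) : Cmd → Bool
  | .skip => false
  | .set i _ => i == r
  | .write _ _ _ _ => false
  | .emit _ => false
  | .seq P Q => P.setsReg r || Q.setsReg r
  | .ite _ P Q => P.setsReg r || Q.setsReg r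
  | .forTo i P => i == r || P.setsReg r

def Cmd.setsMat (a : ℕ) : Cmd → Bool
  | .skip => false
  | .set _ _ => false
  | .write b _ _ _ => b == a
  | .emit _ => false
  | .seq P Q => P.setsMat a || Q.setsMat a
  | .ite _ P Q => P.setsMat a || Q.setsMat a
  | .forTo _ P => P.setsMat a

def Cmd.emits : Cmd → Bool
  | .emit _ => true
  | .seq P Q => P.emits || Q.emits
  | .ite _ P Q => P.emits || Q.emits
  | .forTo _ P => P.emits
  | _ => false

theorem iter_induct {f : ℕ → St → St} {n : ℕ} {S : St} (I : ℕ → St → Prop) (h0 : I 0 S)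
    (hs : ∀ j < n, ∀ T, I j T → I (j + 1) (f j T)) : I n (iter f n S) := by
  suffices ∀ m ≤ n, I m (iter f m S) from this n le_rfl
  intro m
  induction m with
  | zero => exact fun _ => h0
  | succ m ih => exact fun hm => hs m (by omega) _ (ih (by omega))

variable {n : ℕ} {w : ℕ → ℕ}

theorem Cmd.run_seq (P Q : Cmd) (S : St) :
    (Cmd.seq P Q).run n w S = Q.run n w (P.run n w S) := rfl

theorem Cmd.run_set (i : ℕ) (e : Ex) (S : St) :
    (Cmd.set i e).run n w S = S.setReg i (e.eval n w S) := rfl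

theorem Cmd.run_forTo_induct {i : ℕ} {P : Cmd} {S : St} (I : ℕ → St → Prop) (h0 : I 0 S)
    (hs : ∀ j < n, ∀ T, I j T → I (j + 1) (P.run n w (T.setReg i j))) :
    I n ((Cmd.forTo i P).run n w S) :=
  iter_induct I h0 hs

theorem Cmd.run_reg {P : Cmd} {r : ℕ} (h : P.setsReg r = false) (S : St) :
    (P.run n w S).reg r = S.reg r := by
  induction P generalizing S with
  | skip => rfl
  | set i e =>
    simp only [Cmd.setsReg, beq_eq_false_iff_ne] at h
    simp [Cmd.run, Ne.symm h]
  | write a u v e => rfl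
  | emit e => rfl
  | seq P Q hP hQ =>
    simp only [Cmd.setsReg, Bool.or_eq_false_iff] at h
    simp only [Cmd.run]
    rw [hQ h.2, hP h.1]
  | ite e P Q hP hQ =>
    simp only [Cmd.setsReg, Bool.or_eq_false_iff] at h
    simp only [Cmd.run]
    split_ifs
    · exact hP h.1 S
    · exact hQ h.2 S
  | forTo i P hP =>
    simp only [Cmd.setsReg, Bool.or_eq_false_iff, beq_eq_false_iff_ne] at h
    simp only [Cmd.run]
    refine iter_induct (fun _ T => T.reg r = S.reg r) rfl fun j _ T hT => ?_
    rw [hP h.2, ← hT]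
    simp [Ne.symm h.1]

theorem Cmd.run_mat {P : Cmd} {a : ℕ} (h : P.setsMat a = false) (S : St) :
    (P.run n w S).mat a = S.mat a := by
  induction P generalizing S with
  | skip => rfl
  | set i e => rfl
  | write b u v e =>
    simp only [Cmd.setsMat, beq_eq_false_iff_ne] at h
    simp only [Cmd.run]
    funext u' v'
    rw [St.mat_write, if_neg (by simp [Ne.symm h])]
  | emit e => rfl
  | seq P Q hP hQ =>
    simp only [Cmd.setsMat, Bool.or_eq_false_iff] at h
    simp only [Cmd.run]
    rw [hQ h.2, hP h.1]
  | ite e P Q hP hQ =>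
    simp only [Cmd.setsMat, Bool.or_eq_false_iff] at h
    simp only [Cmd.run]
    split_ifs
    · exact hP h.1 S
    · exact hQ h.2 S
  | forTo i P hP =>
    simp only [Cmd.setsMat] at h
    simp only [Cmd.run]
    refine iter_induct (fun _ T => T.mat a = S.mat a) rfl fun j _ T hT => ?_
    rw [hP h, ← hT]
    rfl

theorem Cmd.run_out {P : Cmd} (h : P.emits = false) (S : St) : (P.run n w S).out = S.out := by
  induction P generalizing S with
  | skip => rfl
  | set i e => rfl
  | write b u v e => rfl
  | emit e => simp [Cmd.emits] at h
  | seq P Q hP hQ =>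
    simp only [Cmd.emits, Bool.or_eq_false_iff] at h
    simp only [Cmd.run]
    rw [hQ h.2, hP h.1]
  | ite e P Q hP hQ =>
    simp only [Cmd.emits, Bool.or_eq_false_iff] at h
    simp only [Cmd.run]
    split_ifs
    · exact hP h.1 S
    · exact hQ h.2 S
  | forTo i P hP =>
    simp only [Cmd.emits] at h
    simp only [Cmd.run]
    refine iter_induct (fun _ T => T.out = S.out) rfl fun j _ T hT => ?_
    rw [hP h, ← hT]
    rfl

/-! #### Filling arrays and emitting lists -/

def Cmd.fill (a i : ℕ) (e : Ex) : Cmd := .forTo i (.write a (.const 0) (.reg i) e)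

def Cmd.fill₂ (a i j : ℕ) (e : Ex) : Cmd :=
  .forTo i (.forTo j (.write a (.reg i) (.reg j) e))

/-- As `e` does not read the array being filled, the entries already written do not influence the
later ones, and each is the value of `e` in the initial state. -/
theorem Cmd.fill_mat {a i : ℕ} {e : Ex} (he : e.readsMat a = false) (S : St) {v : ℕ} (hv : v < n) :
    ((Cmd.fill a i e).run n w S).mat a 0 v = e.eval n w (S.setReg i v) := by
  have := iter_induct (n := n) (S := S)
    (f := fun j S => (Cmd.write a (.const 0) (.reg i) e).run n w (S.setReg i j))
    (fun m T => (∀ r ≠ i, T.reg r = S.reg r) ∧ (∀ b ≠ a, T.mat b = S.mat b) ∧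
      ∀ v < m, T.mat a 0 v = e.eval n w (S.setReg i v)) ⟨fun _ _ => rfl, fun _ _ => rfl, by simp⟩
    (by
      rintro m hm T ⟨h1, h2, h3⟩
      refine ⟨fun r hr => ?_, fun b hb => ?_, fun v hv => ?_⟩
      · rw [Cmd.run_reg rfl, St.reg_setReg, if_neg hr, h1 r hr]
      · rw [Cmd.run_mat (by simp [Cmd.setsMat, Ne.symm hb]), St.mat_setReg, h2 b hb]
      · simp only [Cmd.run, Ex.eval_const, Ex.eval_reg, St.reg_setReg, if_true, St.mat_write]
        by_cases hvm : v = m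
        · subst hvm
          rw [if_pos (by simpa using hm)]
          refine Ex.eval_congr n w a e he _ _ ?_ h2
          funext r
          by_cases hr : r = i
          · simp [hr]
          · simp [hr, h1 r hr]
        · rw [if_neg (by omega)]
          exact h3 v (by omega))
  exact this.2.2 v hv

theorem Cmd.fill_mat_of_le {a i : ℕ} {e : Ex} (S : St) {u v : ℕ} (hv : n ≤ v) :
    ((Cmd.fill a i e).run n w S).mat a u v = S.mat a u v := by
  refine iter_induct (fun _ T => T.mat a u v = S.mat a u v) rfl fun j hj T hT => ?_
  simp only [Cmd.run, Ex.eval_const, Ex.eval_reg, St.reg_setReg, if_true, St.mat_write]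
  rw [if_neg (by omega), ← hT]
  rfl

theorem Cmd.fill₂_mat_of_le {a i j : ℕ} {e : Ex} (hij : i ≠ j) (S : St) {u v : ℕ}
    (huv : n ≤ u ∨ n ≤ v) :
    ((Cmd.fill₂ a i j e).run n w S).mat a u v = S.mat a u v := by
  refine Cmd.run_forTo_induct (fun _ T => T.mat a u v = S.mat a u v) rfl fun l hl T hT => ?_
  refine (Cmd.run_forTo_induct (S := T.setReg i l)
    (fun _ T' => T'.reg i = l ∧ T'.mat a u v = S.mat a u v) ⟨by simp, hT⟩ fun m hm T' hT' => ⟨?_, ?_⟩).2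
  · rw [Cmd.run_reg rfl, St.reg_setReg, if_neg hij, hT'.1]
  · simp only [Cmd.run, Ex.eval_reg, St.reg_setReg, if_true, St.mat_write, if_neg hij]
    rw [if_neg (by rw [hT'.1]; omega), ← hT'.2]
    rfl

theorem Cmd.fill₂_mat {a i j : ℕ} {e : Ex} (hij : i ≠ j) (he : e.readsMat a = false) (S : St)
    {u v : ℕ} (hu : u < n) (hv : v < n) :
    ((Cmd.fill₂ a i j e).run n w S).mat a u v = e.eval n w ((S.setReg i u).setReg j v) := by
  have := iter_induct (n := n) (S := S)
    (f := fun l S => (Cmd.forTo j (.write a (.reg i) (.reg j) e)).run n w (S.setReg i l))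
    (fun m T => (∀ r, r ≠ i → r ≠ j → T.reg r = S.reg r) ∧ (∀ b ≠ a, T.mat b = S.mat b) ∧
      ∀ u < m, ∀ v < n, T.mat a u v = e.eval n w ((S.setReg i u).setReg j v))
    ⟨fun _ _ _ => rfl, fun _ _ => rfl, by simp⟩
    (by
      rintro m hm T ⟨h1, h2, h3⟩
      refine ⟨fun r hr hr' => ?_, fun b hb => ?_, ?_⟩
      · rw [Cmd.run_reg (by simp [Cmd.setsReg, Ne.symm hr']), St.reg_setReg, if_neg hr, h1 r hr hr']
      · rw [Cmd.run_mat (by simp [Cmd.setsMat, Ne.symm hb]), St.mat_setReg, h2 b hb]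
      · have := iter_induct (n := n) (S := T.setReg i m)
          (f := fun l S => (Cmd.write a (.reg i) (.reg j) e).run n w (S.setReg j l))
          (fun l T' => (∀ r, r ≠ i → r ≠ j → T'.reg r = S.reg r) ∧ T'.reg i = m ∧
            (∀ b ≠ a, T'.mat b = S.mat b) ∧
            (∀ u < m, ∀ v < n, T'.mat a u v = e.eval n w ((S.setReg i u).setReg j v)) ∧
            ∀ v < l, T'.mat a m v = e.eval n w ((S.setReg i m).setReg j v))
          ⟨fun r hr hr' => by simp [hr, h1 r hr hr'], by simp, h2, h3, by simp⟩
          (by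
            rintro l hl T' ⟨g1, g2, g3, g4, g5⟩
            refine ⟨fun r hr hr' => ?_, ?_, fun b hb => ?_, fun u hu v hv => ?_, fun v hv => ?_⟩
            · rw [Cmd.run_reg rfl, St.reg_setReg, if_neg hr', g1 r hr hr']
            · rw [Cmd.run_reg rfl, St.reg_setReg, if_neg hij, g2]
            · rw [Cmd.run_mat (by simp [Cmd.setsMat, Ne.symm hb]), St.mat_setReg, g3 b hb]
            · simp only [Cmd.run, Ex.eval_reg, St.reg_setReg, if_true, St.mat_write]
              rw [if_neg (by rw [if_neg hij, g2]; omega)]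
              exact g4 u hu v hv
            · simp only [Cmd.run, Ex.eval_reg, St.reg_setReg, if_true, St.mat_write]
              rw [if_neg hij, g2]
              by_cases hvl : v = l
              · subst hvl
                rw [if_pos (by simpa using hl)]
                refine Ex.eval_congr n w a e he _ _ ?_ g3
                funext r
                by_cases hr : r = j
                · simp [hr]
                · by_cases hr' : r = i
                  · simp [hr', hij, g2]
                  · simp [hr, hr', g1 r hr' hr]
              · rw [if_neg (by omega)]
                exact g5 v (by omega))
        intro u hu v hv
        by_cases hum : u = m
        · subst hum
          exact this.2.2.2.2 v hv
        · exact this.2.2.2.1 u (by omega) v hv)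
  exact this.2.2 u hu v hv

theorem Cmd.run_for_emit {i : ℕ} {e : Ex} (S : St) (g : ℕ → ℕ)
    (hg : ∀ v < n, ∀ T : St, (∀ r ≠ i, T.reg r = S.reg r) → T.mat = S.mat →
      e.eval n w (T.setReg i v) = g v) :
    ((Cmd.forTo i (.emit e)).run n w S).out = S.out ++ (List.range n).map g := by
  have := iter_induct (n := n) (S := S)
    (f := fun j S => (Cmd.emit e).run n w (S.setReg i j))
    (fun m T => (∀ r ≠ i, T.reg r = S.reg r) ∧ T.mat = S.mat ∧
      T.out = S.out ++ (List.range m).map g) ⟨fun _ _ => rfl, rfl, by simp⟩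
    (by
      rintro m hm T ⟨h1, h2, h3⟩
      refine ⟨fun r hr => ?_, h2, ?_⟩
      · rw [Cmd.run_reg rfl, St.reg_setReg, if_neg hr, h1 r hr]
      · simp [Cmd.run, h3, hg m hm T h1 h2, List.range_succ])
  exact this.2.2

end Bounded

/-! ### Smallest-last orders and greedy colorings -/

theorem cnt_eq_succ {n : ℕ} {p : ℕ → Prop} {v : ℕ} (hv : v < n) (hp : p v) :
    cnt n p = cnt n (fun u => p u ∧ u ≠ v) + 1 := by
  classical
  have : (Finset.range n).filter p =
      insert v ((Finset.range n).filter fun u => p u ∧ u ≠ v) := by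
    ext u
    simp only [Finset.mem_filter, Finset.mem_range, Finset.mem_insert]
    by_cases h : u = v <;> simp [h, hv, hp]
  have h2 : v ∉ (Finset.range n).filter fun u => p u ∧ u ≠ v := by simp
  have h3 := Finset.card_insert_of_notMem h2
  rw [← this] at h3
  unfold cnt
  convert h3

/-- `rk` numbers the vertices in the order of their removal, always of a vertex of minimum degree
among those that remain. -/
structure IsRemovalRank (n : ℕ) (A : ℕ → ℕ → Prop) (rk : ℕ → ℕ) : Prop where
  pos : ∀ v < n, 0 < rk v
  le : ∀ v < n, rk v ≤ n
  inj : ∀ u < n, ∀ v < n, rk u = rk v → u = v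
  min : ∀ v < n, ∀ u < n, rk v ≤ rk u →
    cnt n (fun y => rk v ≤ rk y ∧ A v y) ≤ cnt n (fun y => rk v ≤ rk y ∧ A u y)

theorem IsRemovalRank.exists_rank {n : ℕ} {A : ℕ → ℕ → Prop} {rk : ℕ → ℕ}
    (h : IsRemovalRank n A rk) {i : ℕ} (hi : 0 < i) (hin : i ≤ n) : ∃ v < n, rk v = i := by
  classical
  have h1 : (Finset.range n).image rk ⊆ Finset.Icc 1 n := by
    intro x hx
    simp only [Finset.mem_image, Finset.mem_range, Finset.mem_Icc] at hx ⊢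
    obtain ⟨v, hv, rfl⟩ := hx
    exact ⟨h.pos v hv, h.le v hv⟩
  have h2 : ((Finset.range n).image rk).card = n := by
    rw [Finset.card_image_of_injOn, Finset.card_range]
    intro u hu v hv huv
    simp only [Finset.coe_range, Set.mem_Iio] at hu hv
    exact h.inj u hu v hv huv
  have h3 := Finset.eq_of_subset_of_card_le h1 (by simp [h2])
  have : i ∈ (Finset.range n).image rk := by rw [h3]; simp; omega
  simpa using this

/-- The state after the removal of `j` vertices; the other vertices have rank `0`. -/
structure IsPartialRank (n : ℕ) (A : ℕ → ℕ → Prop) (j : ℕ) (rk : ℕ → ℕ) : Prop where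
  le : ∀ v < n, rk v ≤ j
  cnt_zero : cnt n (fun v => rk v = 0) + j = n
  inj : ∀ u < n, ∀ v < n, rk u ≠ 0 → rk u = rk v → u = v
  min : ∀ v < n, rk v ≠ 0 → ∀ u < n, (rk u = 0 ∨ rk v ≤ rk u) →
    cnt n (fun y => (rk y = 0 ∨ rk v ≤ rk y) ∧ A v y) ≤
      cnt n (fun y => (rk y = 0 ∨ rk v ≤ rk y) ∧ A u y)

theorem IsPartialRank.zero (n : ℕ) (A : ℕ → ℕ → Prop) {rk : ℕ → ℕ} (h0 : ∀ v < n, rk v = 0) :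
    IsPartialRank n A 0 rk :=
  ⟨fun v hv => (h0 v hv).le, cnt_of_forall h0, fun u hu _ _ h => absurd (h0 u hu) h,
    fun v hv h => absurd (h0 v hv) h⟩

/-- For a vertex `v` removed earlier, the vertices present at its removal are those of rank `0` or
at least `rk v`. This set does not change when one of rank `0` receives the larger rank `j + 1`. For
the new vertex it is the set of all vertices of rank `0`, where its degree is minimal by choice. -/
theorem IsPartialRank.step {n : ℕ} {A : ℕ → ℕ → Prop} {j : ℕ} {rk : ℕ → ℕ}
    (h : IsPartialRank n A j rk) (hj : j < n) :
    let a := argminN n (fun v => rk v = 0) fun v => cnt n fun y => rk y = 0 ∧ A v y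
    a < n ∧ IsPartialRank n A (j + 1) (Function.update rk a (j + 1)) := by
  intro a
  obtain ⟨ha, hCa, hmin⟩ := argminN_spec (n := n) (c := fun v => rk v = 0)
    (f := fun v => cnt n fun y => rk y = 0 ∧ A v y) (cnt_pos.1 (by have := h.cnt_zero; omega))
  change a < n at ha
  change rk a = 0 at hCa
  change ∀ u < n, rk u = 0 → cnt n (fun y => rk y = 0 ∧ A a y) ≤ _ at hmin
  clear_value a
  obtain ⟨h2, h3, h4, h5⟩ := h
  refine ⟨ha, fun v hv => ?_, ?_, ?_, ?_⟩
  · rw [Function.update_apply]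
    split_ifs
    · omega
    · have := h2 v hv; omega
  · rw [cnt_eq_succ ha hCa] at h3
    have : cnt n (fun v => Function.update rk a (j + 1) v = 0) =
        cnt n (fun u => rk u = 0 ∧ u ≠ a) :=
      cnt_congr fun u _ => by by_cases hu : u = a <;> simp [hu]
    omega
  · intro u hu v hv hne heq
    have hu2 := h2 u hu
    have hv2 := h2 v hv
    rw [Function.update_apply] at hne
    rw [Function.update_apply, Function.update_apply] at heq
    by_cases hua : u = a <;> by_cases hva : v = a <;>
      simp only [hua, hva, if_true, if_false] at hne heq
    · rw [hua, hva]
    · omega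
    · omega
    · exact h4 u hu v hv hne heq
  · intro v hv hne u hu hle
    by_cases hva : v = a
    · subst hva
      have hcond : ∀ y < n, (Function.update rk v (j + 1) y = 0 ∨
          j + 1 ≤ Function.update rk v (j + 1) y) ↔ rk y = 0 := by
        intro y hy
        have := h2 y hy
        rw [Function.update_apply]
        split_ifs with hyv
        · subst hyv; simpa using hCa
        · omega
      simp only [Function.update_self] at hle ⊢
      rw [cnt_congr (p := fun y => _ ∧ A v y) (q := fun y => rk y = 0 ∧ A v y)
          fun y hy => by rw [hcond y hy],
        cnt_congr (p := fun y => _ ∧ A u y) (q := fun y => rk y = 0 ∧ A u y)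
          fun y hy => by rw [hcond y hy]]
      exact hmin u hu ((hcond u hu).1 hle)
    · rw [Function.update_of_ne hva] at hne hle ⊢
      have hv2 := h2 v hv
      have hcond : ∀ y < n, (Function.update rk a (j + 1) y = 0 ∨
          rk v ≤ Function.update rk a (j + 1) y) ↔ (rk y = 0 ∨ rk v ≤ rk y) := by
        intro y hy
        rw [Function.update_apply]
        split_ifs with hya
        · subst hya; omega
        · rfl
      rw [cnt_congr (p := fun y => _ ∧ A v y) (q := fun y => (rk y = 0 ∨ rk v ≤ rk y) ∧ A v y)
          fun y hy => by rw [hcond y hy],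
        cnt_congr (p := fun y => _ ∧ A u y) (q := fun y => (rk y = 0 ∨ rk v ≤ rk y) ∧ A u y)
          fun y hy => by rw [hcond y hy]]
      exact h5 v hv hne u hu ((hcond u hu).1 hle)

theorem IsPartialRank.isRemovalRank {n : ℕ} {A : ℕ → ℕ → Prop} {rk : ℕ → ℕ}
    (h : IsPartialRank n A n rk) : IsRemovalRank n A rk := by
  obtain ⟨h2, h3, h4, h5⟩ := h
  have hpos : ∀ v < n, rk v ≠ 0 := cnt_eq_zero.1 (by omega)
  refine ⟨fun v hv => Nat.pos_of_ne_zero (hpos v hv), h2,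
    fun u hu v hv => h4 u hu v hv (hpos u hu), fun v hv u hu huv => ?_⟩
  have := h5 v hv (hpos v hv) u hu (Or.inr huv)
  rwa [cnt_congr (p := fun y => _ ∧ A v y) (q := fun y => rk v ≤ rk y ∧ A v y)
      fun y hy => by simp [hpos y hy],
    cnt_congr (p := fun y => _ ∧ A u y) (q := fun y => rk v ≤ rk y ∧ A u y)
      fun y hy => by simp [hpos y hy]] at this

/-- The vertices of rank greater than `m` are colored. -/
def IsPartialGreedy (n : ℕ) (A : ℕ → ℕ → Prop) (rk : ℕ → ℕ) (m : ℕ) (col : ℕ → ℕ) : Prop :=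
  ∀ v < n, m < rk v → col v < n ∧ IsLeast {c | ∀ u < n, A v u → rk v < rk u → col u ≠ c} (col v)

theorem IsPartialGreedy.step {n : ℕ} {A : ℕ → ℕ → Prop} {rk : ℕ → ℕ} (hrk : IsRemovalRank n A rk)
    {m : ℕ} {col : ℕ → ℕ} (h : IsPartialGreedy n A rk (m + 1) col) (hm : m < n) :
    let v := findN n fun v => rk v = m + 1
    v < n ∧ IsPartialGreedy n A rk m (Function.update col v
      (findN n fun c => ∀ u < n, A v u → rk v < rk u → col u ≠ c)) := by
  classical
  intro v
  obtain ⟨hv, hrv, -⟩ := findN_spec (n := n) (p := fun v => rk v = m + 1)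
    (hrk.exists_rank (by omega) hm)
  change v < n at hv
  change rk v = m + 1 at hrv
  clear_value v
  refine ⟨hv, ?_⟩
  -- The vertices of larger rank differ from `v`, so they are at most `n - 1` and cannot occupy all
  -- `n` colors.
  have hex : ∃ c < n, ∀ u < n, A v u → rk v < rk u → col u ≠ c := by
    by_contra hne
    push Not at hne
    have hsub : Finset.range n ⊆ ((Finset.range n).erase v).image col := by
      intro c hc
      obtain ⟨u, hu, -, hr, hcu⟩ := hne c (Finset.mem_range.1 hc)
      refine Finset.mem_image.2 ⟨u, ?_, hcu⟩
      simp only [Finset.mem_erase, Finset.mem_range]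
      exact ⟨by rintro rfl; omega, hu⟩
    have h1 := (Finset.card_le_card hsub).trans Finset.card_image_le
    rw [Finset.card_erase_of_mem (by simpa using hv), Finset.card_range] at h1
    omega
  obtain ⟨hc, hcp, hcmin⟩ := findN_spec hex
  set c := findN n fun c => ∀ u < n, A v u → rk v < rk u → col u ≠ c with hcdef
  clear_value c
  -- The rank of `v` is the least among the vertices now colored, so the new color enters no
  -- constraint on a colored vertex.
  have hne : ∀ x < n, m < rk x → ∀ u < n, rk x < rk u → u ≠ v := by
    rintro x - hx u - hu rfl
    omega
  intro x hx hmx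
  have hset : {c' | ∀ u < n, A x u → rk x < rk u → Function.update col v c u ≠ c'} =
      {c' | ∀ u < n, A x u → rk x < rk u → col u ≠ c'} := by
    ext c'
    refine forall₂_congr fun u hu => forall₂_congr fun _ hr => ?_
    rw [Function.update_of_ne (hne x hx hmx u hu hr)]
  rw [hset]
  by_cases hxv : x = v
  · subst hxv
    rw [Function.update_self]
    refine ⟨hc, hcp, fun c' hc' => ?_⟩
    by_contra hlt
    exact hcmin c' (by omega) hc'
  · rw [Function.update_of_ne hxv]
    have : rk x ≠ m + 1 := fun h => hxv (hrk.inj x hx v hv (h.trans hrv.symm))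
    exact h x hx (by omega)

/-! ### Order and coloring as programs. -/

namespace Bounded

variable {n : ℕ} {w : ℕ → ℕ}

theorem St.mat_write_row (S : St) {a v x : ℕ} (hv : v < n) :
    (S.write n a 0 v x).mat a 0 = Function.update (S.mat a 0) v x := by
  funext y
  rw [St.mat_write, Function.update_apply]
  simp [hv]

theorem St.mat_write_of_ne (S : St) {a b u v x : ℕ} (h : b ≠ a) :
    (S.write n a u v x).mat b = S.mat b := by
  funext y z
  rw [St.mat_write]
  simp [h]

def orderStep : Cmd :=
  .seq
    (.set 1 (.argmin 10 11 12 (fun v => .eq (.vec 1 (.reg v)) (.const 0))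
      fun v => .cnt 13 (.and (.eq (.vec 1 (.reg 13)) (.const 0)) (.read 0 (.reg v) (.reg 13)))))
    (.write 1 (.const 0) (.reg 1) (.add (.reg 0) (.const 1)))

/-- Array `1` receives the ranks of the vertices of the graph in matrix `0`. -/
def orderCmd : Cmd := .forTo 0 orderStep

theorem orderCmd_spec (S : St) (h0 : ∀ v < n, S.mat 1 0 v = 0) :
    IsRemovalRank n (fun u v => S.mat 0 u v ≠ 0) ((orderCmd.run n w S).mat 1 0) := by
  refine (Cmd.run_forTo_induct (n := n) (w := w) (i := 0) (S := S) (P := orderStep)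
    (fun j T => T.mat 0 = S.mat 0 ∧ IsPartialRank n (fun u v => S.mat 0 u v ≠ 0) j (T.mat 1 0))
    ⟨rfl, .zero _ _ h0⟩ ?_).2.isRemovalRank
  rintro j hj T ⟨h1, h2⟩
  refine ⟨(Cmd.run_mat rfl _).trans h1, ?_⟩
  obtain ⟨ha, h3⟩ := h2.step hj
  have hev : (Ex.argmin 10 11 12 (fun v => .eq (.vec 1 (.reg v)) (.const 0))
      fun v => .cnt 13 (.and (.eq (.vec 1 (.reg 13)) (.const 0))
        (.read 0 (.reg v) (.reg 13)))).eval n w (T.setReg 0 j) =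
      argminN n (fun v => T.mat 1 0 v = 0)
        fun v => cnt n fun y => T.mat 1 0 y = 0 ∧ S.mat 0 v y ≠ 0 := by
    refine Ex.eval_argmin n w _ (by decide) _ _ ?_ ?_ ?_ ?_
    · intro x v hv; simp
    · intro x v hv u hu; simp
    · intro x v hv u hu; simp [h1]
    · intro x v hv u hu; simp [h1]
  simp only [orderStep, Cmd.run, hev, Ex.eval_const, Ex.eval_reg, Ex.eval_add, St.reg_setReg,
    if_true]
  rw [St.mat_write_row _ ha]
  exact h3

/-- Colors are given against the order of removal: round `j` treats the vertex of rank `n - j`,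
which is found as the one whose rank and `j` add up to `n`. -/
def colorStep : Cmd :=
  .seq (.set 1 (.find 10 11 (.eq (.add (.vec 1 (.reg 11)) (.reg 0)) .size))) <|
  .seq (.set 2 (.find 10 11 (.all 12 (.imp (.read 0 (.reg 1) (.reg 12))
    (.imp (.lt (.vec 1 (.reg 1)) (.vec 1 (.reg 12))) (.not (.eq (.vec 2 (.reg 12)) (.reg 11))))))))
  (.write 2 (.const 0) (.reg 1) (.reg 2))

/-- Array `2` receives the greedy coloring, for the ranks in array `1`. -/
def colorCmd : Cmd := .forTo 0 colorStep

theorem colorCmd_spec (S : St) {A : ℕ → ℕ → Prop} (hA : ∀ u v, S.mat 0 u v ≠ 0 ↔ A u v)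
    (hrk : IsRemovalRank n A (S.mat 1 0)) :
    IsPartialGreedy n A (S.mat 1 0) 0 ((colorCmd.run n w S).mat 2 0) := by
  have key := (Cmd.run_forTo_induct (n := n) (w := w) (i := 0) (S := S) (P := colorStep)
    (fun j T => T.mat 0 = S.mat 0 ∧ T.mat 1 = S.mat 1 ∧
      IsPartialGreedy n A (S.mat 1 0) (n - j) (T.mat 2 0))
    ⟨rfl, rfl, fun v hv h => absurd (hrk.le v hv) (by omega)⟩ ?_).2.2
  · rwa [Nat.sub_self] at key
  rintro j hj T ⟨h0, h1, h2⟩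
  refine ⟨(Cmd.run_mat rfl _).trans h0, (Cmd.run_mat rfl _).trans h1, ?_⟩
  obtain ⟨m, hm⟩ : ∃ m, n - j = m + 1 := ⟨n - j - 1, by omega⟩
  rw [hm] at h2
  obtain ⟨hv, h3⟩ := h2.step hrk (by omega)
  have hev : (Ex.find 10 11 (.eq (.add (.vec 1 (.reg 11)) (.reg 0)) .size)).eval n w
      (T.setReg 0 j) = findN n fun v => S.mat 1 0 v = m + 1 := by
    refine Ex.eval_find n w _ (by decide) _ fun x v hv => ?_
    simp [h1]
    omega
  set v := findN n fun v => S.mat 1 0 v = m + 1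
  have hev2 : (Ex.find 10 11 (.all 12 (.imp (.read 0 (.reg 1) (.reg 12))
    (.imp (.lt (.vec 1 (.reg 1)) (.vec 1 (.reg 12)))
      (.not (.eq (.vec 2 (.reg 12)) (.reg 11))))))).eval n w
      ((T.setReg 0 j).setReg 1 v) = findN n fun c => ∀ u < n, A v u →
        S.mat 1 0 v < S.mat 1 0 u → T.mat 2 0 u ≠ c := by
    refine Ex.eval_find n w _ (by decide) _ fun x c hc => ?_
    simp [h1, ← hA, h0]
  simp only [colorStep, Cmd.run, hev, hev2, Ex.eval_const, Ex.eval_reg, St.reg_setReg, if_true]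
  rw [St.mat_write_row _ (by simpa using hv)]
  have : n - (j + 1) = m := by omega
  rw [this]
  exact h3

end Bounded

/-! ### Contraction of edges in few triangles -/

/-- A graph on `{0, …, n - 1}`. -/
structure IsGraph (n : ℕ) (A : ℕ → ℕ → Prop) : Prop where
  symm : ∀ u v, A u v → A v u
  irrefl : ∀ u, ¬ A u u
  lt : ∀ u v, A u v → u < n

theorem IsGraph.lt' {n : ℕ} {A : ℕ → ℕ → Prop} (h : IsGraph n A) {u v : ℕ} (hA : A u v) : v < n :=
  h.lt _ _ (h.symm _ _ hA)

theorem IsGraph.ne {n : ℕ} {A : ℕ → ℕ → Prop} (h : IsGraph n A) {u v : ℕ} (hA : A u v) : u ≠ v := by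
  rintro rfl
  exact h.irrefl _ hA

/-- The set `s` induces a connected nonempty subgraph. -/
def ConnOn (A : ℕ → ℕ → Prop) (s : Set ℕ) : Prop :=
  s.Nonempty ∧ ∀ x ∈ s, ∀ y ∈ s, Relation.ReflTransGen (fun u v => u ∈ s ∧ v ∈ s ∧ A u v) x y

theorem ConnOn.singleton (A : ℕ → ℕ → Prop) (x : ℕ) : ConnOn A {x} :=
  ⟨⟨x, rfl⟩, by rintro _ rfl _ rfl; exact .refl⟩

theorem ConnOn.mono {A A' : ℕ → ℕ → Prop} {s : Set ℕ} (h : ConnOn A s)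
    (hA : ∀ u v, A u v → A' u v) : ConnOn A' s :=
  ⟨h.1, fun x hx y hy => (h.2 x hx y hy).lift id fun _ _ h => ⟨h.1, h.2.1, hA _ _ h.2.2⟩⟩

theorem ConnOn.union {A : ℕ → ℕ → Prop} (hA : ∀ u v, A u v → A v u) {s t : Set ℕ}
    (hs : ConnOn A s) (ht : ConnOn A t) {x y : ℕ} (hx : x ∈ s) (hy : y ∈ t) (hxy : A x y) :
    ConnOn A (s ∪ t) := by
  have h1 : ∀ u ∈ s, ∀ v ∈ s,
      Relation.ReflTransGen (fun u v => u ∈ s ∪ t ∧ v ∈ s ∪ t ∧ A u v) u v := fun u hu v hv =>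
    (hs.2 u hu v hv).lift id fun _ _ h => ⟨Or.inl h.1, Or.inl h.2.1, h.2.2⟩
  have h2 : ∀ u ∈ t, ∀ v ∈ t,
      Relation.ReflTransGen (fun u v => u ∈ s ∪ t ∧ v ∈ s ∪ t ∧ A u v) u v := fun u hu v hv =>
    (ht.2 u hu v hv).lift id fun _ _ h => ⟨Or.inr h.1, Or.inr h.2.1, h.2.2⟩
  refine ⟨⟨x, Or.inl hx⟩, ?_⟩
  rintro u (hu | hu) v (hv | hv)
  · exact h1 u hu v hv
  · exact ((h1 u hu x hx).tail ⟨Or.inl hx, Or.inr hy, hxy⟩).trans (h2 y hy v hv)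
  · exact ((h2 u hu y hy).tail ⟨Or.inr hy, Or.inl hx, hA _ _ hxy⟩).trans (h1 x hx v hv)
  · exact h2 u hu v hv

theorem ConnOn.insert {A : ℕ → ℕ → Prop} (hA : ∀ u v, A u v → A v u) {s : Set ℕ}
    (hs : ConnOn A s) {x y : ℕ} (hx : x ∈ s) (hxy : A x y) : ConnOn A (insert y s) := by
  rw [← Set.union_singleton]
  exact hs.union hA (.singleton A y) hx rfl hxy

/-- If the fibres of `f` over a connected set of the graph `B` are connected in `A`, and any two
adjacent ones are joined by an edge of `A`, then so is their union. -/
theorem ConnOn.preimage {A B : ℕ → ℕ → Prop} {f : ℕ → ℕ} {s d : Set ℕ}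
    (hs : ConnOn B s) (hf : ∀ a ∈ s, ConnOn A {u | u ∈ d ∧ f u = a})
    (hAB : ∀ a b, B a b → ∃ u ∈ d, ∃ v ∈ d, f u = a ∧ f v = b ∧ A u v) :
    ConnOn A {u | u ∈ d ∧ f u ∈ s} := by
  have hin : ∀ a ∈ s, ∀ u v, u ∈ d → f u = a → v ∈ d → f v = a → Relation.ReflTransGen
      (fun u v => u ∈ {u | u ∈ d ∧ f u ∈ s} ∧ v ∈ {u | u ∈ d ∧ f u ∈ s} ∧ A u v) u v := by
    intro a ha u v hu hfu hv hfv
    refine ((hf a ha).2 u ⟨hu, hfu⟩ v ⟨hv, hfv⟩).lift id ?_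
    rintro x y ⟨⟨hx, hfx⟩, ⟨hy, hfy⟩, hxy⟩
    exact ⟨⟨hx, hfx ▸ ha⟩, ⟨hy, hfy ▸ ha⟩, hxy⟩
  refine ⟨?_, ?_⟩
  · obtain ⟨a, ha⟩ := hs.1
    obtain ⟨u, hu, hfu⟩ := (hf a ha).1
    exact ⟨u, hu, hfu ▸ ha⟩
  · rintro x ⟨hx, hfx⟩ y ⟨hy, hfy⟩
    have h := hs.2 _ hfx _ hfy
    generalize hb : f y = b at h
    clear hfy
    -- Induction along a path in `B`: an edge of `A` leads into the next fibre, and the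
    -- connectedness of that fibre leads to any of its vertices.
    induction h generalizing y with
    | refl => exact hin _ hfx x y hx rfl hy hb
    | @tail b c _ h2 ih =>
      obtain ⟨hbs, hcs, hbc⟩ := h2
      obtain ⟨u, hu, v, hv, rfl, rfl, huv⟩ := hAB _ _ hbc
      refine ((ih u hu rfl).tail ⟨⟨hu, hbs⟩, ⟨hv, hcs⟩, huv⟩).trans ?_
      exact hin _ hcs v y hv rfl hy hb

/-- Twice the number of edges. -/
noncomputable def edges₂ (n : ℕ) (A : ℕ → ℕ → Prop) : ℕ := ∑ u ∈ Finset.range n, cnt n (A u)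

/-- The number of vertices that are not isolated. -/
noncomputable def order (n : ℕ) (A : ℕ → ℕ → Prop) : ℕ := cnt n fun u => ∃ v < n, A u v

/-- The number of common neighbors. -/
noncomputable def codeg (n : ℕ) (A : ℕ → ℕ → Prop) (u v : ℕ) : ℕ := cnt n fun x => A u x ∧ A v x

/-- The graph that arises by identifying the vertices with the same value of `f`. -/
def quot (n : ℕ) (A : ℕ → ℕ → Prop) (f : ℕ → ℕ) (a b : ℕ) : Prop :=
  a ≠ b ∧ ∃ u < n, ∃ v < n, f u = a ∧ f v = b ∧ A u v

theorem quot_isGraph {n : ℕ} {A : ℕ → ℕ → Prop} (hA : IsGraph n A) {f : ℕ → ℕ}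
    (hf : ∀ u < n, f u < n) : IsGraph n (quot n A f) where
  symm := by
    rintro a b ⟨h, u, hu, v, hv, h1, h2, h3⟩
    exact ⟨h.symm, v, hv, u, hu, h2, h1, hA.symm _ _ h3⟩
  irrefl u h := h.1 rfl
  lt := by
    rintro _ _ ⟨-, u, hu, v, hv, rfl, -, -⟩
    exact hf u hu

theorem quot_congr {n : ℕ} (A : ℕ → ℕ → Prop) {f g : ℕ → ℕ} (h : ∀ u < n, f u = g u) :
    quot n A f = quot n A g := by
  funext a b
  refine propext (and_congr_right fun _ => exists_congr fun u => and_congr_right fun hu =>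
    exists_congr fun v => and_congr_right fun hv => ?_)
  rw [h u hu, h v hv]

theorem quot_id {n : ℕ} {A : ℕ → ℕ → Prop} (hA : IsGraph n A) : quot n A (fun u => u) = A := by
  funext a b
  refine propext ⟨?_, fun h => ⟨hA.ne h, a, hA.lt _ _ h, b, hA.lt' h, rfl, rfl, h⟩⟩
  rintro ⟨-, u, -, v, -, rfl, rfl, h⟩
  exact h

/-- Contraction of the edge `ab`: the vertex `b` is merged into `a`. -/
def contr (M : ℕ → ℕ → Prop) (a b x y : ℕ) : Prop :=
  x ≠ y ∧ x ≠ b ∧ y ≠ b ∧ (M x y ∨ (x = a ∧ M b y) ∨ (y = a ∧ M x b))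

theorem quot_contr {n : ℕ} {A : ℕ → ℕ → Prop} (f : ℕ → ℕ) {a b : ℕ} (hab : a ≠ b) :
    quot n A (fun u => if f u = b then a else f u) = contr (quot n A f) a b := by
  funext x y
  refine propext ⟨?_, ?_⟩
  · rintro ⟨hne, u, hu, v, hv, h1, h2, h3⟩
    dsimp only at h1 h2
    split_ifs at h1 h2 with hub hvb hvb
    · omega
    · subst h1 h2
      exact ⟨hne, hab, hvb, Or.inr (Or.inl ⟨rfl, Ne.symm hvb, u, hu, v, hv, hub, rfl, h3⟩)⟩
    · subst h1 h2
      exact ⟨hne, hub, hab, Or.inr (Or.inr ⟨rfl, hub, u, hu, v, hv, rfl, hvb, h3⟩)⟩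
    · subst h1 h2
      exact ⟨hne, hub, hvb, Or.inl ⟨hne, u, hu, v, hv, rfl, rfl, h3⟩⟩
  · rintro ⟨hne, hx, hy, ⟨-, u, hu, v, hv, h1, h2, h3⟩ | ⟨hxa, -, u, hu, v, hv, h1, h2, h3⟩ |
      ⟨hya, -, u, hu, v, hv, h1, h2, h3⟩⟩
    · refine ⟨hne, u, hu, v, hv, ?_, ?_, h3⟩
      · dsimp only
        rw [if_neg (by rw [h1]; exact hx), h1]
      · dsimp only
        rw [if_neg (by rw [h2]; exact hy), h2]
    · refine ⟨hne, u, hu, v, hv, ?_, ?_, h3⟩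
      · dsimp only
        rw [if_pos h1, hxa]
      · dsimp only
        rw [if_neg (by rw [h2]; exact hy), h2]
    · refine ⟨hne, u, hu, v, hv, ?_, ?_, h3⟩
      · dsimp only
        rw [if_neg (by rw [h1]; exact hx), h1]
      · dsimp only
        rw [if_pos h2, hya]

/-- The vertex `b` becomes isolated, and no isolated vertex ceases to be so. There is only an
inequality because `a` becomes isolated too if `ab` was a whole component. -/
theorem order_contr {n : ℕ} {M : ℕ → ℕ → Prop} (hM : IsGraph n M) {a b : ℕ} (hab : M a b) :
    order n (contr M a b) + 1 ≤ order n M := by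
  have hb := hM.lt' hab
  have ha := hM.lt _ _ hab
  unfold order
  rw [cnt_eq_succ (p := fun u => ∃ v < n, M u v) (v := b) hb ⟨a, ha, hM.symm _ _ hab⟩]
  refine Nat.add_le_add_right (cnt_mono ?_) 1
  rintro x hx ⟨y, hy, -, hxb, -, h | ⟨h, -⟩ | ⟨-, h⟩⟩
  · exact ⟨⟨y, hy, h⟩, hxb⟩
  · subst h; exact ⟨⟨b, hb, hab⟩, hxb⟩
  · exact ⟨⟨b, hb, h⟩, hxb⟩

theorem sum_range_split {n a b : ℕ} (ha : a < n) (hb : b < n) (hab : a ≠ b) (g : ℕ → ℕ) :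
    ∑ x ∈ Finset.range n, g x = ∑ x ∈ ((Finset.range n).erase b).erase a, g x + g a + g b := by
  rw [Finset.sum_erase_add _ _ (by simp [ha, hab]), Finset.sum_erase_add _ _ (by simp [hb])]

/-- What is lost is the edge `ab` and, for each common neighbor, one of two edges that become
parallel; all edges are counted twice. -/
theorem edges₂_contr {n : ℕ} {M : ℕ → ℕ → Prop} (hM : IsGraph n M) {a b : ℕ} (hab : M a b) :
    edges₂ n (contr M a b) + (2 + 2 * codeg n M a b) = edges₂ n M := by
  classical
  have hb := hM.lt' hab
  have ha := hM.lt _ _ hab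
  have hne := hM.ne hab
  have hba := hM.symm _ _ hab
  have haa := hM.irrefl a
  have hbb := hM.irrefl b
  set R := ((Finset.range n).erase b).erase a with hR
  have hRmem : ∀ x ∈ R, x ≠ a ∧ x ≠ b := by
    intro x hx
    simp only [hR, Finset.mem_erase] at hx
    exact ⟨hx.1, hx.2.1⟩
  have hc : ∀ p : ℕ → Prop, cnt n p = ∑ x ∈ R, (if p x then 1 else 0) +
      (if p a then 1 else 0) + if p b then 1 else 0 := fun p => by
    rw [cnt_eq_sum, sum_range_split ha hb hne]
  have hcn : codeg n M a b = ∑ y ∈ R, if M a y ∧ M b y then 1 else 0 := by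
    unfold codeg
    rw [hc]
    simp only [haa, hbb, false_and, and_false, if_false, add_zero]
    exact Finset.sum_congr rfl fun _ _ => by congr
  have hx : ∀ x ∈ R, cnt n (M x) = cnt n (contr M a b x) + if M a x ∧ M b x then 1 else 0 := by
    intro x hx
    obtain ⟨hxa, hxb⟩ := hRmem x hx
    have h1 : ∑ y ∈ R, (if contr M a b x y then 1 else 0) = ∑ y ∈ R, if M x y then 1 else 0 := by
      refine Finset.sum_congr rfl fun y hy => if_congr ?_ rfl rfl
      obtain ⟨hya, hyb⟩ := hRmem y hy
      simp only [contr, hxb, hyb, hxa, hya, ne_eq, not_false_eq_true, true_and, false_and, or_false]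
      exact ⟨fun h => h.2, fun h => ⟨hM.ne h, h⟩⟩
    have h2 : contr M a b x a ↔ M a x ∨ M b x := by
      simp only [contr, hxb, hxa, hne, ne_eq, not_false_eq_true, true_and, false_and, false_or]
      exact or_congr ⟨hM.symm _ _, hM.symm _ _⟩ ⟨hM.symm _ _, hM.symm _ _⟩
    have h3 : ¬ contr M a b x b := fun h => h.2.2.1 rfl
    have h4 : M x a ↔ M a x := ⟨hM.symm _ _, hM.symm _ _⟩
    have h5 : M x b ↔ M b x := ⟨hM.symm _ _, hM.symm _ _⟩
    rw [hc, hc, h1]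
    simp only [h2, h3, h4, h5, if_false]
    by_cases g1 : M a x <;> by_cases g2 : M b x <;> simp [g1, g2]
  have hb0 : cnt n (contr M a b b) = 0 := cnt_eq_zero.2 fun y _ h => h.2.1 rfl
  have ha0 : cnt n (M a) + cnt n (M b) = cnt n (contr M a b a) + codeg n M a b + 2 := by
    have h1 : ∑ y ∈ R, (if contr M a b a y then 1 else 0) + ∑ y ∈ R, (if M a y ∧ M b y then 1 else 0)
        = ∑ y ∈ R, (if M a y then 1 else 0) + ∑ y ∈ R, if M b y then 1 else 0 := by
      rw [← Finset.sum_add_distrib, ← Finset.sum_add_distrib]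
      refine Finset.sum_congr rfl fun y hy => ?_
      obtain ⟨hya, hyb⟩ := hRmem y hy
      have : contr M a b a y ↔ M a y ∨ M b y := by
        simp only [contr, hyb, hne, hya, Ne.symm hya, ne_eq, not_false_eq_true, true_and, false_and,
          or_false]
      simp only [this]
      by_cases g1 : M a y <;> by_cases g2 : M b y <;> simp [g1, g2]
    have h2 : ¬ contr M a b a a := fun h => h.1 rfl
    have h3 : ¬ contr M a b a b := fun h => h.2.2.1 rfl
    rw [hc (M a), hc (M b), hc (contr M a b a), hcn]
    simp only [haa, hbb, hab, hba, h2, h3, if_true, if_false]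
    omega
  unfold edges₂
  rw [sum_range_split ha hb hne, sum_range_split ha hb hne, ← hR, Finset.sum_congr rfl hx,
    Finset.sum_add_distrib, ← hcn, hb0]
  omega

theorem cnt_mul_le_sum {n d : ℕ} {p : ℕ → Prop} {g : ℕ → ℕ} (h : ∀ u < n, p u → d ≤ g u) :
    cnt n p * d ≤ ∑ u ∈ Finset.range n, g u := by
  classical
  unfold cnt
  rw [← smul_eq_mul, ← Finset.sum_const]
  refine (Finset.sum_le_sum fun u hu => ?_).trans
    (Finset.sum_le_sum_of_subset (Finset.filter_subset _ _))
  simp only [Finset.mem_filter, Finset.mem_range] at hu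
  exact h u hu.1 hu.2

theorem order_mul_le_edges₂ {n d : ℕ} {A : ℕ → ℕ → Prop}
    (h : ∀ u < n, (∃ v < n, A u v) → d ≤ cnt n (A u)) : order n A * d ≤ edges₂ n A :=
  cnt_mul_le_sum h

theorem order_pos_of_edge {n : ℕ} {A : ℕ → ℕ → Prop} (hA : IsGraph n A) {u v : ℕ} (h : A u v) :
    0 < order n A :=
  cnt_pos.2 ⟨u, hA.lt _ _ h, v, hA.lt' h, h⟩

theorem edges₂_pos {n : ℕ} {A : ℕ → ℕ → Prop} (hA : IsGraph n A) :
    0 < edges₂ n A ↔ ∃ u v, A u v := by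
  unfold edges₂
  constructor
  · intro h
    obtain ⟨u, -, hu⟩ := Finset.exists_ne_zero_of_sum_ne_zero h.ne'
    obtain ⟨v, -, hv⟩ := cnt_pos.1 (Nat.pos_of_ne_zero hu)
    exact ⟨u, v, hv⟩
  · rintro ⟨u, v, h⟩
    refine Finset.sum_pos' (fun _ _ => Nat.zero_le _) ⟨u, Finset.mem_range.2 (hA.lt _ _ h), ?_⟩
    exact cnt_pos.2 ⟨v, hA.lt' h, h⟩

/-- The edge `ab` may be contracted without lowering the average degree. -/
def Contractible (n : ℕ) (M : ℕ → ℕ → Prop) (a b : ℕ) : Prop :=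
  M a b ∧ order n M * (2 + 2 * codeg n M a b) ≤ edges₂ n M

/-- One step of the contraction process; the map `f` tells into which vertex a vertex was merged. -/
noncomputable def contractStep (n : ℕ) (A : ℕ → ℕ → Prop) (f : ℕ → ℕ) : ℕ → ℕ :=
  let a := findN n fun a => ∃ b < n, Contractible n (quot n A f) a b
  let b := findN n fun b => Contractible n (quot n A f) a b
  fun u => if f u = b then a else f u

/-- The invariant of the contraction process after `j` steps. -/
structure IsContraction (n : ℕ) (A : ℕ → ℕ → Prop) (d j : ℕ) (f : ℕ → ℕ) : Prop where
  lt : ∀ u < n, f u < n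
  conn : ∀ u < n, ConnOn A {v | v ∈ Set.Iio n ∧ f v = f u}
  dense : order n (quot n A f) * d ≤ edges₂ n (quot n A f)
  pos : 0 < d → 0 < edges₂ n (quot n A f)
  progress : (∀ a b, ¬ Contractible n (quot n A f) a b) ∨ order n (quot n A f) + j ≤ n

theorem IsContraction.congr {n : ℕ} {A : ℕ → ℕ → Prop} {d j : ℕ} {f g : ℕ → ℕ}
    (h : IsContraction n A d j f) (hfg : ∀ u < n, g u = f u) : IsContraction n A d j g := by
  have hq := quot_congr A hfg
  refine ⟨fun u hu => by rw [hfg u hu]; exact h.lt u hu, fun u hu => ?_, ?_, ?_, ?_⟩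
  · convert h.conn u hu using 1
    ext v
    simp only [Set.mem_ofPred_eq, Set.mem_Iio]
    refine and_congr_right fun hv => ?_
    rw [hfg u hu, hfg v hv]
  · rw [hq]; exact h.dense
  · rw [hq]; exact h.pos
  · rw [hq]; exact h.progress

theorem IsContraction.step {n : ℕ} {A : ℕ → ℕ → Prop} (hA : IsGraph n A) {d j : ℕ} {f : ℕ → ℕ}
    (h : IsContraction n A d j f) : IsContraction n A d (j + 1) (contractStep n A f) := by
  set M := quot n A f with hMdef
  have hM : IsGraph n M := quot_isGraph hA h.lt
  by_cases hex : ∃ a < n, ∃ b < n, Contractible n M a b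
  · obtain ⟨ha, hb', -⟩ := findN_spec hex
    obtain ⟨hb, hc, -⟩ := findN_spec hb'
    unfold contractStep
    rw [← hMdef]
    dsimp only
    set a := findN n fun a => ∃ b < n, Contractible n M a b
    set b := findN n fun b => Contractible n M a b
    clear_value b a
    have hne := hM.ne hc.1
    have hq : quot n A (fun u => if f u = b then a else f u) = contr M a b := quot_contr f hne
    have ho := order_contr hM hc.1
    have he := edges₂_contr hM hc.1
    have hle := hc.2
    -- Both ends of the contracted edge count, so `q ≥ 1` below; this is what keeps the number of
    -- edges positive.
    have hop : 2 ≤ order n M := by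
      have := order_pos_of_edge hM hc.1
      unfold order at this ⊢
      rw [cnt_eq_succ (v := a) ha ⟨b, hb, hc.1⟩]
      have : 0 < cnt n fun u => (∃ v < n, M u v) ∧ u ≠ a :=
        cnt_pos.2 ⟨b, hb, ⟨a, ha, hM.symm _ _ hc.1⟩, hne.symm⟩
      omega
    obtain ⟨q, hq1⟩ : ∃ q, order n M = q + 1 := ⟨order n M - 1, by omega⟩
    rw [hq1] at hle hop
    -- The loss is at most a fraction `1 / (q + 1)` of the edges, while the number of vertices falls
    -- from `q + 1` to at most `q`: the average degree does not drop.
    have hkey : edges₂ n M * q ≤ edges₂ n (contr M a b) * (q + 1) := by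
      have : edges₂ n M * q + edges₂ n M ≤ edges₂ n (contr M a b) * (q + 1) + edges₂ n M := by
        calc edges₂ n M * q + edges₂ n M = edges₂ n M * (q + 1) := by ring
          _ = edges₂ n (contr M a b) * (q + 1) + (q + 1) * (2 + 2 * codeg n M a b) := by
            rw [← he]; ring
          _ ≤ _ := Nat.add_le_add_left hle _
      omega
    refine ⟨fun u hu => ?_, fun u hu => ?_, ?_, fun hd => ?_, ?_⟩
    · split_ifs
      · exact ha
      · exact h.lt u hu
    · obtain ⟨-, x, hx, y, hy, hfx, hfy, hxy⟩ := hc.1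
      by_cases hu' : f u = a ∨ f u = b
      · have h1 := (h.conn x hx).union hA.symm (h.conn y hy) (x := x) (y := y) ⟨hx, rfl⟩
          ⟨hy, rfl⟩ hxy
        convert h1 using 1
        ext v
        simp only [Set.mem_ofPred_eq, Set.mem_Iio, Set.mem_union, hfx, hfy]
        rw [← and_or_left]
        refine and_congr_right fun hv => ?_
        have : (if f u = b then a else f u) = a := by
          split_ifs with h0
          · rfl
          · tauto
        rw [this]
        split_ifs with h0 <;> simp [h0]
      · push Not at hu'
        convert h.conn u hu using 1
        ext v
        simp only [Set.mem_ofPred_eq, Set.mem_Iio, if_neg hu'.2]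
        refine and_congr_right fun hv => ?_
        by_cases h0 : f v = b
        · rw [if_pos h0, h0]
          exact ⟨fun h => absurd h.symm hu'.1, fun h => absurd h.symm hu'.2⟩
        · rw [if_neg h0]
    · rw [hq]
      have hd := h.dense
      rw [← hMdef, hq1] at hd
      have h1 : (q + 1) * (q * d) ≤ (q + 1) * edges₂ n (contr M a b) :=
        calc (q + 1) * (q * d) = (q + 1) * d * q := by ring
          _ ≤ edges₂ n M * q := Nat.mul_le_mul_right _ hd
          _ ≤ _ := hkey.trans (by rw [mul_comm])
      exact (Nat.mul_le_mul_right _ (by omega : order n (contr M a b) ≤ q)).trans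
        (Nat.le_of_mul_le_mul_left h1 (by omega))
    · rw [hq]
      have := h.pos hd
      rw [← hMdef] at this
      by_contra h0
      have h0' : edges₂ n (contr M a b) = 0 := by omega
      rw [h0', zero_mul] at hkey
      have := Nat.mul_pos this (by omega : 0 < q)
      omega
    · right
      rw [hq]
      rcases h.progress with hp | hp
      · exact absurd hc (hp _ _)
      · rw [← hMdef] at hp
        omega
  · have hstab : ∀ a b, ¬ Contractible n M a b := fun a b hc =>
      hex ⟨a, hM.lt _ _ hc.1, b, hM.lt' hc.1, hc⟩
    -- Without a contractible edge the search for `b` returns the default `n`, which is no value of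
    -- `f` on the vertices, so the step changes nothing.
    have hb : (findN n fun b => Contractible n M
        (findN n fun a => ∃ b < n, Contractible n M a b) b) = n :=
      findN_eq_of_not fun b _ => hstab _ _
    have heq : ∀ u < n, contractStep n A f u = f u := by
      intro u hu
      unfold contractStep
      rw [← hMdef]
      rw [hb, if_neg (h.lt u hu).ne]
    refine IsContraction.congr ⟨h.lt, h.conn, h.dense, h.pos, Or.inl hstab⟩ heq

/-- Every effective step lowers the number of nonisolated vertices. If all `n` steps were effective,
no such vertex and hence no edge would remain. -/
theorem IsContraction.stable {n : ℕ} {A : ℕ → ℕ → Prop} (hA : IsGraph n A) {d : ℕ} {f : ℕ → ℕ}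
    (h : IsContraction n A d n f) (a b : ℕ) : ¬ Contractible n (quot n A f) a b := by
  rcases h.progress with hp | hp
  · exact hp a b
  · intro hc
    have := order_pos_of_edge (quot_isGraph hA h.lt) hc.1
    omega

/-- In a graph without contractible edges the neighborhood of a vertex of minimum positive degree is
small and dense. -/
theorem dense_neighborhood {n d : ℕ} {M : ℕ → ℕ → Prop} (hM : IsGraph n M)
    (hdense : order n M * d ≤ edges₂ n M) (hstab : ∀ a b, ¬ Contractible n M a b) {x : ℕ}
    (hx : ∃ v < n, M x v)
    (hmin : ∀ u < n, (∃ v < n, M u v) → cnt n (M x) ≤ cnt n (M u)) :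
    d < 2 * cnt n (M x) ∧ ∀ y, M x y →
      cnt n (M x) ≤ 2 * cnt n (fun z => M y z ∧ M x y ∧ M x z) + 1 := by
  have h1 := order_mul_le_edges₂ hmin
  -- As `xy` is not contractible, the average degree is less than `2 + 2 * codeg n M x y`. Compared
  -- with the lower bound `d` this gives the size of the neighborhood, compared with the minimum
  -- degree it gives the density.
  have key : ∀ y, M x y → edges₂ n M < order n M * (2 + 2 * codeg n M x y) := by
    intro y hy
    by_contra h
    exact hstab x y ⟨hy, by omega⟩
  constructor
  · obtain ⟨y, hyn, hy⟩ := hx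
    have h2 := hdense.trans_lt (key y hy)
    have h3 : codeg n M x y + 1 ≤ cnt n (M x) := by
      rw [cnt_eq_succ hyn hy]
      exact Nat.add_le_add_right (cnt_mono fun z _ hz => ⟨hz.1, fun h => hM.irrefl y (h ▸ hz.2)⟩) 1
    have h4 := Nat.lt_of_mul_lt_mul_left h2
    omega
  · intro y hy
    have h2 := Nat.lt_of_mul_lt_mul_left (h1.trans_lt (key y hy))
    have h3 : codeg n M x y = cnt n (fun z => M y z ∧ M x y ∧ M x z) :=
      cnt_congr fun z _ => ⟨fun h => ⟨h.2, hy, h.1⟩, fun h => ⟨h.2.2, h.1⟩⟩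
    omega

/-! ### The contraction program -/

/-- The subgraph of the vertices whose rank is at least that of `v`. -/
def suffixGraph (A : ℕ → ℕ → Prop) (rk : ℕ → ℕ) (v x y : ℕ) : Prop :=
  A x y ∧ rk v ≤ rk x ∧ rk v ≤ rk y

theorem suffixGraph_isGraph {n : ℕ} {A : ℕ → ℕ → Prop} (hA : IsGraph n A) (rk : ℕ → ℕ) (v : ℕ) :
    IsGraph n (suffixGraph A rk v) :=
  ⟨fun _ _ h => ⟨hA.symm _ _ h.1, h.2.2, h.2.1⟩, fun _ h => hA.irrefl _ h.1,
    fun _ _ h => hA.lt _ _ h.1⟩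

theorem le_cnt_of_surj {n k : ℕ} {p : ℕ → Prop} (g : ℕ → ℕ) (h : ∀ c < k, ∃ u < n, p u ∧ g u = c) :
    k ≤ cnt n p := by
  classical
  have : Finset.range k ⊆ ((Finset.range n).filter p).image g := by
    intro c hc
    obtain ⟨u, hu, hp, hg⟩ := h c (Finset.mem_range.1 hc)
    exact Finset.mem_image.2 ⟨u, by simp [hu, hp], hg⟩
  have h1 := (Finset.card_le_card this).trans Finset.card_image_le
  rw [Finset.card_range] at h1
  unfold cnt
  convert h1

/-- Greediness: each color below `col v` is on a neighbor of `v` of larger rank. So `v` has `col v`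
neighbors in the suffix, where its degree is smallest. -/
theorem suffixGraph_degree {n : ℕ} {A : ℕ → ℕ → Prop} {rk col : ℕ → ℕ} (hrk : IsRemovalRank n A rk)
    (hcol : IsPartialGreedy n A rk 0 col) {v : ℕ} (hv : v < n) {x : ℕ} (hx : x < n)
    (hvx : rk v ≤ rk x) : col v ≤ cnt n (suffixGraph A rk v x) := by
  have h1 : col v ≤ cnt n fun y => rk v ≤ rk y ∧ A v y := by
    refine le_cnt_of_surj col fun c hc => ?_
    have h2 := (hcol v hv (hrk.pos v hv)).2.2
    by_contra hne
    push Not at hne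
    have : c ∈ {c | ∀ u < n, A v u → rk v < rk u → col u ≠ c} := fun u hu hA hr =>
      hne u hu ⟨hr.le, hA⟩
    exact absurd (h2 this) (by omega)
  refine (h1.trans (hrk.min v hv x hx hvx)).trans (cnt_mono fun y _ hy => ?_)
  exact ⟨hy.2, hvx, hy.1⟩

/-- The start of the contraction, with nothing merged. Vertices outside the suffix are isolated and
not counted by `order`, so the minimum degree in the suffix bounds the average degree. -/
theorem isContraction_suffixGraph {n : ℕ} {A : ℕ → ℕ → Prop} (hA : IsGraph n A) {rk col : ℕ → ℕ}
    (hrk : IsRemovalRank n A rk) (hcol : IsPartialGreedy n A rk 0 col) {v : ℕ} (hv : v < n)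
    {f : ℕ → ℕ} (hf : ∀ u < n, f u = u) :
    IsContraction n (suffixGraph A rk v) (col v) 0 f := by
  have hB := suffixGraph_isGraph hA rk v
  refine IsContraction.congr (f := fun u => u) ⟨fun u hu => hu, fun u hu => ?_, ?_, ?_, ?_⟩ hf
  · convert ConnOn.singleton _ u using 1
    ext x
    simp only [Set.mem_ofPred_eq, Set.mem_Iio, Set.mem_singleton_iff]
    exact ⟨fun h => h.2, fun h => ⟨h ▸ hu, h⟩⟩
  · rw [quot_id hB]
    refine order_mul_le_edges₂ fun u hu ⟨y, _, h⟩ => suffixGraph_degree hrk hcol hv hu h.2.1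
  · intro hpos
    rw [quot_id hB, edges₂_pos hB]
    obtain ⟨y, _, h⟩ := cnt_pos.1 (hpos.trans_le (suffixGraph_degree hrk hcol hv hv le_rfl))
    exact ⟨v, y, h⟩
  · right
    exact cnt_le _ _

/-! ### The contraction process as a program. -/

namespace Bounded

variable {n : ℕ} {w : ℕ → ℕ}

theorem Cmd.fill₂_ind {a i j : ℕ} {e : Ex} (hij : i ≠ j) (he : e.readsMat a = false) (S : St)
    (hS : ∀ u v, n ≤ u ∨ n ≤ v → S.mat a u v = 0) (u v : ℕ) :
    ((Cmd.fill₂ a i j (.ind e)).run n w S).mat a u v ≠ 0 ↔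
      u < n ∧ v < n ∧ e.holds n w ((S.setReg i u).setReg j v) := by
  by_cases h : u < n ∧ v < n
  · rw [Cmd.fill₂_mat hij (by simpa [Ex.ind, Ex.readsMat] using he) S h.1 h.2]
    change (Ex.ind e).holds _ _ _ ↔ _
    simp [h.1, h.2]
  · rw [Cmd.fill₂_mat_of_le hij S (by omega), hS u v (by omega)]
    simp only [ne_eq, not_true_eq_false, false_iff]
    tauto

theorem Cmd.fill₂_zero {a i j : ℕ} {e : Ex} (hij : i ≠ j) (S : St)
    (hS : ∀ u v, n ≤ u ∨ n ≤ v → S.mat a u v = 0) (u v : ℕ) (huv : n ≤ u ∨ n ≤ v) :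
    ((Cmd.fill₂ a i j e).run n w S).mat a u v = 0 := by
  rw [Cmd.fill₂_mat_of_le hij S huv, hS u v huv]

theorem Cmd.fill_ind {a i : ℕ} {e : Ex} (he : e.readsMat a = false) (S : St)
    (hS : ∀ v, n ≤ v → S.mat a 0 v = 0) (v : ℕ) :
    ((Cmd.fill a i (.ind e)).run n w S).mat a 0 v ≠ 0 ↔ v < n ∧ e.holds n w (S.setReg i v) := by
  by_cases h : v < n
  · rw [Cmd.fill_mat (by simpa [Ex.ind, Ex.readsMat] using he) S h]
    change (Ex.ind e).holds _ _ _ ↔ _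
    simp [h]
  · rw [Cmd.fill_mat_of_le S (by omega), hS v (by omega)]
    simp [h]

/-- Register `3` receives a vertex of largest color, register `9` the number of colors, matrix `10`
the subgraph of the vertices of at least the same rank, and array `3` the identity. -/
def suffixCmd : Cmd :=
  .seq (.set 3 (.find 10 11 (.all 12 (.le (.vec 2 (.reg 12)) (.vec 2 (.reg 11)))))) <|
  .seq (.set 9 (.ite .size (.add (.vec 2 (.reg 3)) (.const 1)) (.const 0))) <|
  .seq (.fill₂ 10 1 2 (.ind (.and (.read 0 (.reg 1) (.reg 2))
    (.and (.le (.vec 1 (.reg 3)) (.vec 1 (.reg 1))) (.le (.vec 1 (.reg 3)) (.vec 1 (.reg 2)))))))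
  (.fill 3 1 (.reg 1))

theorem suffixCmd_spec (S : St) {A : ℕ → ℕ → Prop} (hA : IsGraph n A)
    (hSA : ∀ u v, S.mat 0 u v ≠ 0 ↔ A u v) (hS : ∀ u v, S.mat 10 u v = 0) (hn : 0 < n) :
    ∃ v < n, (∀ u < n, S.mat 2 0 u ≤ S.mat 2 0 v) ∧
      (suffixCmd.run n w S).reg 9 = S.mat 2 0 v + 1 ∧
      (∀ x y, (suffixCmd.run n w S).mat 10 x y ≠ 0 ↔ suffixGraph A (S.mat 1 0) v x y) ∧
      ∀ u < n, (suffixCmd.run n w S).mat 3 0 u = u := by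
  have hev : (Ex.find 10 11 (.all 12 (.le (.vec 2 (.reg 12)) (.vec 2 (.reg 11))))).eval n w S =
      findN n fun v => ∀ u < n, S.mat 2 0 u ≤ S.mat 2 0 v := by
    refine Ex.eval_find n w _ (by decide) _ fun x v hv => ?_
    simp
  have hex : ∃ v < n, ∀ u < n, S.mat 2 0 u ≤ S.mat 2 0 v := by
    obtain ⟨v, hv, h⟩ := Finset.exists_max_image (Finset.range n) (S.mat 2 0) ⟨0, by simpa using hn⟩
    exact ⟨v, by simpa using hv, fun u hu => h u (by simpa using hu)⟩
  obtain ⟨hv, hmax, -⟩ := findN_spec hex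
  set v := findN n fun v => ∀ u < n, S.mat 2 0 u ≤ S.mat 2 0 v
  refine ⟨v, hv, hmax, ?_, fun x y => ?_, fun u hu => ?_⟩
  · rw [suffixCmd, Cmd.run_seq, Cmd.run_set, hev, Cmd.run_seq, Cmd.run_reg rfl, Cmd.run_set]
    have : Ex.size.holds n w (S.setReg 3 v) := hn.ne'
    simp [this]
  · rw [suffixCmd, Cmd.run_seq, Cmd.run_set, hev, Cmd.run_seq, Cmd.run_set, Cmd.run_seq,
      Cmd.run_mat rfl, Cmd.fill₂_ind (by decide) rfl]
    · simp [hSA, suffixGraph, St.mat_setReg]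
      exact ⟨fun h => h.2.2, fun h => ⟨hA.lt _ _ h.1, hA.lt' h.1, h⟩⟩
    · exact fun u v _ => hS u v
  · rw [suffixCmd, Cmd.run_seq, Cmd.run_seq, Cmd.run_seq, Cmd.fill_mat rfl _ hu]
    simp

/-- Matrix `4` receives the quotient of the graph in matrix `10` by the map in array `3`. -/
def quotCmd : Cmd :=
  .fill₂ 4 1 2 (.ind (.and (.not (.eq (.reg 1) (.reg 2))) (.ex 10 (.ex 11
    (.and (.eq (.vec 3 (.reg 10)) (.reg 1)) (.and (.eq (.vec 3 (.reg 11)) (.reg 2))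
      (.read 10 (.reg 10) (.reg 11))))))))

theorem quotCmd_spec (S : St) {B : ℕ → ℕ → Prop} (hSB : ∀ u v, S.mat 10 u v ≠ 0 ↔ B u v)
    (hS : ∀ u v, n ≤ u ∨ n ≤ v → S.mat 4 u v = 0) (hf : ∀ u < n, S.mat 3 0 u < n) (u v : ℕ) :
    (quotCmd.run n w S).mat 4 u v ≠ 0 ↔ quot n B (S.mat 3 0) u v := by
  rw [quotCmd, Cmd.fill₂_ind (by decide) rfl _ hS]
  simp only [Ex.holds_and, Ex.holds_not, Ex.holds_eq, Ex.eval_reg, St.reg_setReg, Ex.holds_ex,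
    Ex.eval_vec, St.mat_setReg, Ex.holds_read, hSB]
  constructor
  · rintro ⟨-, -, h, x, hx, y, hy, h1, h2, h3⟩
    exact ⟨h, x, hx, y, hy, h1, h2, h3⟩
  · rintro ⟨h, x, hx, y, hy, h1, h2, h3⟩
    exact ⟨h1 ▸ hf x hx, h2 ▸ hf y hy, h, x, hx, y, hy, h1, h2, h3⟩

/-- A test whether the edge between the vertices in the registers `i` and `j` is contractible, if
the registers `5` and `6` hold twice the number of edges and the number of vertices. -/
def contractibleEx (i j : ℕ) : Ex :=
  .and (.read 4 (.reg i) (.reg j)) <| .le (.sum 14 (.ite (.lt (.reg 14) (.reg 6))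
    (.add (.const 2) (.add (.cnt 15 (.and (.read 4 (.reg i) (.reg 15)) (.read 4 (.reg j) (.reg 15))))
      (.cnt 15 (.and (.read 4 (.reg i) (.reg 15)) (.read 4 (.reg j) (.reg 15)))))) (.const 0)))
    (.reg 5)

/-- The new map is assembled in array `13` and copied back, since `Cmd.fill_mat` requires an
expression that does not read the array being filled. -/
def contractStepCmd : Cmd :=
  .seq quotCmd <|
  .seq (.set 5 (.sum 10 (.cnt 11 (.read 4 (.reg 10) (.reg 11))))) <|
  .seq (.set 6 (.cnt 10 (.ex 11 (.read 4 (.reg 10) (.reg 11))))) <|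
  .seq (.set 7 (.find 10 11 (.ex 12 (contractibleEx 11 12)))) <|
  .seq (.set 8 (.find 10 11 (contractibleEx 7 11))) <|
  .seq (.fill 13 1 (.ite (.eq (.vec 3 (.reg 1)) (.reg 8)) (.reg 7) (.vec 3 (.reg 1))))
  (.fill 3 1 (.vec 13 (.reg 1)))

/-- The language has no multiplication; the product with `order n M` is a sum with as many nonzero
terms, which fits because `order n M ≤ n`. -/
theorem contractibleEx_holds (S : St) {M : ℕ → ℕ → Prop} (hM : ∀ u v, S.mat 4 u v ≠ 0 ↔ M u v)
    (h5 : S.reg 5 = edges₂ n M) (h6 : S.reg 6 = order n M) (i j : ℕ) (hi : i ≠ 14 ∧ i ≠ 15)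
    (hj : j ≠ 14 ∧ j ≠ 15) :
    (contractibleEx i j).holds n w S ↔ Contractible n M (S.reg i) (S.reg j) := by
  classical
  have hsum : ∀ c, (∑ x ∈ Finset.range n, if x < order n M then c else 0) = order n M * c := by
    intro c
    rw [← Finset.sum_filter]
    have : (Finset.range n).filter (fun x => x < order n M) = Finset.range (order n M) := by
      ext x
      have : order n M ≤ n := cnt_le _ _
      simp only [Finset.mem_filter, Finset.mem_range]
      omega
    rw [this, Finset.sum_const, Finset.card_range, smul_eq_mul]
  simp only [contractibleEx, Ex.holds_and, Ex.holds_read, Ex.eval_reg, hM, Ex.holds_le, Ex.eval_sum,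
    Ex.eval_ite, Ex.holds_lt, St.reg_setReg, Ex.eval_add, Ex.eval_const, Ex.eval_cnt, St.mat_setReg,
    if_true, hi.1, hi.2, hj.1, hj.2, if_false, show (6 : ℕ) ≠ 14 by decide, h5, h6, Contractible]
  rw [← hsum, two_mul]
  unfold codeg
  exact iff_of_eq (by congr!)

theorem contractStepCmd_spec (S : St) {B : ℕ → ℕ → Prop} (hSB : ∀ u v, S.mat 10 u v ≠ 0 ↔ B u v)
    (hS : ∀ u v, n ≤ u ∨ n ≤ v → S.mat 4 u v = 0) (hf : ∀ u < n, S.mat 3 0 u < n) {u : ℕ}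
    (hu : u < n) :
    (contractStepCmd.run n w S).mat 3 0 u = contractStep n B (S.mat 3 0) u := by
  have hM := quotCmd_spec (w := w) S hSB hS hf
  set M := quot n B (S.mat 3 0) with hMdef
  set T := quotCmd.run n w S with hT
  have hT3 : T.mat 3 = S.mat 3 := Cmd.run_mat rfl S
  have e5 : (Ex.sum 10 (.cnt 11 (.read 4 (.reg 10) (.reg 11)))).eval n w T = edges₂ n M := by
    simp only [Ex.eval_sum, Ex.eval_cnt, Ex.holds_read, St.mat_setReg, hM, Ex.eval_reg,
      St.reg_setReg]
    simp [edges₂]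
  have e6 : (Ex.cnt 10 (.ex 11 (.read 4 (.reg 10) (.reg 11)))).eval n w
      (T.setReg 5 (edges₂ n M)) = order n M := by
    simp only [Ex.eval_cnt, Ex.holds_ex, Ex.holds_read, St.mat_setReg, hM, Ex.eval_reg,
      St.reg_setReg]
    simp [order]
  set T6 := (T.setReg 5 (edges₂ n M)).setReg 6 (order n M) with hT6
  have e7 : (Ex.find 10 11 (.ex 12 (contractibleEx 11 12))).eval n w T6 =
      findN n fun a => ∃ b < n, Contractible n M a b := by
    refine Ex.eval_find n w _ (by decide) _ fun x v hv => ?_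
    rw [Ex.holds_ex]
    refine exists_congr fun b => and_congr_right fun hb => ?_
    refine (contractibleEx_holds _ (M := M) (by simpa [hT6] using hM) (by simp [hT6])
      (by simp [hT6]) _ _ (by decide) (by decide)).trans ?_
    simp
  set a := findN n fun a => ∃ b < n, Contractible n M a b with ha
  have e8 : (Ex.find 10 11 (contractibleEx 7 11)).eval n w (T6.setReg 7 a) =
      findN n fun b => Contractible n M a b := by
    refine Ex.eval_find n w _ (by decide) _ fun x v hv => ?_
    refine (contractibleEx_holds _ (M := M) (by simpa [hT6] using hM) (by simp [hT6])
      (by simp [hT6]) _ _ (by decide) (by decide)).trans ?_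
    simp
  rw [contractStepCmd, Cmd.run_seq, Cmd.run_seq, Cmd.run_set, ← hT, e5, Cmd.run_seq, Cmd.run_set, e6,
    ← hT6, Cmd.run_seq, Cmd.run_set, e7, Cmd.run_seq, Cmd.run_set, e8, Cmd.run_seq,
    Cmd.fill_mat rfl _ hu, Ex.eval_vec, St.mat_setReg, Ex.eval_reg, St.reg_setReg, if_pos rfl,
    Cmd.fill_mat rfl _ hu]
  have hm : T6.mat 3 0 = S.mat 3 0 := by rw [← hT3]; rfl
  simp only [Ex.eval_ite, Ex.holds_eq, Ex.eval_vec, Ex.eval_reg, St.mat_setReg, St.reg_setReg, hm,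
    contractStep, ← hMdef, ← ha]
  simp only [if_true, show (8 : ℕ) ≠ 1 by decide, show (7 : ℕ) ≠ 1 by decide,
    show (7 : ℕ) ≠ 8 by decide, if_false]

/-- The contraction process. -/
def contractCmd : Cmd := .forTo 0 contractStepCmd

theorem contractCmd_spec (S : St) {B : ℕ → ℕ → Prop} (hB : IsGraph n B)
    (hSB : ∀ u v, S.mat 10 u v ≠ 0 ↔ B u v)
    (hS : ∀ u v, n ≤ u ∨ n ≤ v → S.mat 4 u v = 0) {d : ℕ}
    (hf : IsContraction n B d 0 (S.mat 3 0)) :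
    IsContraction n B d n ((contractCmd.run n w S).mat 3 0) ∧
      ∀ u v, n ≤ u ∨ n ≤ v → (contractCmd.run n w S).mat 4 u v = 0 := by
  refine (Cmd.run_forTo_induct (n := n) (w := w) (i := 0) (S := S) (P := contractStepCmd)
    (fun j T => T.mat 10 = S.mat 10 ∧ IsContraction n B d j (T.mat 3 0) ∧
      ∀ u v, n ≤ u ∨ n ≤ v → T.mat 4 u v = 0) ⟨rfl, hf, hS⟩ ?_).2
  rintro j hj T ⟨h1, h2, h3⟩
  refine ⟨(Cmd.run_mat rfl _).trans h1, ?_, fun u v huv => ?_⟩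
  · refine (h2.step hB).congr fun u hu => ?_
    exact contractStepCmd_spec (T.setReg 0 j) (by simpa [h1] using hSB) h3 h2.lt hu
  · rw [contractStepCmd, Cmd.run_seq, Cmd.run_mat rfl, quotCmd]
    exact Cmd.fill₂_zero (i := 1) (j := 2) (by decide) (T.setReg 0 j) h3 u v huv

/-- Register `5` receives a vertex of minimum positive degree in the contracted graph, register `6`
its degree, and matrix `11` the graph induced by its neighborhood. -/
def nbhdCmd : Cmd :=
  .seq quotCmd <|
  .seq (.set 5 (.argmin 10 11 12 (fun v => .ex 13 (.read 4 (.reg v) (.reg 13)))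
    fun v => .cnt 13 (.read 4 (.reg v) (.reg 13)))) <|
  .seq (.set 6 (.cnt 10 (.read 4 (.reg 5) (.reg 10))))
  (.fill₂ 11 1 2 (.ind (.and (.read 4 (.reg 1) (.reg 2))
    (.and (.read 4 (.reg 5) (.reg 1)) (.read 4 (.reg 5) (.reg 2))))))

/-- What is known of the graph `H` on the neighborhood `W` of size `m`. -/
structure IsDenseNbhd (n : ℕ) (H : ℕ → ℕ → Prop) (W : ℕ → Prop) (m : ℕ) : Prop where
  graph : IsGraph n H
  mem : ∀ u v, H u v → W u
  card : cnt n W = m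
  degree : ∀ y, W y → m ≤ 2 * cnt n (H y) + 1

/-- A contracted graph without edges is not excluded: then `x` is the default `n`, the neighborhood
is empty and `m = 0`. For `0 < d` there is an edge, by the field `pos`. -/
theorem nbhdCmd_spec (S : St) {B : ℕ → ℕ → Prop} (hB : IsGraph n B)
    (hSB : ∀ u v, S.mat 10 u v ≠ 0 ↔ B u v)
    (hS : ∀ u v, n ≤ u ∨ n ≤ v → S.mat 4 u v = 0) (hS11 : ∀ u v, S.mat 11 u v = 0) {d : ℕ}
    (hf : IsContraction n B d n (S.mat 3 0)) :
    ∃ (H : ℕ → ℕ → Prop) (W : ℕ → Prop) (m : ℕ), IsDenseNbhd n H W m ∧ (0 < d → d < 2 * m) ∧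
      (∀ u v, (nbhdCmd.run n w S).mat 11 u v ≠ 0 ↔ H u v) ∧ (nbhdCmd.run n w S).reg 6 = m ∧
      (∀ v, (nbhdCmd.run n w S).mat 4 ((nbhdCmd.run n w S).reg 5) v ≠ 0 ↔ W v) ∧
      ∀ u v, H u v → quot n B (S.mat 3 0) u v := by
  have hM := quotCmd_spec (w := w) S hSB hS hf.lt
  have hG := quot_isGraph hB hf.lt
  have hdense := hf.dense
  have hpos := hf.pos
  have hstab := hf.stable hB
  set M := quot n B (S.mat 3 0) with hMdef
  set T := quotCmd.run n w S with hT
  have e5 : (Ex.argmin 10 11 12 (fun v => .ex 13 (.read 4 (.reg v) (.reg 13)))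
    fun v => .cnt 13 (.read 4 (.reg v) (.reg 13))).eval n w T =
      argminN n (fun v => ∃ u < n, M v u) fun v => cnt n (M v) := by
    refine Ex.eval_argmin n w _ (by decide) _ _ ?_ ?_ ?_ ?_
    · intro x v hv; simp [hM]
    · intro x v hv u hu; simp [hM]
    · intro x v hv u hu; simp [hM]
    · intro x v hv u hu; simp [hM]
  set x := argminN n (fun v => ∃ u < n, M v u) fun v => cnt n (M v) with hx
  have e6 : (Ex.cnt 10 (.read 4 (.reg 5) (.reg 10))).eval n w (T.setReg 5 x) = cnt n (M x) := by
    simp [hM]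
  have hmin : ∀ y, M x y → ∀ u < n, (∃ v < n, M u v) → cnt n (M x) ≤ cnt n (M u) := fun y hy =>
    (argminN_spec (n := n) (c := fun v => ∃ u < n, M v u) (f := fun v => cnt n (M v))
      ⟨x, hG.lt _ _ hy, y, hG.lt' hy, hy⟩).2.2
  refine ⟨fun u v => M u v ∧ M x u ∧ M x v, M x, cnt n (M x),
    ⟨⟨fun u v h => ⟨hG.symm _ _ h.1, h.2.2, h.2.1⟩, fun u h => hG.irrefl _ h.1,
      fun u v h => hG.lt _ _ h.1⟩, fun u v h => h.2.1, rfl, fun y hy => ?_⟩, fun hd => ?_,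
      fun u v => ?_, ?_, fun v => ?_, fun u v h => h.1⟩
  · exact (dense_neighborhood hG hdense hstab ⟨y, hG.lt' hy, hy⟩ (hmin y hy)).2 y hy
  · obtain ⟨u, v, huv⟩ := (edges₂_pos hG).1 (hpos hd)
    obtain ⟨y, hy, hxy⟩ := (argminN_spec (n := n) (c := fun v => ∃ u < n, M v u)
      (f := fun v => cnt n (M v)) ⟨u, hG.lt _ _ huv, v, hG.lt' huv, huv⟩).2.1
    exact (dense_neighborhood hG hdense hstab ⟨y, hy, hxy⟩ (hmin y hxy)).1
  · rw [nbhdCmd, Cmd.run_seq, Cmd.run_seq, Cmd.run_set, ← hT, e5, Cmd.run_seq, Cmd.run_set, e6,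
      Cmd.fill₂_ind (by decide) rfl]
    · simp [hM]
      exact ⟨fun h => h.2.2, fun h => ⟨hG.lt _ _ h.1, hG.lt' h.1, h⟩⟩
    · intro u v _
      have : T.mat 11 = S.mat 11 := Cmd.run_mat rfl S
      simp [this, hS11]
  · rw [nbhdCmd, Cmd.run_seq, Cmd.run_seq, Cmd.run_set, ← hT, e5, Cmd.run_seq, Cmd.run_set, e6,
      Cmd.run_reg rfl]
    simp
  · rw [nbhdCmd, Cmd.run_seq, Cmd.run_seq, Cmd.run_set, ← hT, e5, Cmd.run_seq, Cmd.run_set, e6,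
      Cmd.run_reg rfl, Cmd.run_mat rfl]
    simp [hM]

end Bounded

/-! ### Preparation of a dense graph -/

open Bounded (IsDenseNbhd)

theorem cnt_le_add_not {n : ℕ} (p q : ℕ → Prop) :
    cnt n p ≤ cnt n (fun v => p v ∧ q v) + cnt n fun v => p v ∧ ¬ q v := by
  classical
  simp only [cnt_eq_sum, ← Finset.sum_add_distrib]
  refine Finset.sum_le_sum fun v _ => ?_
  by_cases hp : p v <;> by_cases hq : q v <;> simp [hp, hq]

theorem sum_cnt_comm (n : ℕ) (p : ℕ → ℕ → Prop) :
    ∑ x ∈ Finset.range n, cnt n (p x) = ∑ y ∈ Finset.range n, cnt n fun x => p x y := by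
  classical
  simp only [cnt_eq_sum]
  exact Finset.sum_comm

theorem sum_le_cnt_mul {n d : ℕ} {p : ℕ → Prop} {g : ℕ → ℕ} (h : ∀ u < n, p u → g u ≤ d)
    (h0 : ∀ u < n, ¬ p u → g u = 0) : ∑ u ∈ Finset.range n, g u ≤ cnt n p * d := by
  classical
  rw [cnt_eq_sum, Finset.sum_mul]
  refine Finset.sum_le_sum fun u hu => ?_
  have hu' := Finset.mem_range.1 hu
  by_cases hp : p u
  · simpa [hp] using h u hu' hp
  · simp [hp, h0 u hu' hp]

theorem cnt_and_const (n : ℕ) (a : Prop) (p : ℕ → Prop) (h : ¬ a) : cnt n (fun v => a ∧ p v) = 0 :=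
  cnt_eq_zero.2 fun _ _ h' => h h'.1

section Dense

variable {n : ℕ} {H : ℕ → ℕ → Prop} {W : ℕ → Prop} {m : ℕ}

/-- The number of (ordered) pairs of neighbors of `x` with fewer than `b` common neighbors. -/
noncomputable def badPairs (n : ℕ) (H : ℕ → ℕ → Prop) (b x : ℕ) : ℕ :=
  ∑ y ∈ Finset.range n, cnt n fun z => H x y ∧ H x z ∧ codeg n H y z < b

/-- By interchange of summation, a pair is counted once for each common neighbor, and only if there
are fewer than `b` of them. -/
theorem sum_badPairs_le (hD : IsDenseNbhd n H W m) (b : ℕ) :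
    ∑ x ∈ Finset.range n, badPairs n H b x ≤ m * (m * b) := by
  classical
  unfold badPairs
  rw [Finset.sum_comm]
  rw [← hD.card]
  refine sum_le_cnt_mul (fun y _ _ => ?_) fun y _ hy => ?_
  · rw [sum_cnt_comm]
    refine sum_le_cnt_mul (fun z _ _ => ?_) fun z _ hz => ?_
    · by_cases hb : codeg n H y z < b
      · refine le_trans (cnt_mono fun x _ hx => ?_) hb.le
        exact ⟨hD.graph.symm _ _ hx.1, hD.graph.symm _ _ hx.2.1⟩
      · rw [cnt_eq_zero.2 fun x _ hx => hb hx.2.2]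
        exact Nat.zero_le _
    · exact cnt_eq_zero.2 fun x _ hx => hz (hD.mem _ _ (hD.graph.symm _ _ hx.2.1))
  · exact Finset.sum_eq_zero fun x _ => cnt_eq_zero.2 fun z _ hz =>
      hy (hD.mem _ _ (hD.graph.symm _ _ hz.1))

theorem badPairs_argmin_le (hD : IsDenseNbhd n H W m) (b : ℕ) (hm : 0 < m) :
    let x := argminN n W (badPairs n H b)
    W x ∧ badPairs n H b x ≤ m * b := by
  intro x
  obtain ⟨-, hW, hmin⟩ := argminN_spec (n := n) (c := W) (f := badPairs n H b)
    (cnt_pos.1 (hD.card ▸ hm))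
  refine ⟨hW, ?_⟩
  have h1 := (cnt_mul_le_sum hmin).trans (sum_badPairs_le hD b)
  rw [hD.card] at h1
  exact Nat.le_of_mul_le_mul_left h1 hm

/-- The vertices that the construction uses: `Y` for dominating, `Z` to be dominated, and `R` for
the roots of the branch sets. -/
def goodY (n : ℕ) (H : ℕ → ℕ → Prop) (b a₂ x y : ℕ) : Prop :=
  H x y ∧ cnt n (fun z => H x z ∧ codeg n H y z < b) ≤ a₂

/-- The vertices with many neighbors in `Y`. -/
def goodZ (n : ℕ) (H : ℕ → ℕ → Prop) (Y : ℕ → Prop) (a z : ℕ) : Prop :=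
  z < n ∧ a ≤ cnt n fun y => Y y ∧ H z y

/-- The vertices of `Y` with many neighbors in `Z`. -/
def goodR (n : ℕ) (H : ℕ → ℕ → Prop) (Y Z : ℕ → Prop) (a y : ℕ) : Prop :=
  Y y ∧ a ≤ cnt n fun z => Z z ∧ H y z

/-- The properties of `Y`, `Z` and `R` on which the construction depends. -/
structure IsPrepared (n : ℕ) (H : ℕ → ℕ → Prop) (W : ℕ → Prop) (m b : ℕ) (Y Z R : ℕ → Prop) :
    Prop where
  graph : IsGraph n H
  card : cnt n W = m
  memY : ∀ v, Y v → W v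
  memZ : ∀ v, Z v → W v
  ltR : ∀ v, R v → v < n
  dominate : ∀ r z, R r → Z z → m + 1024 * b ≤ 1024 * cnt n fun v => Y v ∧ b ≤ codeg n H r v ∧ H z v
  hit : ∀ r, R r → m + 512 * b ≤ 512 * cnt n fun z => Z z ∧ H r z
  roots : b ≤ cnt n R

/-- Each excluded neighbor of `x` lies in more than `m / 256` of the at most `m * (m / 2048)` bad
pairs, so at most `m / 8` of about `m / 2` neighbors are excluded. -/
theorem card_goodY (hD : IsDenseNbhd n H W m) (hm : 1000 ≤ m) {x : ℕ} (hx : W x)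
    (hbad : badPairs n H (m / 2048) x ≤ m * (m / 2048)) :
    m ≤ 4 * cnt n (goodY n H (m / 2048) (m / 256) x) := by
  have h1 := cnt_le_add_not (n := n) (H x)
    fun y => cnt n (fun z => H x z ∧ codeg n H y z < m / 2048) ≤ m / 256
  have h2 : cnt n (fun y => H x y ∧ ¬ cnt n (fun z => H x z ∧ codeg n H y z < m / 2048) ≤ m / 256) *
      (m / 256 + 1) ≤ badPairs n H (m / 2048) x := by
    refine cnt_mul_le_sum fun y _ hy => ?_
    have : cnt n (fun z => H x y ∧ H x z ∧ codeg n H y z < m / 2048) =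
        cnt n fun z => H x z ∧ codeg n H y z < m / 2048 := cnt_congr fun z _ => by simp [hy.1]
    rw [this]
    omega
  set k := cnt n fun y => H x y ∧ ¬ cnt n (fun z => H x z ∧ codeg n H y z < m / 2048) ≤ m / 256
  have h3 : m * (8 * k) ≤ m * m := by
    calc m * (8 * k) ≤ (256 * (m / 256 + 1)) * (8 * k) := Nat.mul_le_mul_right _ (by omega)
      _ = 2048 * (k * (m / 256 + 1)) := by ring
      _ ≤ 2048 * (m * (m / 2048)) := Nat.mul_le_mul_left _ (h2.trans hbad)
      _ = m * (2048 * (m / 2048)) := by ring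
      _ ≤ m * m := Nat.mul_le_mul_left _ (by omega)
  have h4 : 8 * k ≤ m := Nat.le_of_mul_le_mul_left h3 (by omega)
  have h5 := hD.degree x hx
  have h6 : cnt n (goodY n H (m / 2048) (m / 256) x) = cnt n fun y => H x y ∧
    cnt n (fun z => H x z ∧ codeg n H y z < m / 2048) ≤ m / 256 := rfl
  omega

/-- Double counting of the pairs of a vertex of `Y` and a neighbor of it, at least `m / 4 * ((m - 1)
/ 2)` in number: at most `m * (m / 128)` of them end outside `Z`, as many again start outside `R`,
and at most `cnt n R * m` remain. -/
theorem card_goodR (hD : IsDenseNbhd n H W m) (hm : 1000 ≤ m) {Y : ℕ → Prop}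
    (hYW : ∀ y, Y y → W y) (hY : m ≤ 4 * cnt n Y) :
    m ≤ 16 * cnt n (goodR n H Y (goodZ n H Y (m / 128)) (m / 128)) := by
  classical
  set Z := goodZ n H Y (m / 128) with hZ
  set R := goodR n H Y Z (m / 128) with hR
  have h1 : cnt n Y * ((m - 1) / 2) ≤ ∑ y ∈ Finset.range n, cnt n fun z => Y y ∧ H y z := by
    refine cnt_mul_le_sum fun y _ hy => ?_
    have := hD.degree y (hYW y hy)
    have h : cnt n (fun z => Y y ∧ H y z) = cnt n (H y) := cnt_congr fun z _ => by simp [hy]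
    omega
  have h2 : ∑ y ∈ Finset.range n, cnt n (fun z => Y y ∧ H y z) ≤
      ∑ y ∈ Finset.range n, cnt n (fun z => Y y ∧ Z z ∧ H y z) + m * (m / 128) := by
    have e1 : ∑ y ∈ Finset.range n, cnt n (fun z => Y y ∧ H y z) ≤
        ∑ y ∈ Finset.range n, cnt n (fun z => Y y ∧ Z z ∧ H y z) +
        ∑ y ∈ Finset.range n, cnt n (fun z => Y y ∧ ¬ Z z ∧ H y z) := by
      rw [← Finset.sum_add_distrib]
      refine Finset.sum_le_sum fun y _ => ?_
      refine (cnt_le_add_not _ Z).trans (Nat.add_le_add (cnt_mono ?_) (cnt_mono ?_))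
      · exact fun z _ h => ⟨h.1.1, h.2, h.1.2⟩
      · exact fun z _ h => ⟨h.1.1, h.2, h.1.2⟩
    refine e1.trans (Nat.add_le_add_left ?_ _)
    rw [sum_cnt_comm, ← hD.card]
    refine sum_le_cnt_mul (fun z hz _ => ?_) fun z _ hz => ?_
    · rw [hD.card]
      by_cases hZz : Z z
      · rw [cnt_eq_zero.2 fun y _ h => h.2.1 hZz]
        exact Nat.zero_le _
      · have : cnt n (fun y => Y y ∧ H z y) < m / 128 := by
          by_contra h
          exact hZz ⟨hz, by omega⟩
        exact (cnt_mono fun y _ h => ⟨h.1, hD.graph.symm _ _ h.2.2⟩).trans this.le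
    · exact cnt_eq_zero.2 fun y _ h => hz (hD.mem _ _ (hD.graph.symm _ _ h.2.2))
  have h3 : ∑ y ∈ Finset.range n, cnt n (fun z => Y y ∧ Z z ∧ H y z) ≤
      cnt n R * m + m * (m / 128) := by
    have e1 : ∑ y ∈ Finset.range n, cnt n (fun z => Y y ∧ Z z ∧ H y z) =
        ∑ y ∈ Finset.range n, cnt n (fun z => R y ∧ Z z ∧ H y z) +
        ∑ y ∈ Finset.range n, cnt n (fun z => (Y y ∧ ¬ R y) ∧ Z z ∧ H y z) := by
      rw [← Finset.sum_add_distrib]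
      refine Finset.sum_congr rfl fun y _ => ?_
      by_cases hRy : R y
      · have hYy : Y y := hRy.1
        simp [hRy, hYy, cnt_eq_zero.2]
      · simp [hRy, cnt_eq_zero.2]
    rw [e1]
    refine Nat.add_le_add ?_ ?_
    · refine sum_le_cnt_mul (fun y _ hy => ?_) fun y _ hy => cnt_and_const _ _ _ hy
      rw [← hD.card]
      exact cnt_mono fun z _ h => hD.mem _ _ (hD.graph.symm _ _ h.2.2)
    · rw [← hD.card]
      refine sum_le_cnt_mul (fun y _ hy => ?_) fun y _ hy => ?_
      · rw [hD.card]
        by_cases hc : Y y ∧ ¬ R y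
        · have : cnt n (fun z => Z z ∧ H y z) < m / 128 := by
            by_contra h
            exact hc.2 ⟨hc.1, by omega⟩
          exact (cnt_mono fun z _ h => h.2).trans this.le
        · rw [cnt_and_const _ _ _ hc]
          exact Nat.zero_le _
      · exact cnt_and_const _ _ _ fun h => hy (hYW y h.1)
  have h4 : m * ((m - 1) / 2) ≤ m * (4 * (cnt n R + m / 128 + m / 128)) := by
    calc m * ((m - 1) / 2) ≤ 4 * cnt n Y * ((m - 1) / 2) := Nat.mul_le_mul_right _ hY
      _ = 4 * (cnt n Y * ((m - 1) / 2)) := by ring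
      _ ≤ 4 * (cnt n R * m + m * (m / 128) + m * (m / 128)) := by omega
      _ = _ := by ring
  have h5 := Nat.le_of_mul_le_mul_left h4 (by omega)
  omega

/-- A vertex of `Z` has `m / 128` neighbors in `Y`, and at most `m / 256` of them form a bad pair
with a given root, because the root is in `Y`. The surplus terms with `b` in the conclusions are a
reserve for vertices that get labelled while branch sets grow. -/
theorem isPrepared (hD : IsDenseNbhd n H W m) (hm : 1000 ≤ m) {x : ℕ}
    (hx : x = argminN n W (badPairs n H (m / 2048))) {Y Z R : ℕ → Prop}
    (hY : Y = goodY n H (m / 2048) (m / 256) x) (hZ : Z = goodZ n H Y (m / 128))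
    (hR : R = goodR n H Y Z (m / 128)) : IsPrepared n H W m (m / 2048) Y Z R := by
  obtain ⟨hWx, hbad⟩ := badPairs_argmin_le hD (m / 2048) (by omega)
  rw [← hx] at hWx hbad
  have hYx : ∀ y, Y y → H x y := by
    intro y hy
    rw [hY] at hy
    exact hy.1
  have hYW : ∀ y, Y y → W y := fun y hy => hD.mem _ _ (hD.graph.symm _ _ (hYx y hy))
  have hRc := card_goodR hD hm hYW (by rw [hY]; exact card_goodY hD hm hWx hbad)
  rw [← hZ, ← hR] at hRc
  refine ⟨hD.graph, hD.card, hYW, fun z hz => ?_, fun v hv => ?_, fun r z hr hz => ?_,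
    fun r hr => ?_, by omega⟩
  · rw [hZ] at hz
    obtain ⟨y, _, -, hy⟩ := cnt_pos.1 ((by omega : 0 < m / 128).trans_le hz.2)
    exact hD.mem _ _ hy
  · rw [hR] at hv
    exact hD.graph.lt' (hYx v hv.1)
  · rw [hR] at hr
    rw [hZ] at hz
    have h1 := hr.1
    rw [hY] at h1
    have h2 := h1.2
    have h3 := hz.2
    have h4 := cnt_le_add_not (n := n) (fun y => Y y ∧ H z y) fun v => m / 2048 ≤ codeg n H r v
    have h5 : cnt n (fun v => (Y v ∧ H z v) ∧ ¬ m / 2048 ≤ codeg n H r v) ≤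
        cnt n fun z => H x z ∧ codeg n H r z < m / 2048 :=
      cnt_mono fun v _ hv => ⟨hYx v hv.1.1, by omega⟩
    have h6 : cnt n (fun v => (Y v ∧ H z v) ∧ m / 2048 ≤ codeg n H r v) =
        cnt n fun v => Y v ∧ m / 2048 ≤ codeg n H r v ∧ H z v :=
      cnt_congr fun v _ => by tauto
    omega
  · rw [hR] at hr
    have := hr.2
    omega

end Dense

/-! ### Growing the branch sets -/

/-- The minimum is at most the average; `g` is a bound for `f` that can be summed over all vertices.
-/
theorem argminN_mul_le {n : ℕ} {c : ℕ → Prop} {f g : ℕ → ℕ} (h : ∃ j < n, c j)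
    (hg : ∀ v < n, c v → f v ≤ g v) :
    cnt n c * f (argminN n c f) ≤ ∑ v ∈ Finset.range n, g v :=
  cnt_mul_le_sum fun u hu hc => ((argminN_spec (f := f) h).2.2 u hu hc).trans (hg u hu hc)

/-- Some vertex with the label `t` is adjacent to `z`. -/
def Touches (n : ℕ) (H : ℕ → ℕ → Prop) (own : ℕ → ℕ) (t z : ℕ) : Prop :=
  ∃ y < n, own y = t ∧ H y z

/-- The number of vertices in `Z` without a neighbor of label `t`. -/
noncomputable def undominated (n : ℕ) (H : ℕ → ℕ → Prop) (Z : ℕ → Prop) (own : ℕ → ℕ) (t : ℕ) : ℕ :=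
  cnt n fun z => Z z ∧ ¬ Touches n H own t z

/-- The branch set with label `i` is joined to the one with label `t`. -/
def BranchJoined (n : ℕ) (H : ℕ → ℕ → Prop) (own : ℕ → ℕ) (i t : ℕ) : Prop :=
  ∃ y < n, own y = t ∧ Touches n H own i y

/-- The number of branch sets before the one with label `h + 1` that are not joined to it. -/
noncomputable def unjoined (n : ℕ) (H : ℕ → ℕ → Prop) (own : ℕ → ℕ) (h : ℕ) : ℕ :=
  cnt n fun i => i < h ∧ ¬ BranchJoined n H own (i + 1) (h + 1)

/-- A free vertex of `Y`, well connected to the root `r`, that leaves as few vertices as possible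
undominated. -/
noncomputable def domPick (n : ℕ) (H : ℕ → ℕ → Prop) (Y Z : ℕ → Prop) (b t r : ℕ) (own : ℕ → ℕ) :
    ℕ :=
  argminN n (fun v => Y v ∧ own v = 0 ∧ b ≤ codeg n H r v)
    fun v => cnt n fun z => Z z ∧ ¬ Touches n H own t z ∧ ¬ H v z

/-- A free common neighbor. -/
noncomputable def connPick (n : ℕ) (H : ℕ → ℕ → Prop) (r v : ℕ) (own : ℕ → ℕ) : ℕ :=
  findN n fun c => own c = 0 ∧ H r c ∧ H c v

/-- The test `c < n` also covers the case without a candidate `v`: the default value is not adjacent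
to anything. -/
noncomputable def domStep (n : ℕ) (H : ℕ → ℕ → Prop) (Y Z : ℕ → Prop) (b t r : ℕ) (own : ℕ → ℕ) :
    ℕ → ℕ :=
  let v := domPick n H Y Z b t r own
  let c := connPick n H r v own
  if c < n then Function.update (Function.update own v t) c t else own

/-- A free neighbor of the root `r` in `Z` that leaves as few branch sets as possible unjoined. -/
noncomputable def joinPick (n : ℕ) (H : ℕ → ℕ → Prop) (Z : ℕ → Prop) (h r : ℕ) (own : ℕ → ℕ) : ℕ :=
  argminN n (fun v => Z v ∧ own v = 0 ∧ H r v)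
    fun v => cnt n fun i => i < h ∧ ¬ BranchJoined n H own (i + 1) (h + 1) ∧ ¬ Touches n H own (i + 1) v

noncomputable def joinStep (n : ℕ) (H : ℕ → ℕ → Prop) (Z : ℕ → Prop) (h r : ℕ) (own : ℕ → ℕ) :
    ℕ → ℕ :=
  let v := joinPick n H Z h r own
  if v < n then Function.update own v (h + 1) else own

/-- The labels `own` arise from `own₀` by labelling a connected set of free vertices, including `r`,
with `t`. -/
structure Grows (n : ℕ) (H : ℕ → ℕ → Prop) (own₀ : ℕ → ℕ) (t r : ℕ) (own : ℕ → ℕ) : Prop where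
  ext : ∀ v, own v = own₀ v ∨ (own₀ v = 0 ∧ own v = t)
  lt : ∀ v, own v ≠ 0 → v < n
  root : own r = t
  conn : ConnOn H {v | own v = t}

/-- The number of labelled vertices. -/
noncomputable def used (n : ℕ) (own : ℕ → ℕ) : ℕ := cnt n fun v => own v ≠ 0

section

variable {n : ℕ} {H : ℕ → ℕ → Prop} {W Y Z R : ℕ → Prop} {m b : ℕ}

theorem update_touches {own : ℕ → ℕ} {t v : ℕ} {z : ℕ} (h : Touches n H own t z) :
    Touches n H (Function.update own v t) t z := by
  obtain ⟨y, hy, h1, h2⟩ := h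
  refine ⟨y, hy, ?_, h2⟩
  rw [Function.update_apply]
  split_ifs <;> simp [h1]

theorem Grows.init {own : ℕ → ℕ} (hown : ∀ v, own v ≠ 0 → v < n) {t r : ℕ} (ht : ∀ v, own v ≠ t)
    (hr : r < n) (hr0 : own r = 0) : Grows n H own t r (Function.update own r t) := by
  refine ⟨fun v => ?_, fun v => ?_, by simp, ?_⟩
  · rw [Function.update_apply]
    split_ifs with h
    · right; rw [h]; exact ⟨hr0, rfl⟩
    · left; rfl
  · rw [Function.update_apply]
    split_ifs with h
    · intro; omega
    · exact hown v
  · convert ConnOn.singleton H r using 1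
    ext v
    simp only [Set.mem_ofPred_eq, Set.mem_singleton_iff, Function.update_apply]
    split_ifs with h
    · simp [h]
    · simp [h, ht v]

theorem Grows.insert (hH : IsGraph n H) {own₀ own : ℕ → ℕ} {t r : ℕ} (hg : Grows n H own₀ t r own)
    {v x : ℕ} (hv : own v = 0) (hx : own x = t) (hxv : H x v) :
    Grows n H own₀ t r (Function.update own v t) := by
  have hupd : ∀ y, Function.update own v t y = t ↔ y = v ∨ own y = t := by
    intro y
    rw [Function.update_apply]
    split_ifs with h <;> simp [h]
  refine ⟨fun y => ?_, fun y => ?_, ?_, ?_⟩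
  · rw [Function.update_apply]
    split_ifs with h
    · right
      subst h
      rcases hg.ext y with h | h
      · exact ⟨h ▸ hv, rfl⟩
      · exact ⟨h.1, rfl⟩
    · exact hg.ext y
  · rw [Function.update_apply]
    split_ifs with h
    · intro; rw [h]; exact hH.lt' hxv
    · exact hg.lt y
  · exact (hupd r).2 (Or.inr hg.root)
  · have h1 := hg.conn.insert hH.symm (x := x) (y := v) hx hxv
    convert h1 using 1
    ext y
    simp only [Set.mem_ofPred_eq, Set.mem_insert_iff, hupd]

theorem Grows.domStep (hH : IsGraph n H) {own₀ own : ℕ → ℕ} {t r : ℕ}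
    (hg : Grows n H own₀ t r own) : Grows n H own₀ t r (domStep n H Y Z b t r own) := by
  unfold _root_.domStep
  set v := domPick n H Y Z b t r own with hv
  set c := connPick n H r v own with hc
  dsimp only
  split_ifs with h
  · obtain ⟨hc0, hrc, hcv⟩ := findN_lt h
    change own c = 0 at hc0
    change H r c at hrc
    change H c v at hcv
    have hvn : v < n := hH.lt' hcv
    have hv0 : own v = 0 := (argminN_lt hvn).2.1
    have hvc := hH.ne hcv
    -- For connectedness the connecting vertex `c` joins the root first, and then `v` joins `c`.
    rw [Function.update_comm hvc.symm]
    refine (hg.insert hH hc0 hg.root hrc).insert hH (x := c) ?_ ?_ hcv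
    · rwa [Function.update_of_ne hvc.symm]
    · simp
  · exact hg

theorem Grows.joinStep (hH : IsGraph n H) {own₀ own : ℕ → ℕ} {h r : ℕ}
    (hg : Grows n H own₀ (h + 1) r own) : Grows n H own₀ (h + 1) r (joinStep n H Z h r own) := by
  unfold _root_.joinStep
  set v := joinPick n H Z h r own with hv
  dsimp only
  split_ifs with h
  · obtain ⟨-, h0, hr⟩ := argminN_lt h
    exact hg.insert hH h0 hg.root hr
  · exact hg

theorem Grows.iterate_domStep (hH : IsGraph n H) {own₀ own : ℕ → ℕ} {t r : ℕ}
    (hg : Grows n H own₀ t r own) (k : ℕ) :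
    Grows n H own₀ t r ((_root_.domStep n H Y Z b t r)^[k] own) := by
  induction k with
  | zero => exact hg
  | succ k ih =>
    rw [Function.iterate_succ_apply']
    exact ih.domStep hH

theorem Grows.iterate_joinStep (hH : IsGraph n H) {own₀ own : ℕ → ℕ} {h r : ℕ}
    (hg : Grows n H own₀ (h + 1) r own) (k : ℕ) :
    Grows n H own₀ (h + 1) r ((_root_.joinStep n H Z h r)^[k] own) := by
  induction k with
  | zero => exact hg
  | succ k ih =>
    rw [Function.iterate_succ_apply']
    exact ih.joinStep hH

theorem used_update_le (own : ℕ → ℕ) (v t : ℕ) : used n (Function.update own v t) ≤ used n own + 1 := by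
  unfold used
  by_cases hv : v < n ∧ Function.update own v t v ≠ 0
  · rw [cnt_eq_succ hv.1 hv.2]
    refine Nat.add_le_add_right (cnt_mono fun y _ hy => ?_) 1
    have := hy.1
    rwa [Function.update_of_ne hy.2] at this
  · refine (cnt_mono fun y hy h => ?_).trans (Nat.le_succ _)
    by_cases hyv : y = v
    · subst hyv
      exact absurd ⟨hy, h⟩ hv
    · rwa [Function.update_of_ne hyv] at h

theorem used_domStep_le (t r : ℕ) (own : ℕ → ℕ) :
    used n (domStep n H Y Z b t r own) ≤ used n own + 2 := by
  unfold domStep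
  dsimp only
  split_ifs
  · have h1 := used_update_le (n := n) own (domPick n H Y Z b t r own) t
    have h2 := used_update_le (n := n) (Function.update own (domPick n H Y Z b t r own) t)
      (connPick n H r (domPick n H Y Z b t r own) own) t
    omega
  · omega

theorem used_joinStep_le (h r : ℕ) (own : ℕ → ℕ) :
    used n (joinStep n H Z h r own) ≤ used n own + 1 := by
  unfold joinStep
  dsimp only
  split_ifs
  · exact used_update_le _ _ _
  · omega

theorem cnt_free_ge {own : ℕ → ℕ} (p : ℕ → Prop) :
    cnt n p ≤ cnt n (fun v => p v ∧ own v = 0) + used n own :=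
  (cnt_le_add_not p fun v => own v = 0).trans
    (Nat.add_le_add_left (cnt_mono fun _ _ h => h.2) _)

/-- With fewer than `b` labelled vertices, each vertex of `Z` still has at least `m / 1024`
neighbors among the candidates, which number at most `m`. By double counting, the best candidate
dominates at least a fraction `1 / 1024` of the undominated vertices. Having `b` common neighbors
with the root, it has a free one. -/
theorem domStep_undominated (hP : IsPrepared n H W m b Y Z R) (hm : 0 < m) {own : ℕ → ℕ} {t r : ℕ}
    (hr : R r) (hused : used n own < b) :
    1024 * undominated n H Z (domStep n H Y Z b t r own) t ≤ 1023 * undominated n H Z own t := by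
  have hH := hP.graph
  set C : ℕ → Prop := fun v => Y v ∧ own v = 0 ∧ b ≤ codeg n H r v with hC
  set F : ℕ → ℕ := fun v => cnt n fun z => Z z ∧ ¬ Touches n H own t z ∧ ¬ H v z with hF
  have helig : ∀ z, Z z → m ≤ 1024 * cnt n fun v => C v ∧ H z v := by
    intro z hz
    have h1 := hP.dominate r z hr hz
    have h2 := cnt_free_ge (n := n) (own := own) fun v => Y v ∧ b ≤ codeg n H r v ∧ H z v
    have h3 : cnt n (fun v => (Y v ∧ b ≤ codeg n H r v ∧ H z v) ∧ own v = 0) =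
        cnt n fun v => C v ∧ H z v := cnt_congr fun v _ => by simp only [hC]; tauto
    omega
  have hex : ∃ v < n, C v := by
    have h1 := hP.hit r hr
    obtain ⟨z, _, hz, _⟩ := cnt_pos.1 (by omega : 0 < cnt n fun z => Z z ∧ H r z)
    have h2 := helig z hz
    obtain ⟨v, hv, hCv, _⟩ := cnt_pos.1 (by omega : 0 < cnt n fun v => C v ∧ H z v)
    exact ⟨v, hv, hCv⟩
  obtain ⟨hvn, ⟨hYv, hv0, hbv⟩, -⟩ := argminN_spec (f := F) hex
  have havg := argminN_mul_le (f := F) (g := fun v => cnt n fun z => C v ∧ (Z z ∧ ¬ Touches n H own t z)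
    ∧ ¬ H v z) hex fun v _ hCv => (cnt_mono fun z _ hz => ⟨hCv, ⟨hz.1, hz.2.1⟩, hz.2.2⟩)
  have hpick : domPick n H Y Z b t r own = argminN n C F := rfl
  set v := argminN n C F with hv
  have hcex : ∃ c < n, own c = 0 ∧ H r c ∧ H c v := by
    have h2 := cnt_free_ge (n := n) (own := own) fun x => H r x ∧ H v x
    have h3 : codeg n H r v = cnt n fun x => H r x ∧ H v x := rfl
    obtain ⟨c, hc, h4, h5⟩ := cnt_pos.1
      (by omega : 0 < cnt n fun x => (H r x ∧ H v x) ∧ own x = 0)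
    exact ⟨c, hc, h5, h4.1, hH.symm _ _ h4.2⟩
  have hcn : connPick n H r v own < n := (findN_spec hcex).1
  set und := undominated n H Z own t with hund
  have hstep : undominated n H Z (domStep n H Y Z b t r own) t ≤ F v := by
    unfold domStep
    rw [hpick]
    dsimp only
    rw [if_pos hcn]
    refine cnt_mono fun z _ hz => ⟨hz.1, fun h => hz.2 (update_touches (update_touches h)),
      fun h => hz.2 ?_⟩
    refine update_touches ⟨v, hvn, by simp, h⟩
  have hsum : cnt n C * und = ∑ v ∈ Finset.range n, (cnt n fun z => C v ∧
      (Z z ∧ ¬ Touches n H own t z) ∧ ¬ H v z) + ∑ v ∈ Finset.range n, (cnt n fun z => C v ∧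
      (Z z ∧ ¬ Touches n H own t z) ∧ H v z) := by
    classical
    rw [cnt_eq_sum, Finset.sum_mul, ← Finset.sum_add_distrib]
    refine Finset.sum_congr rfl fun x _ => ?_
    by_cases hx : C x
    · rw [if_pos hx, one_mul, hund, undominated]
      simp only [cnt_eq_sum, ← Finset.sum_add_distrib, hx, true_and]
      refine Finset.sum_congr rfl fun z _ => ?_
      by_cases h1 : Z z ∧ ¬ Touches n H own t z <;> by_cases h2 : H x z <;> simp [h1, h2]
    · rw [if_neg hx, cnt_and_const _ _ _ hx, cnt_and_const _ _ _ hx, zero_mul, add_zero]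
  have hlow : und * m ≤ 1024 * ∑ v ∈ Finset.range n, (cnt n fun z => C v ∧
      (Z z ∧ ¬ Touches n H own t z) ∧ H v z) := by
    rw [sum_cnt_comm, Finset.mul_sum]
    refine cnt_mul_le_sum fun z _ hz => (helig z hz.1).trans (Nat.mul_le_mul_left _ ?_)
    exact cnt_mono fun v _ h => ⟨h.1, hz, hH.symm _ _ h.2⟩
  have hCm : cnt n C ≤ m := hP.card ▸ cnt_mono fun v _ h => hP.memY v h.1
  have hFle : F v ≤ und := cnt_mono fun z _ hz => ⟨hz.1, hz.2.1⟩
  -- Here `d` is the number of undominated vertices adjacent to `v`; the double counting bounds it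
  -- from below.
  obtain ⟨d, hd⟩ := Nat.exists_eq_add_of_le hFle
  have h1 : m * und ≤ m * (1024 * d) := by
    have : cnt n C * und = cnt n C * F v + cnt n C * d := by rw [hd]; ring
    calc m * und = und * m := mul_comm _ _
      _ ≤ 1024 * (cnt n C * d) := by omega
      _ ≤ 1024 * (m * d) := Nat.mul_le_mul_left _ (Nat.mul_le_mul_right _ hCm)
      _ = _ := by ring
  have h2 := Nat.le_of_mul_le_mul_left h1 hm
  omega

/-- At least `m / 512` free neighbors of the root in `Z` are candidates, and each earlier branch set
fails to touch at most `m / 2 ^ S` of them. So an average candidate misses at most a fraction `512 /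
2 ^ S` of the unjoined sets. -/
theorem joinStep_unjoined (hP : IsPrepared n H W m b Y Z R) (hm : 0 < m) {own : ℕ → ℕ} {h r S : ℕ}
    (hr : R r) (hused : used n own < b)
    (hdom : ∀ i < h, undominated n H Z own (i + 1) * 2 ^ S ≤ m) :
    2 ^ S * unjoined n H (joinStep n H Z h r own) h ≤ 512 * unjoined n H own h := by
  have hH := hP.graph
  set C : ℕ → Prop := fun v => Z v ∧ own v = 0 ∧ H r v with hC
  set F : ℕ → ℕ := fun v => cnt n fun i => i < h ∧ ¬ BranchJoined n H own (i + 1) (h + 1) ∧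
    ¬ Touches n H own (i + 1) v with hF
  have hCm : m ≤ 512 * cnt n C := by
    have h1 := hP.hit r hr
    have h2 := cnt_free_ge (n := n) (own := own) fun z => Z z ∧ H r z
    have h3 : cnt n (fun v => (Z v ∧ H r v) ∧ own v = 0) = cnt n C :=
      cnt_congr fun v _ => by simp only [hC]; tauto
    omega
  have hex : ∃ v < n, C v := cnt_pos.1 (by omega)
  obtain ⟨hvn, ⟨hZv, hv0, hrv⟩, -⟩ := argminN_spec (f := F) hex
  have havg := argminN_mul_le (f := F) (g := fun v => cnt n fun i =>
    (i < h ∧ ¬ BranchJoined n H own (i + 1) (h + 1)) ∧ C v ∧ ¬ Touches n H own (i + 1) v) hex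
    fun v _ hCv => (cnt_mono fun i _ hi => ⟨⟨hi.1, hi.2.1⟩, hCv, hi.2.2⟩)
  have hpick : joinPick n H Z h r own = argminN n C F := rfl
  set v := argminN n C F with hv
  have hstep : unjoined n H (joinStep n H Z h r own) h ≤ F v := by
    unfold joinStep
    rw [hpick]
    dsimp only
    rw [if_pos hvn]
    have ht : ∀ i < h, ∀ z, Touches n H own (i + 1) z →
        Touches n H (Function.update own v (h + 1)) (i + 1) z := by
      rintro i hi z ⟨y, hy, h1, h2⟩
      refine ⟨y, hy, ?_, h2⟩
      rw [Function.update_of_ne, h1]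
      rintro rfl
      omega
    refine cnt_mono fun i _ hi => ⟨hi.1, fun hj => hi.2 ?_, fun hj => hi.2 ?_⟩
    · obtain ⟨y, hy, h1, h2⟩ := hj
      refine ⟨y, hy, ?_, ht i hi.1 y h2⟩
      rw [Function.update_apply]
      split_ifs <;> simp [h1]
    · exact ⟨v, hvn, by simp, ht i hi.1 v hj⟩
  have hup : ∑ v ∈ Finset.range n, (cnt n fun i =>
      (i < h ∧ ¬ BranchJoined n H own (i + 1) (h + 1)) ∧ C v ∧ ¬ Touches n H own (i + 1) v) ≤
      unjoined n H own h * (m / 2 ^ S) := by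
    rw [sum_cnt_comm]
    refine sum_le_cnt_mul (fun i _ hi => ?_) fun i _ hi => cnt_and_const _ _ _ hi
    rw [Nat.le_div_iff_mul_le (by positivity)]
    refine le_trans (Nat.mul_le_mul_right _ (cnt_mono fun v _ hv => ?_)) (hdom i hi.1)
    exact ⟨hv.2.1.1, hv.2.2⟩
  have h1 : m * (2 ^ S * F v) ≤ m * (512 * unjoined n H own h) := by
    calc m * (2 ^ S * F v) ≤ 512 * cnt n C * (2 ^ S * F v) := Nat.mul_le_mul_right _ hCm
      _ = 512 * 2 ^ S * (cnt n C * F v) := by ring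
      _ ≤ 512 * 2 ^ S * (unjoined n H own h * (m / 2 ^ S)) :=
        Nat.mul_le_mul_left _ (havg.trans hup)
      _ = 512 * unjoined n H own h * (m / 2 ^ S * 2 ^ S) := by ring
      _ ≤ 512 * unjoined n H own h * m := Nat.mul_le_mul_left _ (Nat.div_mul_le_self _ _)
      _ = _ := by ring
  exact (Nat.mul_le_mul_left _ hstep).trans (Nat.le_of_mul_le_mul_left h1 hm)

end

/-! ### Iteration of the steps, and the number of branch sets. -/

section

variable {n : ℕ} {H : ℕ → ℕ → Prop} {W Y Z R : ℕ → Prop} {m b : ℕ}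

/-- Only free vertices receive labels, so no vertex loses a nonzero label. -/
theorem Grows.undominated_le {own₀ own : ℕ → ℕ} {t r : ℕ} (hg : Grows n H own₀ t r own) {i : ℕ}
    (hi : i ≠ 0) : undominated n H Z own i ≤ undominated n H Z own₀ i := by
  refine cnt_mono fun z _ hz => ⟨hz.1, fun ⟨y, hy, h1, h2⟩ => hz.2 ⟨y, hy, ?_, h2⟩⟩
  rcases hg.ext y with h | h
  · rw [h, h1]
  · exact absurd (h1.symm.trans h.1) hi

theorem used_iterate_domStep_le (t r : ℕ) (own : ℕ → ℕ) (k : ℕ) :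
    used n ((domStep n H Y Z b t r)^[k] own) ≤ used n own + 2 * k := by
  induction k with
  | zero => simp
  | succ k ih =>
    rw [Function.iterate_succ_apply']
    have := used_domStep_le (n := n) (H := H) (Y := Y) (Z := Z) (b := b) t r
      ((domStep n H Y Z b t r)^[k] own)
    omega

theorem used_iterate_joinStep_le (h r : ℕ) (own : ℕ → ℕ) (k : ℕ) :
    used n ((joinStep n H Z h r)^[k] own) ≤ used n own + k := by
  induction k with
  | zero => simp
  | succ k ih =>
    rw [Function.iterate_succ_apply']
    have := used_joinStep_le (n := n) (H := H) (Z := Z) h r ((joinStep n H Z h r)^[k] own)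
    omega

theorem iterate_domStep_undominated (hP : IsPrepared n H W m b Y Z R) (hm : 0 < m) {own : ℕ → ℕ}
    {t r : ℕ} (hr : R r) {k : ℕ} (hused : used n own + 2 * k < b) :
    1024 ^ k * undominated n H Z ((domStep n H Y Z b t r)^[k] own) t ≤ 1023 ^ k * m := by
  induction k with
  | zero =>
    have : undominated n H Z own t ≤ m := hP.card ▸ cnt_mono fun z _ hz => hP.memZ z hz.1
    simpa using this
  | succ k ih =>
    rw [Function.iterate_succ_apply']
    have h1 := used_iterate_domStep_le (n := n) (H := H) (Y := Y) (Z := Z) (b := b) t r own k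
    have h2 := domStep_undominated hP hm (t := t) hr (lt_of_le_of_lt h1 (by omega))
    calc _ = 1024 ^ k * (1024 * undominated n H Z
          (domStep n H Y Z b t r ((domStep n H Y Z b t r)^[k] own)) t) := by ring
      _ ≤ 1024 ^ k * (1023 * undominated n H Z ((domStep n H Y Z b t r)^[k] own) t) :=
        Nat.mul_le_mul_left _ h2
      _ = 1023 * (1024 ^ k * undominated n H Z ((domStep n H Y Z b t r)^[k] own) t) := by ring
      _ ≤ 1023 * (1023 ^ k * m) := Nat.mul_le_mul_left _ (ih (by omega))
      _ = _ := by ring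

/-- Bernoulli's inequality for `(1 + 1 / 1023) ^ 1024`: every `1024` rounds of domination halve what
is left. -/
theorem two_pow_mul_le (S : ℕ) : 2 ^ S * 1023 ^ (1024 * S) ≤ 1024 ^ (1024 * S) := by
  have h : (2 : ℕ) * 1023 ^ 1024 ≤ 1024 ^ 1024 := by
    have h1 := one_add_mul_le_pow (a := (1 / 1023 : ℝ)) (by norm_num) 1024
    have h2 : (2 : ℝ) ≤ (1024 / 1023) ^ 1024 := by
      refine le_trans ?_ (h1.trans_eq ?_)
      · norm_num
      · congr 1; norm_num
    rw [div_pow, le_div_iff₀ (by positivity)] at h2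
    exact_mod_cast h2
  rw [pow_mul, pow_mul, ← mul_pow]
  exact Nat.pow_le_pow_left h S

theorem undominated_mul_le (hP : IsPrepared n H W m b Y Z R) (hm : 0 < m) {own : ℕ → ℕ}
    {t r : ℕ} (hr : R r) {S : ℕ} (hused : used n own + 2 * (1024 * S) < b) :
    undominated n H Z ((domStep n H Y Z b t r)^[1024 * S] own) t * 2 ^ S ≤ m := by
  set u := undominated n H Z ((domStep n H Y Z b t r)^[1024 * S] own) t with hu
  have h1 := iterate_domStep_undominated hP hm (t := t) hr hused
  rw [← hu] at h1
  refine Nat.le_of_mul_le_mul_left (c := 1023 ^ (1024 * S)) ?_ (by positivity)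
  refine le_trans ?_ h1
  calc 1023 ^ (1024 * S) * (u * 2 ^ S) = (2 ^ S * 1023 ^ (1024 * S)) * u := by ring
    _ ≤ _ := Nat.mul_le_mul_right _ (two_pow_mul_le S)

theorem iterate_joinStep_unjoined (hP : IsPrepared n H W m b Y Z R) (hm : 0 < m) {own : ℕ → ℕ}
    {h r S : ℕ} (hr : R r) (hg : Grows n H own (h + 1) r own)
    (hdom : ∀ i < h, undominated n H Z own (i + 1) * 2 ^ S ≤ m) {k : ℕ}
    (hused : used n own + k < b) :
    (2 ^ S) ^ k * unjoined n H ((joinStep n H Z h r)^[k] own) h ≤ 512 ^ k * h := by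
  induction k with
  | zero =>
    have : unjoined n H own h ≤ h := by
      refine le_trans (cnt_mono (q := fun i => i < h) fun i _ hi => hi.1) ?_
      classical
      unfold cnt
      refine (Finset.card_le_card (t := Finset.range h) fun i hi => ?_).trans_eq
        (Finset.card_range h)
      simp only [Finset.mem_filter] at hi
      simpa using hi.2
    simpa using this
  | succ k ih =>
    rw [Function.iterate_succ_apply']
    have h1 := used_iterate_joinStep_le (n := n) (H := H) (Z := Z) h r own k
    have hgk := hg.iterate_joinStep (Z := Z) hP.graph k
    have h2 := joinStep_unjoined hP hm hr (lt_of_le_of_lt h1 (by omega)) (h := h) (S := S)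
      fun i hi => (Nat.mul_le_mul_right _ (hgk.undominated_le (by omega))).trans (hdom i hi)
    set f := joinStep n H Z h r
    calc _ = (2 ^ S) ^ k * (2 ^ S * unjoined n H (f (f^[k] own)) h) := by ring
      _ ≤ (2 ^ S) ^ k * (512 * unjoined n H (f^[k] own) h) := Nat.mul_le_mul_left _ h2
      _ = 512 * ((2 ^ S) ^ k * unjoined n H (f^[k] own) h) := by ring
      _ ≤ 512 * (512 ^ k * h) := Nat.mul_le_mul_left _ (ih (by omega))
      _ = _ := by ring

theorem IsPrepared.edge (hP : IsPrepared n H W m b Y Z R) (hm : 0 < m) (v : ℕ) (hv : R v) :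
    ∃ u, H v u := by
  have := hP.hit v hv
  obtain ⟨u, -, -, h⟩ := cnt_pos.1 (by omega : 0 < cnt n fun z => Z z ∧ H v z)
  exact ⟨u, h⟩

/-- One more branch set is grown from the root `r`. -/
noncomputable def addBranch (n : ℕ) (H : ℕ → ℕ → Prop) (Y Z : ℕ → Prop) (b k h r : ℕ)
    (own : ℕ → ℕ) : ℕ → ℕ :=
  (joinStep n H Z h r)^[k] ((domStep n H Y Z b (h + 1) r)^[k] (Function.update own r (h + 1)))

theorem addBranch_grows (hH : IsGraph n H) {own : ℕ → ℕ} {k h r : ℕ}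
    (hlt : ∀ v, own v ≠ 0 → v < n) (hle : ∀ v, own v ≤ h) (hr : r < n) (hr0 : own r = 0) :
    Grows n H own (h + 1) r (addBranch n H Y Z b k h r own) :=
  ((Grows.init hlt (fun v => by have := hle v; omega) hr hr0).iterate_domStep hH k).iterate_joinStep
    hH k

theorem Grows.self {own₀ own : ℕ → ℕ} {t r : ℕ} (hg : Grows n H own₀ t r own) :
    Grows n H own t r own :=
  ⟨fun _ => Or.inl rfl, hg.lt, hg.root, hg.conn⟩

/-- The budget `1 + 3 * (1024 * S)` pays for the root, two vertices per round of domination and one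
per round of joining. After the latter at most `h * (512 / 2 ^ S) ^ (1024 * S)` sets are unjoined.
As `512 = 2 ^ 9` and `S ≥ 10`, this is at most `h / 2 ^ (S * S) < 1`, hence none. -/
theorem addBranch_succeeds (hP : IsPrepared n H W m b Y Z R) (hm : 0 < m) {own : ℕ → ℕ}
    {h r S : ℕ} (hlt : ∀ v, own v ≠ 0 → v < n) (hle : ∀ v, own v ≤ h) (hr : R r) (hr0 : own r = 0)
    (hdom : ∀ i < h, undominated n H Z own (i + 1) * 2 ^ S ≤ m) (hS : 10 ≤ S)
    (hhm : h < 2 ^ (S * S)) (hused : used n own + 1 + 3 * (1024 * S) < b) :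
    (∀ i < h + 1, undominated n H Z (addBranch n H Y Z b (1024 * S) h r own) (i + 1) * 2 ^ S ≤ m) ∧
    unjoined n H (addBranch n H Y Z b (1024 * S) h r own) h = 0 ∧
    used n (addBranch n H Y Z b (1024 * S) h r own) ≤ used n own + (1 + 3 * (1024 * S)) := by
  have hH := hP.graph
  have hrn := hP.ltR r hr
  set k := 1024 * S with hk
  have g1 : Grows n H own (h + 1) r _ :=
    Grows.init hlt (fun v => by have := hle v; omega) hrn hr0
  have u1 := used_update_le (n := n) own r (h + 1)
  set o1 := Function.update own r (h + 1) with ho1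
  have g2 := g1.iterate_domStep (Y := Y) (Z := Z) (b := b) hH k
  have u2 := used_iterate_domStep_le (n := n) (H := H) (Y := Y) (Z := Z) (b := b) (h + 1) r o1 k
  have d2 := undominated_mul_le hP hm (t := h + 1) (own := o1) hr (S := S) (by omega)
  rw [← hk] at d2
  set o2 := (domStep n H Y Z b (h + 1) r)^[k] o1 with ho2
  have g3 := g2.iterate_joinStep (Z := Z) hH k
  have g3' := g2.self.iterate_joinStep (Z := Z) hH k
  have u3 := used_iterate_joinStep_le (n := n) (H := H) (Z := Z) h r o2 k
  have j3 := iterate_joinStep_unjoined hP hm hr g2.self (S := S)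
    (fun i hi => (Nat.mul_le_mul_right _ (g2.undominated_le (by omega))).trans (hdom i hi))
    (k := k) (by omega)
  change (∀ i < h + 1, undominated n H Z ((joinStep n H Z h r)^[k] o2) _ * _ ≤ _) ∧
    unjoined n H ((joinStep n H Z h r)^[k] o2) h = 0 ∧
    used n ((joinStep n H Z h r)^[k] o2) ≤ _
  set o3 := (joinStep n H Z h r)^[k] o2 with ho3
  refine ⟨fun i hi => ?_, ?_, by omega⟩
  · by_cases hih : i < h
    · exact (Nat.mul_le_mul_right _ (g3.undominated_le (by omega))).trans (hdom i hih)
    · have : i = h := by omega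
      subst this
      exact (Nat.mul_le_mul_right _ (g3'.undominated_le (by omega))).trans d2
  · by_contra hne
    have h1 : 1 ≤ unjoined n H o3 h := Nat.one_le_iff_ne_zero.2 hne
    obtain ⟨d, hd⟩ := Nat.exists_eq_add_of_le (show 9 ≤ S by omega)
    have e1 : (2 ^ S) ^ k = 512 ^ k * (2 ^ d) ^ k := by
      rw [hd, pow_add, mul_pow]; norm_num
    rw [e1, mul_assoc] at j3
    have h2 := Nat.le_of_mul_le_mul_left j3 (by positivity)
    have h3 : 2 ^ (S * S) ≤ (2 ^ d) ^ k := by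
      rw [← pow_mul]
      refine Nat.pow_le_pow_right (by norm_num) ?_
      have : S ≤ d * 1024 := by omega
      calc S * S ≤ (d * 1024) * S := Nat.mul_le_mul_right _ this
        _ = d * k := by rw [hk]; ring
    have h4 : (2 ^ d) ^ k * 1 ≤ (2 ^ d) ^ k * unjoined n H o3 h := Nat.mul_le_mul_left _ h1
    omega

/-- The labels `1, …, h` mark branch sets of a clique minor. -/
structure Branches (n : ℕ) (H : ℕ → ℕ → Prop) (own : ℕ → ℕ) (h : ℕ) : Prop where
  lt : ∀ v, own v ≠ 0 → v < n
  le : ∀ v, own v ≤ h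
  conn : ∀ i < h, ConnOn H {v | own v = i + 1}
  joined : ∀ i j, i < j → j < h → BranchJoined n H own (i + 1) (j + 1)
  le_used : h ≤ used n own
  edge : ∀ v, own v ≠ 0 → ∃ u, H v u

theorem Branches.zero : Branches n H (fun _ => 0) 0 :=
  ⟨by simp, by simp, by simp, by simp, by simp, by simp⟩

theorem Branches.le_size {own : ℕ → ℕ} {h : ℕ} (hb : Branches n H own h) : h ≤ n :=
  hb.le_used.trans (cnt_le _ _)

theorem Branches.grow {own own' : ℕ → ℕ} {h r : ℕ} (hb : Branches n H own h) (hr : r < n)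
    (hr1 : ∃ u, H r u) (hr0 : own r = 0) (hg : Grows n H own (h + 1) r own') (hj : unjoined n H own' h = 0) :
    Branches n H own' (h + 1) := by
  have hext : ∀ t, t ≠ 0 → t ≠ h + 1 → ∀ v, own' v = t ↔ own v = t := by
    intro t ht ht' v
    rcases hg.ext v with h | h
    · rw [h]
    · rw [h.1, h.2]
      exact ⟨fun h => absurd h.symm ht', fun h => absurd h.symm ht⟩
  have hn := hb.le_size
  refine ⟨hg.lt, fun v => ?_, fun i hi => ?_, fun i j hij hjh => ?_, ?_,
    fun v hv => ?_⟩
  · rcases hg.ext v with h | h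
    · rw [h]; exact (hb.le v).trans (by omega)
    · exact h.2.le
  · by_cases hih : i = h
    · subst hih; exact hg.conn
    · have : {v | own' v = i + 1} = {v | own v = i + 1} := by
        ext v; exact hext _ (by omega) (by omega) v
      rw [this]
      exact hb.conn i (by omega)
  · by_cases hjh' : j = h
    · subst hjh'
      have := cnt_eq_zero.1 hj i (by omega)
      by_contra hne
      exact this ⟨hij, hne⟩
    · obtain ⟨y, hy, h1, x, hx, h2, h3⟩ := hb.joined i j hij (by omega)
      exact ⟨y, hy, (hext _ (by omega) (by omega) _).2 h1, x, hx,
        (hext _ (by omega) (by omega) _).2 h2, h3⟩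
  · refine le_trans (Nat.add_le_add_right hb.le_used 1) ?_
    unfold used
    rw [cnt_eq_succ (p := fun v => own' v ≠ 0) (v := r) hr (by rw [hg.root]; omega)]
    refine Nat.add_le_add_right (cnt_mono fun v _ hv => ⟨?_, ?_⟩) 1
    · rcases hg.ext v with h | h
      · rwa [h]
      · exact absurd h.1 hv
    · rintro rfl; exact hv hr0
  · rcases hg.ext v with h | h
    · exact hb.edge v (h ▸ hv)
    -- A newly labelled vertex is the root or has a first edge on its path to the root.
    · rcases (hg.conn.2 v h.2 r hg.root).cases_head with h1 | ⟨u, h1, -⟩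
      · rwa [h1]
      · exact ⟨u, h1.2.2⟩

/-- The next branch set is accepted if enough vertices were free and it is joined to all others. -/
noncomputable def growStep (n : ℕ) (H : ℕ → ℕ → Prop) (Y Z R : ℕ → Prop) (b u k : ℕ)
    (s : (ℕ → ℕ) × ℕ) : (ℕ → ℕ) × ℕ :=
  open Classical in
  let r := findN n fun v => R v ∧ s.1 v = 0
  let own := addBranch n H Y Z b k s.2 r s.1
  if used n s.1 ≤ u ∧ r < n ∧ unjoined n H own s.2 = 0 then (own, s.2 + 1) else s

theorem Branches.growStep (hH : IsGraph n H) (hR : ∀ v, R v → ∃ u, H v u) {u k : ℕ} {s : (ℕ → ℕ) × ℕ}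
    (hb : Branches n H s.1 s.2) :
    Branches n H (growStep n H Y Z R b u k s).1 (growStep n H Y Z R b u k s).2 := by
  unfold _root_.growStep
  dsimp only
  split_ifs with h
  · have h0 := (findN_lt h.2.1).2
    exact hb.grow h.2.1 (hR _ (findN_lt h.2.1).1) h0 (addBranch_grows hH hb.lt hb.le h.2.1 h0) h.2.2
  · exact hb

theorem Branches.iterate_growStep (hH : IsGraph n H) (hR : ∀ v, R v → ∃ u, H v u) {u k : ℕ}
    (j : ℕ) :
    Branches n H ((_root_.growStep n H Y Z R b u k)^[j] (fun _ => 0, 0)).1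
      ((_root_.growStep n H Y Z R b u k)^[j] (fun _ => 0, 0)).2 := by
  induction j with
  | zero => exact Branches.zero
  | succ j ih =>
    rw [Function.iterate_succ_apply']
    exact ih.growStep hH hR

/-- While at most `u` vertices are labelled, a root is free and the next branch set succeeds. Once
more are labelled, dividing by the cost of a branch set gives the bound. If `n` rounds succeeded,
there would be `n` branch sets, which use more than `u` vertices as well. -/
theorem growStep_count (hP : IsPrepared n H W m b Y Z R) (hm : 0 < m) {u S : ℕ}
    (hS : 10 ≤ S) (hum : u < 2 ^ (S * S)) (hu : u + 1 + 3 * (1024 * S) < b) (hun : u < n) :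
    u < ((growStep n H Y Z R b u (1024 * S))^[n] (fun _ => 0, 0)).2 * (1 + 3 * (1024 * S)) := by
  have key : ∀ j, ∀ s, s = (growStep n H Y Z R b u (1024 * S))^[j] (fun _ => 0, 0) →
      (∀ i < s.2, undominated n H Z s.1 (i + 1) * 2 ^ S ≤ m) ∧
      used n s.1 ≤ s.2 * (1 + 3 * (1024 * S)) ∧ (u < used n s.1 ∨ s.2 = j) := by
    intro j
    induction j with
    | zero =>
      rintro s rfl
      refine ⟨by simp, ?_, Or.inr rfl⟩
      simp [used, cnt_eq_zero]
    | succ j ih =>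
      intro s hs
      rw [Function.iterate_succ_apply'] at hs
      obtain ⟨h1, h2, h3⟩ := ih _ rfl
      have hb := Branches.iterate_growStep (n := n) (H := H) (Y := Y) (Z := Z) (R := R) (b := b)
        hP.graph (hP.edge hm) (u := u) (k := 1024 * S) j
      set s' := (growStep n H Y Z R b u (1024 * S))^[j] (fun _ => 0, 0) with hs'
      by_cases hus : used n s'.1 ≤ u
      · have hex : ∃ v < n, R v ∧ s'.1 v = 0 := by
          have h4 := cnt_free_ge (n := n) (own := s'.1) R
          have h5 := hP.roots
          exact cnt_pos.1 (by omega)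
        obtain ⟨hr, ⟨hRr, hr0⟩, -⟩ := findN_spec hex
        obtain ⟨a1, a2, a3⟩ := addBranch_succeeds hP hm hb.lt hb.le hRr hr0 h1 hS
          (by have := hb.le_used; omega) (by omega)
        have hstep : growStep n H Y Z R b u (1024 * S) s' =
            (addBranch n H Y Z b (1024 * S) s'.2 (findN n fun v => R v ∧ s'.1 v = 0) s'.1,
              s'.2 + 1) := by
          unfold growStep
          exact if_pos ⟨hus, hr, a2⟩
        rw [hs, hstep]
        refine ⟨a1, ?_, Or.inr ?_⟩
        · dsimp only
          rw [add_mul, one_mul]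
          omega
        · dsimp only
          omega
      · have hstep : growStep n H Y Z R b u (1024 * S) s' = s' := by
          unfold growStep
          exact if_neg fun h => hus h.1
        rw [hs, hstep]
        exact ⟨h1, h2, Or.inl (by omega)⟩
  obtain ⟨-, h2, h3⟩ := key n _ rfl
  have hb := Branches.iterate_growStep (n := n) (H := H) (Y := Y) (Z := Z) (R := R) (b := b)
    hP.graph (hP.edge hm) (u := u) (k := 1024 * S) n
  have := hb.le_used
  rcases h3 with h3 | h3
  · omega
  · omega

end

/-! ### The growth of the branch sets as a program. -/

namespace Bounded

variable {n : ℕ} {w : ℕ → ℕ}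

theorem Cmd.run_ite (e : Ex) (P Q : Cmd) (S : St) [Decidable (e.holds n w S)] :
    (Cmd.ite e P Q).run n w S = if e.holds n w S then P.run n w S else Q.run n w S := by
  simp only [Cmd.run, Ex.holds]
  congr

theorem Cmd.run_write (a : ℕ) (u v e : Ex) (S : St) : (Cmd.write a u v e).run n w S =
    S.write n a (u.eval n w S) (v.eval n w S) (e.eval n w S) := rfl

theorem Cmd.run_mat_of_le (P : Cmd) (S : St) (a u : ℕ) {v : ℕ} (hv : n ≤ v) :
    (P.run n w S).mat a u v = S.mat a u v := by
  induction P generalizing S with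
  | skip => rfl
  | set i e => rfl
  | write b u v e =>
    simp only [Cmd.run]
    rw [St.mat_write, if_neg (by omega)]
  | emit e => rfl
  | seq P Q hP hQ => rw [Cmd.run_seq, hQ, hP]
  | ite e P Q hP hQ =>
    simp only [Cmd.run]
    split_ifs
    · exact hP S
    · exact hQ S
  | forTo i P hP =>
    refine Cmd.run_forTo_induct (fun _ T => T.mat a u v = S.mat a u v) rfl fun j _ T hT => ?_
    rw [hP, ← hT]
    rfl

/-- Register `d` receives the binary length of the value of `e`; register `t` is for intermediate
results. -/
def sizeCmd (d t : ℕ) (e : Ex) : Cmd :=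
  .seq (.set t e) <| .seq (.set d (.const 0)) <|
  .forTo 0 (.ite (.reg t) (.seq (.set d (.add (.reg d) (.const 1))) (.set t (.half (.reg t)))) .skip)

/-- The binary length is the number of halvings down to zero; `n` rounds suffice because the value
is at most `n < 2 ^ n`. -/
theorem sizeCmd_spec {d t : ℕ} {e : Ex} (S : St) (hdt : d ≠ t) (hd : d ≠ 0) (ht : t ≠ 0)
    (he : e.eval n w S ≤ n) : ((sizeCmd d t e).run n w S).reg d = Nat.size (e.eval n w S) := by
  classical
  set x := e.eval n w S with hx
  rw [sizeCmd, Cmd.run_seq, Cmd.run_seq, Cmd.run_set, Cmd.run_set, ← hx, Ex.eval_const]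
  have key := Cmd.run_forTo_induct (n := n) (w := w) (i := 0)
    (S := (S.setReg t x).setReg d 0)
    (P := .ite (.reg t) (.seq (.set d (.add (.reg d) (.const 1))) (.set t (.half (.reg t)))) .skip)
    (fun j T => T.reg t = x / 2 ^ T.reg d ∧ T.reg d ≤ Nat.size x ∧ (T.reg t = 0 ∨ T.reg d = j))
    ⟨by simp [hdt.symm], by simp, by simp⟩ ?_
  · obtain ⟨h1, h2, h3⟩ := key
    refine le_antisymm h2 (Nat.size_le.2 ?_)
    have hpos : 0 < 2 ^ ((Cmd.forTo 0 (.ite (.reg t) (.seq (.set d (.add (.reg d) (.const 1)))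
      (.set t (.half (.reg t)))) .skip)).run n w ((S.setReg t x).setReg d 0)).reg d := by positivity
    rcases h3 with h3 | h3
    · rw [h3] at h1
      exact (Nat.div_eq_zero_iff_lt hpos).1 h1.symm
    · rw [h3]
      exact he.trans_lt Nat.lt_two_pow_self
  · rintro j hj T ⟨h1, h2, h3⟩
    rw [Cmd.run_ite]
    split_ifs with h
    · simp only [Ex.holds_reg, St.reg_setReg, if_neg ht] at h
      simp only [Cmd.run, St.reg_setReg, Ex.eval_add, Ex.eval_reg, Ex.eval_const, Ex.eval_half, if_neg hd,
        if_neg ht, hdt, hdt.symm, if_true, if_false]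
      refine ⟨?_, ?_, Or.inr ?_⟩
      · rw [h1, pow_succ, Nat.div_div_eq_div_mul]
      · refine Nat.lt_size.2 ?_
        by_contra hlt
        exact h (h1.trans (Nat.div_eq_of_lt (by omega)))
      · rcases h3 with h3 | h3
        · exact absurd h3 h
        · rw [h3]
    · simp only [Ex.holds_reg, St.reg_setReg, if_neg ht, ne_eq, not_not] at h
      simp only [Cmd.run, St.reg_setReg, if_neg hd, if_neg ht]
      exact ⟨h1, h2, Or.inl h⟩

/-- Some vertex with the label `t` is adjacent to `z`, where array `14` holds the labels. -/
def touchesEx (t z : Ex) : Ex :=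
  .ex 14 (.and (.eq (.vec 14 (.reg 14)) t) (.read 11 (.reg 14) z))

def joinedEx (i t : Ex) : Ex :=
  .ex 16 (.and (.eq (.vec 14 (.reg 16)) t) (touchesEx i (.reg 16)))

/-- The label of the next branch set. -/
def labelEx : Ex := .add (.reg 20) (.const 1)

def domCmd : Cmd :=
  .seq (.set 28 (.argmin 10 11 12
    (fun v => .and (.vec 5 (.reg v)) (.and (.eq (.vec 14 (.reg v)) (.const 0)) (.le (.reg 22)
      (.cnt 13 (.and (.read 11 (.reg 27) (.reg 13)) (.read 11 (.reg v) (.reg 13)))))))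
    fun v => .cnt 13 (.and (.vec 6 (.reg 13)) (.and (.not (touchesEx labelEx (.reg 13)))
      (.not (.read 11 (.reg v) (.reg 13))))))) <|
  .seq (.set 29 (.find 10 11 (.and (.eq (.vec 14 (.reg 11)) (.const 0))
    (.and (.read 11 (.reg 27) (.reg 11)) (.read 11 (.reg 11) (.reg 28))))))
  (.ite (.lt (.reg 29) .size)
    (.seq (.write 14 (.const 0) (.reg 28) labelEx) (.write 14 (.const 0) (.reg 29) labelEx)) .skip)

theorem domCmd_spec (S : St) {H : ℕ → ℕ → Prop} {Y Z : ℕ → Prop} (hH : IsGraph n H)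
    (hSH : ∀ u v, S.mat 11 u v ≠ 0 ↔ H u v) (hY : ∀ v, S.mat 5 0 v ≠ 0 ↔ Y v)
    (hZ : ∀ v, S.mat 6 0 v ≠ 0 ↔ Z v) :
    (domCmd.run n w S).mat 14 0 =
      domStep n H Y Z (S.reg 22) (S.reg 20 + 1) (S.reg 27) (S.mat 14 0) := by
  classical
  rw [domCmd, Cmd.run_seq, Cmd.run_set, Ex.eval_argmin n w S (by decide)
    (fun v => Y v ∧ S.mat 14 0 v = 0 ∧ S.reg 22 ≤ codeg n H (S.reg 27) v)
    (fun v => cnt n fun z => Z z ∧ ¬ Touches n H (S.mat 14 0) (S.reg 20 + 1) z ∧ ¬ H v z)]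
  rotate_left
  · intro x v hv; simp [hSH, hY, codeg]
  · intro x v hv u hu; simp [hSH, hY, codeg]
  · intro x v hv u hu; simp [hSH, hZ, touchesEx, labelEx, Touches]
  · intro x v hv u hu; simp [hSH, hZ, touchesEx, labelEx, Touches]
  change (Cmd.run n w _ (S.setReg 28 (domPick n H Y Z (S.reg 22) (S.reg 20 + 1) (S.reg 27)
    (S.mat 14 0)))).mat 14 0 = _
  unfold domStep
  set v := domPick n H Y Z (S.reg 22) (S.reg 20 + 1) (S.reg 27) (S.mat 14 0) with hv
  rw [Cmd.run_seq, Cmd.run_set, Ex.eval_find n w _ (by decide)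
    (fun c => S.mat 14 0 c = 0 ∧ H (S.reg 27) c ∧ H c v)]
  rotate_left
  · intro x v hv; simp [hSH]
  change (Cmd.run n w _ (St.setReg _ 29 (connPick n H (S.reg 27) v (S.mat 14 0)))).mat 14 0 = _
  set c := connPick n H (S.reg 27) v (S.mat 14 0) with hc
  rw [Cmd.run_ite]
  simp only [Ex.holds_lt, Ex.eval_reg, St.reg_setReg, Ex.eval_size, if_true]
  split_ifs with h
  · have hcv : H c v := (findN_lt h).2.2
    rw [Cmd.run_seq, Cmd.run_write, Cmd.run_write]
    simp only [Ex.eval_const, Ex.eval_reg, St.reg_setReg, St.reg_write, labelEx, Ex.eval_add]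
    rw [St.mat_write_row _ (by simpa using h), St.mat_write_row _ (by simpa using hH.lt' hcv)]
    simp [← hc]
  · rfl

/-- No test is needed: without a candidate, register `28` holds `n`, and writing in that column has
no effect. -/
def joinCmd : Cmd :=
  .seq (.set 28 (.argmin 10 11 12
    (fun v => .and (.vec 6 (.reg v)) (.and (.eq (.vec 14 (.reg v)) (.const 0))
      (.read 11 (.reg 27) (.reg v))))
    fun v => .cnt 15 (.and (.lt (.reg 15) (.reg 20)) (.and
      (.not (joinedEx (.add (.reg 15) (.const 1)) labelEx))
      (.not (touchesEx (.add (.reg 15) (.const 1)) (.reg v)))))))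
  (.write 14 (.const 0) (.reg 28) labelEx)

theorem joinCmd_spec (S : St) {H : ℕ → ℕ → Prop} {Z : ℕ → Prop}
    (hSH : ∀ u v, S.mat 11 u v ≠ 0 ↔ H u v) (hZ : ∀ v, S.mat 6 0 v ≠ 0 ↔ Z v) :
    (joinCmd.run n w S).mat 14 0 = joinStep n H Z (S.reg 20) (S.reg 27) (S.mat 14 0) := by
  classical
  rw [joinCmd, Cmd.run_seq, Cmd.run_set, Ex.eval_argmin n w S (by decide)
    (fun v => Z v ∧ S.mat 14 0 v = 0 ∧ H (S.reg 27) v)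
    (fun v => cnt n fun i => i < S.reg 20 ∧ ¬ BranchJoined n H (S.mat 14 0) (i + 1) (S.reg 20 + 1) ∧
      ¬ Touches n H (S.mat 14 0) (i + 1) v)]
  rotate_left
  · intro x v hv; simp [hSH, hZ]
  · intro x v hv u hu; simp [hSH, hZ]
  · intro x v hv u hu; simp [hSH, joinedEx, touchesEx, labelEx, Touches, BranchJoined]
  · intro x v hv u hu; simp [hSH, joinedEx, touchesEx, labelEx, Touches, BranchJoined]
  change (Cmd.run n w _ (S.setReg 28 (joinPick n H Z (S.reg 20) (S.reg 27)
    (S.mat 14 0)))).mat 14 0 = _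
  unfold joinStep
  set v := joinPick n H Z (S.reg 20) (S.reg 27) (S.mat 14 0) with hv
  rw [Cmd.run_write]
  simp only [Ex.eval_const, Ex.eval_reg, St.reg_setReg, labelEx, Ex.eval_add, if_true,
    show (20 : ℕ) ≠ 28 by decide, if_false]
  split_ifs with h
  · rw [St.mat_write_row _ h, St.mat_setReg]
  · funext x
    rw [St.mat_write, if_neg (by simp; omega)]
    rfl

/-- Array `14` receives the labels with one more branch set, which is accepted, that is, copied to
array `8`, if it is joined to all others. -/
def growCmd : Cmd :=
  .seq (.fill 14 1 (.vec 8 (.reg 1))) <|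
  .seq (.set 27 (.find 10 11 (.and (.vec 7 (.reg 11)) (.eq (.vec 14 (.reg 11)) (.const 0))))) <|
  .seq (.write 14 (.const 0) (.reg 27) labelEx) <|
  .seq (.forTo 1 (.ite (.lt (.reg 1) (.reg 26)) domCmd .skip)) <|
  .seq (.forTo 1 (.ite (.lt (.reg 1) (.reg 26)) joinCmd .skip)) <|
  .ite (.and (.le (.cnt 10 (.not (.eq (.vec 8 (.reg 10)) (.const 0)))) (.reg 25))
      (.and (.lt (.reg 27) .size) (.not (.ex 15 (.and (.lt (.reg 15) (.reg 20))
        (.not (joinedEx (.add (.reg 15) (.const 1)) labelEx)))))))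
    (.seq (.fill 8 1 (.vec 14 (.reg 1))) (.set 20 labelEx)) .skip

/-- Every loop has length `n`, so a prescribed number of rounds is obtained by a guard and is
truncated at `n`. The predicate `I` records what the body leaves unchanged. -/
theorem Cmd.run_iterate {i : ℕ} {P : Cmd} {S : St} {k a : ℕ} (hk : i ≠ k)
    (f : (ℕ → ℕ) → ℕ → ℕ) (I : St → Prop) (hI : I S) (hIi : ∀ T j, I T → I (T.setReg i j))
    (hP : ∀ T, I T → I (P.run n w T) ∧ (P.run n w T).reg k = T.reg k ∧
      (P.run n w T).mat a 0 = f (T.mat a 0)) :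
    ((Cmd.forTo i (.ite (.lt (.reg i) (.reg k)) P .skip)).run n w S).mat a 0 =
      f^[min (S.reg k) n] (S.mat a 0) ∧
    I ((Cmd.forTo i (.ite (.lt (.reg i) (.reg k)) P .skip)).run n w S) := by
  classical
  have := Cmd.run_forTo_induct (n := n) (w := w) (i := i) (S := S)
    (P := .ite (.lt (.reg i) (.reg k)) P .skip)
    (fun j T => I T ∧ T.reg k = S.reg k ∧ T.mat a 0 = f^[min (S.reg k) j] (S.mat a 0))
    ⟨hI, rfl, by simp⟩ ?_
  · exact ⟨this.2.2, this.1⟩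
  · rintro j hj T ⟨h1, h2, h3⟩
    rw [Cmd.run_ite]
    simp only [Ex.holds_lt, Ex.eval_reg, St.reg_setReg, if_true, if_neg hk.symm, h2]
    split_ifs with h
    · obtain ⟨g1, g2, g3⟩ := hP _ (hIi T j h1)
      refine ⟨g1, by rw [g2, ← h2]; simp [hk.symm], ?_⟩
      rw [g3, St.mat_setReg, h3, show min (S.reg k) (j + 1) = min (S.reg k) j + 1 by omega,
        Function.iterate_succ_apply']
    · refine ⟨hIi T j h1, by simp [Cmd.run, hk.symm, h2], ?_⟩
      simp only [Cmd.run, St.mat_setReg]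
      rw [h3, show min (S.reg k) (j + 1) = min (S.reg k) j by omega]

/-- Without a free root the labels in array `14` have no meaning, but register `27` then holds `n`
and they are rejected; so array `14` matters only if `r < n`. -/
theorem growCmd_spec (S : St) {H : ℕ → ℕ → Prop} {Y Z R : ℕ → Prop} (hH : IsGraph n H)
    (hSH : ∀ u v, S.mat 11 u v ≠ 0 ↔ H u v) (hY : ∀ v, S.mat 5 0 v ≠ 0 ↔ Y v)
    (hZ : ∀ v, S.mat 6 0 v ≠ 0 ↔ Z v) (hR : ∀ v, S.mat 7 0 v ≠ 0 ↔ R v)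
    (h8 : ∀ v, n ≤ v → S.mat 8 0 v = 0) (h14 : ∀ v, n ≤ v → S.mat 14 0 v = 0) :
    ((growCmd.run n w S).mat 8 0, (growCmd.run n w S).reg 20) =
      growStep n H Y Z R (S.reg 22) (S.reg 25) (min (S.reg 26) n) (S.mat 8 0, S.reg 20) := by
  classical
  rw [growCmd, Cmd.run_seq]
  set T1 := (Cmd.fill 14 1 (.vec 8 (.reg 1))).run n w S with hT1
  have a1 : T1.mat 14 0 = S.mat 8 0 := by
    funext v
    by_cases hv : v < n
    · rw [hT1, Cmd.fill_mat rfl _ hv]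
      simp
    · rw [hT1, Cmd.run_mat_of_le _ _ _ _ (by omega), h8 v (by omega), h14 v (by omega)]
  have m1 : ∀ a, a ≠ 14 → T1.mat a = S.mat a := fun a ha =>
    Cmd.run_mat (by simp [Cmd.fill, Cmd.setsMat, ha.symm]) S
  have r1 : ∀ i, i ≠ 1 → T1.reg i = S.reg i := fun i hi =>
    Cmd.run_reg (by simp [Cmd.fill, Cmd.setsReg, hi.symm]) S
  clear_value T1
  rw [Cmd.run_seq, Cmd.run_set, Ex.eval_find n w _ (by decide) (fun v => R v ∧ S.mat 8 0 v = 0)]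
  rotate_left
  · intro x v hv; simp [m1, a1, hR]
  set r := findN n fun v => R v ∧ S.mat 8 0 v = 0 with hr
  set T2 := T1.setReg 27 r with hT2
  rw [Cmd.run_seq, Cmd.run_write]
  set T3 := T2.write n 14 (Ex.eval n w (.const 0) T2) (Ex.eval n w (.reg 27) T2)
    (Ex.eval n w labelEx T2) with hT3
  have a3 : r < n → T3.mat 14 0 = Function.update (S.mat 8 0) r (S.reg 20 + 1) := by
    intro hrn
    rw [hT3, Ex.eval_const, St.mat_write_row _ (by simpa [hT2] using hrn), hT2]
    simp [labelEx, r1, a1]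
  have p3 : ∀ v, n ≤ v → T3.mat 14 0 v = 0 := fun v hv => by
    rw [hT3, ← Cmd.run_write, Cmd.run_mat_of_le _ _ _ _ hv, hT2, St.mat_setReg, a1, h8 v hv]
  have m3 : ∀ a, a ≠ 14 → T3.mat a = S.mat a := fun a ha => by
    rw [hT3, St.mat_write_of_ne _ ha, hT2, St.mat_setReg, m1 a ha]
  have r3 : ∀ i, i ≠ 1 → i ≠ 27 → T3.reg i = S.reg i := fun i hi hi' => by
    rw [hT3, St.reg_write, hT2, St.reg_setReg, if_neg hi', r1 i hi]
  have r3' : T3.reg 27 = r := by rw [hT3, St.reg_write, hT2]; simp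
  clear_value T3
  let I : St → Prop := fun T => T.mat 11 = S.mat 11 ∧ T.mat 5 = S.mat 5 ∧ T.mat 6 = S.mat 6 ∧
    T.reg 20 = S.reg 20 ∧ T.reg 22 = S.reg 22 ∧ T.reg 27 = r
  have hI1 : ∀ T j, I T → I (T.setReg 1 j) := fun T j h => by simpa [I] using h
  have hdom := Cmd.run_iterate (n := n) (w := w) (i := 1) (k := 26) (a := 14) (S := T3) (P := domCmd)
    (by decide) (domStep n H Y Z (S.reg 22) (S.reg 20 + 1) r) I
    ⟨m3 _ (by decide), m3 _ (by decide), m3 _ (by decide), r3 _ (by decide) (by decide),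
      r3 _ (by decide) (by decide), r3'⟩ hI1
    (by
      rintro T ⟨g1, g2, g3, g4, g5, g6⟩
      refine ⟨⟨(Cmd.run_mat rfl _).trans g1, (Cmd.run_mat rfl _).trans g2,
        (Cmd.run_mat rfl _).trans g3, (Cmd.run_reg rfl _).trans g4, (Cmd.run_reg rfl _).trans g5,
        (Cmd.run_reg rfl _).trans g6⟩, Cmd.run_reg rfl _, ?_⟩
      rw [domCmd_spec T hH (by rwa [g1]) (by rwa [g2]) (by rwa [g3]), g4, g5, g6])
  rw [Cmd.run_seq]
  set D : Cmd := .forTo 1 (.ite (.lt (.reg 1) (.reg 26)) domCmd .skip) with hD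
  have m4 : ∀ a, a ≠ 14 → (D.run n w T3).mat a = S.mat a := fun a ha =>
    (Cmd.run_mat (by simp [hD, domCmd, Cmd.setsMat, ha.symm]) T3).trans (m3 a ha)
  have r25 : (D.run n w T3).reg 25 = S.reg 25 :=
    (Cmd.run_reg rfl T3).trans (r3 25 (by decide) (by decide))
  have r26 : (D.run n w T3).reg 26 = S.reg 26 :=
    (Cmd.run_reg rfl T3).trans (r3 26 (by decide) (by decide))
  have p4 : ∀ v, n ≤ v → (D.run n w T3).mat 14 0 v = 0 := fun v hv => by
    rw [Cmd.run_mat_of_le _ _ _ _ hv, p3 v hv]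
  set T4 := D.run n w T3 with hT4
  clear_value T4
  obtain ⟨a4, hI4⟩ := hdom
  have hjoin := Cmd.run_iterate (n := n) (w := w) (i := 1) (k := 26) (a := 14) (S := T4)
    (P := joinCmd) (by decide) (joinStep n H Z (S.reg 20) r) I hI4 hI1
    (by
      rintro T ⟨g1, g2, g3, g4, g5, g6⟩
      refine ⟨⟨(Cmd.run_mat rfl _).trans g1, (Cmd.run_mat rfl _).trans g2,
        (Cmd.run_mat rfl _).trans g3, (Cmd.run_reg rfl _).trans g4, (Cmd.run_reg rfl _).trans g5,
        (Cmd.run_reg rfl _).trans g6⟩, Cmd.run_reg rfl _, ?_⟩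
      rw [joinCmd_spec T (by rwa [g1]) (by rwa [g3]), g4, g6])
  rw [Cmd.run_seq]
  set J : Cmd := .forTo 1 (.ite (.lt (.reg 1) (.reg 26)) joinCmd .skip) with hJ
  have m5 : (J.run n w T4).mat 8 = S.mat 8 := (Cmd.run_mat rfl T4).trans (m4 _ (by decide))
  have r5 : (J.run n w T4).reg 25 = S.reg 25 := (Cmd.run_reg rfl T4).trans r25
  set T5 := J.run n w T4 with hT5
  obtain ⟨a5, i1, i2, i3, i4, i5, i6⟩ := hjoin
  have a5' : r < n → T5.mat 14 0 =
      addBranch n H Y Z (S.reg 22) (min (S.reg 26) n) (S.reg 20) r (S.mat 8 0) := by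
    intro hrn
    rw [hT5, a5, a4, a3 hrn, r26, r3 26 (by decide) (by decide)]
    rfl
  have h14' : ∀ v, n ≤ v → T5.mat 14 0 v = 0 := fun v hv => by
    rw [hT5, Cmd.run_mat_of_le _ _ _ _ hv, p4 v hv]
  clear_value T5
  rw [Cmd.run_ite]
  unfold growStep
  dsimp only
  rw [← hr]
  by_cases hrn : r < n
  · rw [← a5' hrn]
    have hcond : (Ex.and (.le (.cnt 10 (.not (.eq (.vec 8 (.reg 10)) (.const 0)))) (.reg 25))
      (.and (.lt (.reg 27) .size) (.not (.ex 15 (.and (.lt (.reg 15) (.reg 20))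
        (.not (joinedEx (.add (.reg 15) (.const 1)) labelEx))))))).holds n w T5 ↔
        used n (S.mat 8 0) ≤ S.reg 25 ∧ r < n ∧ unjoined n H (T5.mat 14 0) (S.reg 20) = 0 := by
      unfold unjoined
      rw [cnt_eq_zero]
      simp [m5, i6, r5, i4, joinedEx, touchesEx, labelEx, i1, hSH, used, BranchJoined, Touches]
    split_ifs with h1 h2 h2
    · rw [Cmd.run_seq, Cmd.run_set]
      refine Prod.ext ?_ ?_
      · funext v
        simp only [St.mat_setReg]
        by_cases hv : v < n
        · rw [Cmd.fill_mat rfl _ hv]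
          simp
        · rw [Cmd.run_mat_of_le _ _ _ _ (by omega), m5, h8 v (by omega), h14' v (by omega)]
      · simp only [St.reg_setReg, if_true, labelEx, Ex.eval_add, Ex.eval_reg, Ex.eval_const]
        rw [Cmd.run_reg rfl, i4]
    · exact absurd (hcond.1 h1) h2
    · exact absurd (hcond.2 h2) h1
    · simp [Cmd.run, m5, i4]
  · rw [if_neg, if_neg]
    · simp [Cmd.run, m5, i4]
    · exact fun h => hrn h.2.1
    · intro h
      simp only [Ex.holds_and, Ex.holds_lt, Ex.eval_reg, Ex.eval_size, i6] at h
      exact hrn h.2.1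

end Bounded

theorem cnt_lt (n k : ℕ) : cnt n (fun i => i < k) = min n k := by
  classical
  have : (Finset.range n).filter (fun i => i < k) = Finset.range (min n k) := by
    ext i; simp
  unfold cnt
  rw [← Finset.card_range (min n k), ← this]
  congr

/-- The count is the square root of `L` rounded up, obtained without taking roots. -/
theorem cnt_mul_self_lt {n L : ℕ} (hL : L ≤ n) :
    L ≤ cnt n (fun i => i * i < L) ^ 2 ∧ (cnt n (fun i => i * i < L) - 1) ^ 2 ≤ L := by
  rcases Nat.eq_zero_or_pos L with rfl | hpos
  · simp [cnt_eq_zero.2]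
  · have h1 : cnt n (fun i => i * i < L) = cnt n fun i => i < Nat.sqrt (L - 1) + 1 := by
      refine cnt_congr fun i _ => ?_
      rw [Nat.lt_succ_iff, Nat.le_sqrt]
      omega
    have h2 := Nat.sqrt_le_self (L - 1)
    rw [h1, cnt_lt, min_eq_right (by omega), Nat.add_sub_cancel]
    have h3 := Nat.sqrt_lt' (m := L - 1) (n := Nat.sqrt (L - 1) + 1)
    have h4 := Nat.sqrt_le' (L - 1)
    have h5 := h3.1 (by omega)
    omega

/-! ### Thresholds, the three vertex sets and the number of rounds as programs. -/

namespace Bounded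

variable {n : ℕ} {w : ℕ → ℕ}

/-- The registers `22` to `25` receive thresholds that depend on the number in register `6`. -/
def thresholdCmd : Cmd :=
  .seq (.set 24 (.half (.half (.half (.half (.half (.half (.half (.reg 6))))))))) <|
  .seq (.set 23 (.half (.reg 24))) <|
  .seq (.set 22 (.half (.half (.half (.reg 23))))) <|
  .set 25 (.half (.half (.reg 22)))

theorem thresholdCmd_spec (S : St) :
    (thresholdCmd.run n w S).reg 24 = S.reg 6 / 128 ∧ (thresholdCmd.run n w S).reg 23 = S.reg 6 / 256 ∧
    (thresholdCmd.run n w S).reg 22 = S.reg 6 / 2048 ∧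
    (thresholdCmd.run n w S).reg 25 = S.reg 6 / 8192 := by
  simp [thresholdCmd, Cmd.run, Nat.div_div_eq_div_mul]

def codegEx (u v : Ex) : Ex := .cnt 15 (.and (.read 11 u (.reg 15)) (.read 11 v (.reg 15)))

/-- Register `21` receives a vertex with few bad pairs of neighbors; the arrays `5`, `6` and `7`
receive the three sets that belong to it. -/
def goodCmd : Cmd :=
  .seq (.set 21 (.argmin 10 11 12 (fun v => .read 4 (.reg 5) (.reg v))
    fun v => .sum 13 (.cnt 14 (.and (.read 11 (.reg v) (.reg 13)) (.and
      (.read 11 (.reg v) (.reg 14)) (.lt (codegEx (.reg 13) (.reg 14)) (.reg 22))))))) <|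
  .seq (.fill 5 1 (.ind (.and (.read 11 (.reg 21) (.reg 1)) (.le (.cnt 13 (.and
    (.read 11 (.reg 21) (.reg 13)) (.lt (codegEx (.reg 1) (.reg 13)) (.reg 22)))) (.reg 23))))) <|
  .seq (.fill 6 1 (.ind (.le (.reg 24) (.cnt 13 (.and (.vec 5 (.reg 13))
    (.read 11 (.reg 1) (.reg 13))))))) <|
  .fill 7 1 (.ind (.and (.vec 5 (.reg 1)) (.le (.reg 24) (.cnt 13 (.and (.vec 6 (.reg 13))
    (.read 11 (.reg 1) (.reg 13)))))))

theorem goodCmd_spec (S : St) {H : ℕ → ℕ → Prop} {W : ℕ → Prop} (hH : IsGraph n H)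
    (hSH : ∀ u v, S.mat 11 u v ≠ 0 ↔ H u v) (hW : ∀ v, S.mat 4 (S.reg 5) v ≠ 0 ↔ W v)
    (h0 : ∀ a u v, n ≤ v → S.mat a u v = 0) :
    ∃ (x : ℕ) (Y Z R : ℕ → Prop), x = argminN n W (badPairs n H (S.reg 22)) ∧
      Y = goodY n H (S.reg 22) (S.reg 23) x ∧ Z = goodZ n H Y (S.reg 24) ∧
      R = goodR n H Y Z (S.reg 24) ∧ (∀ v, (goodCmd.run n w S).mat 5 0 v ≠ 0 ↔ Y v) ∧
      (∀ v, (goodCmd.run n w S).mat 6 0 v ≠ 0 ↔ Z v) ∧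
      ∀ v, (goodCmd.run n w S).mat 7 0 v ≠ 0 ↔ R v := by
  classical
  have hx : (Ex.argmin 10 11 12 (fun v => .read 4 (.reg 5) (.reg v))
    fun v => .sum 13 (.cnt 14 (.and (.read 11 (.reg v) (.reg 13)) (.and
      (.read 11 (.reg v) (.reg 14)) (.lt (codegEx (.reg 13) (.reg 14)) (.reg 22)))))).eval n w S =
      argminN n W (badPairs n H (S.reg 22)) := by
    refine Ex.eval_argmin n w S (by decide) _ _ ?_ ?_ ?_ ?_
    · intro x v hv; simp [hW]
    · intro x v hv u hu; simp [hW]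
    · intro x v hv u hu; simp [hSH, badPairs, codegEx, codeg]
    · intro x v hv u hu; simp [hSH, badPairs, codegEx, codeg]
  set x := argminN n W (badPairs n H (S.reg 22)) with hxdef
  refine ⟨x, _, _, _, rfl, rfl, rfl, rfl, ?_⟩
  rw [goodCmd, Cmd.run_seq, Cmd.run_set, hx]
  have h0' : ∀ a u v, n ≤ v → (S.setReg 21 x).mat a u v = 0 := h0
  have m1 : (S.setReg 21 x).mat 11 = S.mat 11 := rfl
  have r1 : (S.setReg 21 x).reg 21 = x := by simp
  have r1' : (S.setReg 21 x).reg 22 = S.reg 22 ∧ (S.setReg 21 x).reg 23 = S.reg 23 ∧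
    (S.setReg 21 x).reg 24 = S.reg 24 := by simp
  set T := S.setReg 21 x
  clear_value T
  rw [Cmd.run_seq]
  set F5 := Cmd.fill 5 1 (.ind (.and (.read 11 (.reg 21) (.reg 1)) (.le (.cnt 13 (.and
    (.read 11 (.reg 21) (.reg 13)) (.lt (codegEx (.reg 1) (.reg 13)) (.reg 22)))) (.reg 23))))
    with hF5
  have hY : ∀ v, (F5.run n w T).mat 5 0 v ≠ 0 ↔ goodY n H (S.reg 22) (S.reg 23) x v := by
    intro v
    rw [hF5, Cmd.fill_ind rfl T fun v hv => h0' 5 0 v hv]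
    simp [m1, hSH, r1, r1', codegEx, goodY, codeg]
    exact fun h _ => hH.lt' h
  have m2 : (F5.run n w T).mat 11 = S.mat 11 := (Cmd.run_mat rfl T).trans m1
  have r2 : (F5.run n w T).reg 24 = S.reg 24 := (Cmd.run_reg rfl T).trans r1'.2.2
  have h02 : ∀ a u v, n ≤ v → (F5.run n w T).mat a u v = 0 := fun a u v hv => by
    rw [Cmd.run_mat_of_le _ _ _ _ hv, h0' a u v hv]
  set T2 := F5.run n w T
  clear_value T2
  rw [Cmd.run_seq]
  set F6 := Cmd.fill 6 1 (.ind (.le (.reg 24) (.cnt 13 (.and (.vec 5 (.reg 13))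
    (.read 11 (.reg 1) (.reg 13)))))) with hF6
  set Y := goodY n H (S.reg 22) (S.reg 23) x
  have hZ : ∀ v, (F6.run n w T2).mat 6 0 v ≠ 0 ↔ goodZ n H Y (S.reg 24) v := by
    intro v
    rw [hF6, Cmd.fill_ind rfl T2 fun v hv => h02 6 0 v hv]
    simp [m2, hSH, r2, goodZ, hY]
  have m3 : (F6.run n w T2).mat 11 = S.mat 11 := (Cmd.run_mat rfl T2).trans m2
  have m3' : (F6.run n w T2).mat 5 = T2.mat 5 := Cmd.run_mat rfl T2
  have r3 : (F6.run n w T2).reg 24 = S.reg 24 := (Cmd.run_reg rfl T2).trans r2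
  have h03 : ∀ a u v, n ≤ v → (F6.run n w T2).mat a u v = 0 := fun a u v hv => by
    rw [Cmd.run_mat_of_le _ _ _ _ hv, h02 a u v hv]
  set T3 := F6.run n w T2
  clear_value T3
  refine ⟨fun v => ?_, fun v => ?_, fun v => ?_⟩
  · rw [Cmd.run_mat rfl, m3', hY]
  · rw [Cmd.run_mat rfl, hZ]
  · rw [Cmd.fill_ind rfl T3 fun v hv => h03 7 0 v hv]
    simp [m3, m3', hSH, r3, goodR, hZ, hY]
    exact fun h _ => hH.lt _ _ (hH.symm _ _ h.1)

/-- Register `26` receives the number of steps for a branch set, which is proportional to the square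
root of the binary length of the number in register `6`. -/
def stepsCmd : Cmd :=
  .seq (sizeCmd 30 31 (.reg 6)) <|
  .seq (.set 32 (.cnt 10 (.lt (.sum 11 (.ite (.lt (.reg 11) (.reg 10)) (.reg 10) (.const 0)))
    (.reg 30)))) <|
  .set 26 (.sum 10 (.ite (.lt (.reg 10) (.add (.reg 32) (.const 10))) (.const 1024) (.const 0)))

theorem sum_ite_lt (n k c : ℕ) :
    (∑ x ∈ Finset.range n, if x < k then c else 0) = min n k * c := by
  classical
  rw [← Finset.sum_filter]
  have : (Finset.range n).filter (fun x => x < k) = Finset.range (min n k) := by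
    ext i; simp
  rw [this, Finset.sum_const, Finset.card_range, smul_eq_mul]

theorem size_le_self (m : ℕ) : Nat.size m ≤ m := Nat.size_le.2 Nat.lt_two_pow_self

/-- With `S = q + 10`, the lower bound on `q` makes `2 ^ (S * S)` exceed the number in register `6`,
and the upper bound keeps the branch sets as small as the square root of its logarithm. -/
theorem stepsCmd_spec (S : St) (h6 : S.reg 6 ≤ n) :
    ∃ q, Nat.size (S.reg 6) ≤ q ^ 2 ∧ (q - 1) ^ 2 ≤ Nat.size (S.reg 6) ∧
      (stepsCmd.run n w S).reg 26 = min n (q + 10) * 1024 := by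
  classical
  have h1 := sizeCmd_spec (w := w) (d := 30) (t := 31) (e := .reg 6) S (by decide) (by decide)
    (by decide) h6
  obtain ⟨h2, h3⟩ := cnt_mul_self_lt ((size_le_self (S.reg 6)).trans h6)
  refine ⟨_, h2, h3, ?_⟩
  rw [stepsCmd, Cmd.run_seq, Cmd.run_seq, Cmd.run_set, Cmd.run_set]
  set T := (sizeCmd 30 31 (.reg 6)).run n w S
  have h4 : (Ex.cnt 10 (.lt (.sum 11 (.ite (.lt (.reg 11) (.reg 10)) (.reg 10) (.const 0)))
    (.reg 30))).eval n w T = cnt n (fun i => i * i < Nat.size (S.reg 6)) := by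
    simp only [Ex.eval_cnt]
    refine cnt_congr fun i hi => ?_
    simp only [Ex.holds_lt, Ex.eval_sum, Ex.eval_ite, Ex.eval_reg, St.reg_setReg, Ex.eval_const,
      if_true, show (10 : ℕ) ≠ 11 by decide, show (30 : ℕ) ≠ 10 by decide, if_false, h1]
    have := sum_ite_lt n i i
    rw [min_eq_right hi.le] at this
    rw [← this]
  rw [h4, ← sum_ite_lt]
  simp

theorem growAllCmd_spec (S : St) {H : ℕ → ℕ → Prop} {Y Z R : ℕ → Prop} (hH : IsGraph n H)
    (hSH : ∀ u v, S.mat 11 u v ≠ 0 ↔ H u v) (hY : ∀ v, S.mat 5 0 v ≠ 0 ↔ Y v)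
    (hZ : ∀ v, S.mat 6 0 v ≠ 0 ↔ Z v) (hR : ∀ v, S.mat 7 0 v ≠ 0 ↔ R v)
    (h8 : ∀ v, S.mat 8 0 v = 0) (h14 : ∀ v, n ≤ v → S.mat 14 0 v = 0) (h20 : S.reg 20 = 0) :
    (((Cmd.forTo 0 growCmd).run n w S).mat 8 0, ((Cmd.forTo 0 growCmd).run n w S).reg 20) =
      (growStep n H Y Z R (S.reg 22) (S.reg 25) (min (S.reg 26) n))^[n] (fun _ => 0, 0) := by
  refine (Cmd.run_forTo_induct (n := n) (w := w) (i := 0) (S := S) (P := growCmd)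
    (fun j T => T.mat 11 = S.mat 11 ∧ T.mat 5 = S.mat 5 ∧ T.mat 6 = S.mat 6 ∧ T.mat 7 = S.mat 7 ∧
      T.reg 22 = S.reg 22 ∧ T.reg 25 = S.reg 25 ∧ T.reg 26 = S.reg 26 ∧
      (∀ v, n ≤ v → T.mat 8 0 v = 0) ∧ (∀ v, n ≤ v → T.mat 14 0 v = 0) ∧
      (T.mat 8 0, T.reg 20) =
        (growStep n H Y Z R (S.reg 22) (S.reg 25) (min (S.reg 26) n))^[j] (fun _ => 0, 0))
    ⟨rfl, rfl, rfl, rfl, rfl, rfl, rfl, fun v _ => h8 v, h14, ?_⟩ ?_).2.2.2.2.2.2.2.2.2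
  · rw [h20]
    exact Prod.ext (funext h8) rfl
  · rintro j hj T ⟨g1, g2, g3, g4, g5, g6, g7, g8, g9, g10⟩
    refine ⟨(Cmd.run_mat rfl _).trans g1, (Cmd.run_mat rfl _).trans g2, (Cmd.run_mat rfl _).trans g3,
      (Cmd.run_mat rfl _).trans g4, (Cmd.run_reg rfl _).trans g5, (Cmd.run_reg rfl _).trans g6,
      (Cmd.run_reg rfl _).trans g7, fun v hv => ?_, fun v hv => ?_, ?_⟩
    · rw [Cmd.run_mat_of_le _ _ _ _ hv]; exact g8 v hv
    · rw [Cmd.run_mat_of_le _ _ _ _ hv]; exact g9 v hv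
    · rw [growCmd_spec (T.setReg 0 j) hH (by simpa [g1] using hSH) (by simpa [g2] using hY)
        (by simpa [g3] using hZ) (by simpa [g4] using hR) g8 g9, Function.iterate_succ_apply', ← g10,
        ← g5, ← g6, ← g7]
      rfl

end Bounded

/-! ### The common part of the algorithms -/

/-- The labels `1, …, h` mark branch sets of a clique minor. -/
structure IsCliqueLabelling (n : ℕ) (A : ℕ → ℕ → Prop) (lab : ℕ → ℕ) (h : ℕ) : Prop where
  conn : ∀ i < h, ConnOn A {v | v ∈ Set.Iio n ∧ lab v = i + 1}
  joined : ∀ i j, i < j → j < h → ∃ u < n, ∃ v < n, lab u = i + 1 ∧ lab v = j + 1 ∧ A u v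

theorem Branches.isCliqueLabelling {n : ℕ} {A B H : ℕ → ℕ → Prop} {d j h : ℕ} {own f lab : ℕ → ℕ}
    (hb : Branches n H own h) (hf : IsContraction n B d j f) (hBA : ∀ u v, B u v → A u v)
    (hHB : ∀ u v, H u v → quot n B f u v) (hlab : ∀ v < n, lab v = own (f v)) :
    IsCliqueLabelling n A lab h := by
  refine ⟨fun i hi => ?_, fun i j hij hj => ?_⟩
  · have := (hb.conn i hi).preimage (A := A) (f := f) (d := Set.Iio n) (fun a ha => ?_)
      fun a b hab => ?_
    · convert this using 1
      ext v
      simp only [Set.mem_ofPred_eq, Set.mem_Iio]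
      exact and_congr_right fun hv => by rw [hlab v hv]
    -- A labelled vertex has a neighbor in the quotient, hence is a value of `f`; its fibre is then
    -- one of the connected classes of the contraction.
    · obtain ⟨u, hu⟩ := hb.edge a (by rw [show own a = i + 1 from ha]; omega)
      obtain ⟨-, x, hx, y, hy, rfl, -, -⟩ := hHB _ _ hu
      exact (hf.conn x hx).mono hBA
    · obtain ⟨-, x, hx, y, hy, h1, h2, h3⟩ := hHB _ _ hab
      exact ⟨x, hx, y, hy, h1, h2, hBA _ _ h3⟩
  · obtain ⟨y, hy, h1, x, hx, h2, h3⟩ := hb.joined i j hij hj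
    obtain ⟨-, u, hu, v, hv, rfl, rfl, h4⟩ := hHB _ _ h3
    exact ⟨u, hu, v, hv, by rw [hlab u hu, h2], by rw [hlab v hv, h1], hBA _ _ h4⟩

/-- What the algorithm finds out about a graph: the greedy coloring `col`, which uses at most `K`
colors, and a clique minor with `h` vertices. -/
structure IsAnalysis (n : ℕ) (A : ℕ → ℕ → Prop) (rk col lab : ℕ → ℕ) (K h : ℕ) : Prop where
  rank : IsRemovalRank n A rk
  greedy : IsPartialGreedy n A rk 0 col
  color_lt : ∀ v < n, col v < K
  colors_le : K ≤ n
  label : IsCliqueLabelling n A lab h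
  pos : 0 < n → 1 ≤ h
  le : h ≤ n
  large : ∃ m q, (2 ≤ K → K ≤ 2 * m) ∧ (q - 1) ^ 2 ≤ Nat.size m ∧
    (m / 8192 + 1 + 3072 * (q + 10) < m / 2048 → m / 8192 < h * (1 + 3072 * (q + 10)))

/-! ### The analysis of a graph as a program. -/

namespace Bounded

variable {n : ℕ} {w : ℕ → ℕ}

/-- Array `12` receives the labels of the vertices of the original graph; if no branch set has been
found, then some vertex becomes one. -/
def labelCmd : Cmd :=
  .seq (.fill 12 1 (.ite (.reg 20) (.vec 8 (.vec 3 (.reg 1))) (.ind (.eq (.reg 1) (.const 0))))) <|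
  .set 20 (.ite .size (.ite (.reg 20) (.reg 20) (.const 1)) (.const 0))

def denseCmd : Cmd :=
  .seq thresholdCmd <| .seq goodCmd <| .seq stepsCmd <| .forTo 0 growCmd

/-- The branch sets are valid for every `m`. Their number is bounded only if `m / 8192` used
vertices and one more branch set stay below `b = m / 2048`; this also forces `1024 * (q + 10) ≤ n`,
so the number of rounds is not truncated. -/
theorem denseCmd_spec (S : St) {H : ℕ → ℕ → Prop} {W : ℕ → Prop} {m : ℕ} (hD : IsDenseNbhd n H W m)
    (hSH : ∀ u v, S.mat 11 u v ≠ 0 ↔ H u v) (hW : ∀ v, S.mat 4 (S.reg 5) v ≠ 0 ↔ W v)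
    (h0 : ∀ a u v, n ≤ v → S.mat a u v = 0) (h6 : S.reg 6 = m) (h8 : ∀ v, S.mat 8 0 v = 0)
    (h20 : S.reg 20 = 0) :
    Branches n H ((denseCmd.run n w S).mat 8 0) ((denseCmd.run n w S).reg 20) ∧
    ∃ q, (q - 1) ^ 2 ≤ Nat.size m ∧ (m / 8192 + 1 + 3072 * (q + 10) < m / 2048 →
      m / 8192 < (denseCmd.run n w S).reg 20 * (1 + 3072 * (q + 10))) := by
  have hmn : m ≤ n := hD.card ▸ cnt_le _ _
  rw [denseCmd, Cmd.run_seq]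
  obtain ⟨t24, t23, t22, t25⟩ := thresholdCmd_spec (n := n) (w := w) S
  have m1 : (thresholdCmd.run n w S).mat = S.mat := by
    funext a; exact Cmd.run_mat rfl S
  have r1 : ∀ r, (thresholdCmd.setsReg r = false) → (thresholdCmd.run n w S).reg r = S.reg r :=
    fun r hr => Cmd.run_reg hr S
  have r5 := r1 5 rfl
  have r6 := r1 6 rfl
  have r20 := r1 20 rfl
  set T1 := thresholdCmd.run n w S
  clear_value T1
  rw [Cmd.run_seq]
  obtain ⟨x, Y, Z, R, hx, hY, hZ, hR, g5, g6, g7⟩ := goodCmd_spec (w := w) T1 hD.graph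
    (by rwa [m1]) (by rwa [m1, r5]) (by rwa [m1])
  have n8 : (goodCmd.run n w T1).mat 8 = S.mat 8 := by rw [← m1]; exact Cmd.run_mat rfl T1
  have n11 : (goodCmd.run n w T1).mat 11 = S.mat 11 := by rw [← m1]; exact Cmd.run_mat rfl T1
  have n14 : (goodCmd.run n w T1).mat 14 = S.mat 14 := by rw [← m1]; exact Cmd.run_mat rfl T1
  have s6 : (goodCmd.run n w T1).reg 6 = m := by rw [Cmd.run_reg rfl, r6, h6]
  have s20 : (goodCmd.run n w T1).reg 20 = 0 := by rw [Cmd.run_reg rfl, r20, h20]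
  have s22 : (goodCmd.run n w T1).reg 22 = m / 2048 := by rw [Cmd.run_reg rfl, t22, h6]
  have s25 : (goodCmd.run n w T1).reg 25 = m / 8192 := by rw [Cmd.run_reg rfl, t25, h6]
  set T2 := goodCmd.run n w T1
  clear_value T2
  rw [Cmd.run_seq]
  obtain ⟨q, hq1, hq2, s26⟩ := stepsCmd_spec (n := n) (w := w) T2 (by rwa [s6])
  have m3 : (stepsCmd.run n w T2).mat = T2.mat := by
    funext a; exact Cmd.run_mat rfl T2
  have u20 : (stepsCmd.run n w T2).reg 20 = 0 := by rw [Cmd.run_reg rfl, s20]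
  have u22 : (stepsCmd.run n w T2).reg 22 = m / 2048 := by rw [Cmd.run_reg rfl, s22]
  have u25 : (stepsCmd.run n w T2).reg 25 = m / 8192 := by rw [Cmd.run_reg rfl, s25]
  set T3 := stepsCmd.run n w T2
  clear_value T3
  have key := growAllCmd_spec (w := w) T3 hD.graph (by rwa [m3, n11]) (by rwa [m3]) (by rwa [m3])
    (by rwa [m3]) (by rwa [m3, n8]) (by rw [m3, n14]; exact h0 14 0) u20
  rw [u22, u25, s26] at key
  set T4 := (Cmd.forTo 0 growCmd).run n w T3
  clear_value T4
  have e1 : T4.mat 8 0 = _ := congrArg Prod.fst key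
  have e2 : T4.reg 20 = _ := congrArg Prod.snd key
  have hedge : ∀ v, R v → ∃ u, H v u := by
    rintro v hv
    rw [hR] at hv
    have := hv.1
    rw [hY] at this
    exact ⟨x, hD.graph.symm _ _ this.1⟩
  constructor
  · rw [e1, e2]
    exact Branches.iterate_growStep hD.graph hedge n
  · rw [s6] at hq1 hq2
    refine ⟨q, hq2, fun hlt => ?_⟩
    rw [t22, h6] at hx
    rw [t22, t23, h6] at hY
    rw [t24, h6] at hZ hR
    have hP := isPrepared hD (by omega) hx hY hZ hR
    have e3 : min (min n (q + 10) * 1024) n = 1024 * (q + 10) := by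
      rw [min_eq_right (by omega : q + 10 ≤ n), min_eq_left (by omega), mul_comm]
    rw [e2, e3]
    have hpow : m / 8192 < 2 ^ ((q + 10) * (q + 10)) :=
      calc m / 8192 ≤ m := Nat.div_le_self _ _
        _ < 2 ^ Nat.size m := Nat.lt_size_self m
        _ ≤ _ := Nat.pow_le_pow_right (by norm_num) (hq1.trans (by nlinarith))
    have e4 : 3072 * (q + 10) = 3 * (1024 * (q + 10)) := by ring
    have hn' : m / 8192 < n := by omega
    rw [e4] at hlt ⊢
    exact growStep_count hP (by omega) (Nat.le_add_left 10 q) hpow hlt hn'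

def analyzeCmd : Cmd :=
  .seq orderCmd <| .seq colorCmd <| .seq suffixCmd <| .seq contractCmd <| .seq nbhdCmd <|
  .seq denseCmd labelCmd

/-- Since `K` is one more than the largest color `d`, the bound `d < 2 * m` reads `K ≤ 2 * m`. If no
branch set was accepted, the vertex `0` alone serves as a clique minor. -/
theorem analyzeCmd_spec (S : St) {A : ℕ → ℕ → Prop} (hA : IsGraph n A)
    (hSA : ∀ u v, S.mat 0 u v ≠ 0 ↔ A u v) (hS : ∀ a, a ≠ 0 → ∀ u v, S.mat a u v = 0)
    (h20 : S.reg 20 = 0) :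
    ∃ rk, IsAnalysis n A rk ((analyzeCmd.run n w S).mat 2 0) ((analyzeCmd.run n w S).mat 12 0)
      ((analyzeCmd.run n w S).reg 9) ((analyzeCmd.run n w S).reg 20) := by
  classical
  rcases Nat.eq_zero_or_pos n with hn | hn
  · subst hn
    have h9 : (analyzeCmd.run 0 w S).reg 9 = 0 := by
      rw [analyzeCmd, Cmd.run_seq, Cmd.run_seq, Cmd.run_seq, Cmd.run_reg rfl, suffixCmd, Cmd.run_seq,
        Cmd.run_seq, Cmd.run_reg rfl, Cmd.run_set]
      simp [Ex.holds]
    have h20 : (analyzeCmd.run 0 w S).reg 20 = 0 := by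
      simp only [analyzeCmd, Cmd.run_seq, labelCmd, Cmd.run_set]
      simp [Ex.holds]
    rw [h9, h20]
    refine ⟨fun _ => 0, ⟨by simp, by simp, by simp, by simp⟩, fun v hv => absurd hv (by simp), by simp,
      le_rfl, ⟨by simp, by simp⟩, by simp, le_rfl, 0, 0, by simp, by simp, by simp⟩
  have hz : ∀ (P : Cmd) (T : St), (∀ a u v, n ≤ v → T.mat a u v = 0) →
      ∀ a u v, n ≤ v → (P.run n w T).mat a u v = 0 := fun P T hT a u v hv => by
    rw [Cmd.run_mat_of_le _ _ _ _ hv, hT a u v hv]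
  have z0 : ∀ a u v, n ≤ v → S.mat a u v = 0 := by
    intro a u v hv
    by_cases ha : a = 0
    · subst ha
      by_contra h
      exact absurd (hA.lt' ((hSA u v).1 h)) (by omega)
    · exact hS a ha u v
  rw [analyzeCmd, Cmd.run_seq]
  have hrk := orderCmd_spec (n := n) (w := w) S fun v _ => hS 1 (by decide) 0 v
  have m1 : ∀ a, a ≠ 1 → (orderCmd.run n w S).mat a = S.mat a := fun a ha =>
    Cmd.run_mat (by simp [orderCmd, orderStep, Cmd.setsMat, ha.symm]) S
  have r1 : (orderCmd.run n w S).reg 20 = 0 := by rw [Cmd.run_reg rfl, h20]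
  have z1 := hz orderCmd S z0
  set T1 := orderCmd.run n w S
  clear_value T1
  rw [Cmd.run_seq]
  have hrk' : IsRemovalRank n A (T1.mat 1 0) := by
    convert hrk using 1
    funext u v
    exact propext (hSA u v).symm
  have hcol := colorCmd_spec (w := w) T1 (A := A) (by rwa [m1 0 (by decide)]) hrk'
  have m2 : ∀ a, a ≠ 2 → (colorCmd.run n w T1).mat a = T1.mat a := fun a ha =>
    Cmd.run_mat (by simp [colorCmd, colorStep, Cmd.setsMat, ha.symm]) T1
  have r2 : (colorCmd.run n w T1).reg 20 = 0 := by rw [Cmd.run_reg rfl, r1]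
  have z2 := hz colorCmd T1 z1
  set T2 := colorCmd.run n w T1
  clear_value T2
  rw [Cmd.run_seq]
  obtain ⟨v, hv, hmax, k9, hB, hid⟩ := suffixCmd_spec (w := w) T2 hA
    (by rwa [m2 0 (by decide), m1 0 (by decide)])
    (by rw [m2 10 (by decide), m1 10 (by decide)]; exact hS 10 (by decide)) hn
  rw [m2 1 (by decide)] at hB
  have hcon := isContraction_suffixGraph hA hrk' hcol hv hid
  have hBG := suffixGraph_isGraph hA (T1.mat 1 0) v
  have m3 : ∀ a, a ≠ 10 → a ≠ 3 → (suffixCmd.run n w T2).mat a = T2.mat a := fun a ha ha' =>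
    Cmd.run_mat (by simp [suffixCmd, Cmd.fill, Cmd.fill₂, Cmd.setsMat, ha.symm, ha'.symm]) T2
  have r3 : (suffixCmd.run n w T2).reg 20 = 0 := by rw [Cmd.run_reg rfl, r2]
  have z3 := hz suffixCmd T2 z2
  set T3 := suffixCmd.run n w T2
  clear_value T3
  rw [Cmd.run_seq]
  set B := suffixGraph A (T1.mat 1 0) v
  obtain ⟨hcon4, z44⟩ := contractCmd_spec (w := w) T3 hBG hB
    (fun a b _ => by
      rw [m3 4 (by decide) (by decide), m2 4 (by decide), m1 4 (by decide), hS 4 (by decide)]) hcon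
  have m4 : ∀ a, contractCmd.setsMat a = false → (contractCmd.run n w T3).mat a = T3.mat a :=
    fun a ha => Cmd.run_mat ha T3
  have r4 : (contractCmd.run n w T3).reg 20 = 0 := by rw [Cmd.run_reg rfl, r3]
  have k4 : (contractCmd.run n w T3).reg 9 = T2.mat 2 0 v + 1 := by rw [Cmd.run_reg rfl, k9]
  have z4 := hz contractCmd T3 z3
  set T4 := contractCmd.run n w T3
  clear_value T4
  rw [Cmd.run_seq]
  obtain ⟨H, W, m, hD, hdm, hH, h6, hW, hHB⟩ := nbhdCmd_spec (w := w) T4 hBG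
    (by rwa [m4 10 rfl]) z44
    (by rw [m4 11 rfl, m3 11 (by decide) (by decide), m2 11 (by decide), m1 11 (by decide)]
        exact hS 11 (by decide)) hcon4
  have m5 : ∀ a, nbhdCmd.setsMat a = false → (nbhdCmd.run n w T4).mat a = T4.mat a :=
    fun a ha => Cmd.run_mat ha T4
  have r5 : (nbhdCmd.run n w T4).reg 20 = 0 := by rw [Cmd.run_reg rfl, r4]
  have k5 : (nbhdCmd.run n w T4).reg 9 = T2.mat 2 0 v + 1 := by rw [Cmd.run_reg rfl, k4]
  have z5 := hz nbhdCmd T4 z4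
  set T5 := nbhdCmd.run n w T4
  clear_value T5
  rw [Cmd.run_seq]
  obtain ⟨hbr, q, hq, hlarge⟩ := denseCmd_spec (w := w) T5 hD hH hW z5 h6
    (by rw [m5 8 rfl, m4 8 rfl, m3 8 (by decide) (by decide), m2 8 (by decide), m1 8 (by decide)]
        exact hS 8 (by decide) 0) r5
  have c6 : (denseCmd.run n w T5).mat 2 = T2.mat 2 := by
    rw [Cmd.run_mat rfl, m5 2 rfl, m4 2 rfl, m3 2 (by decide) (by decide)]
  have f6 : (denseCmd.run n w T5).mat 3 = T4.mat 3 := by rw [Cmd.run_mat rfl, m5 3 rfl]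
  have k6 : (denseCmd.run n w T5).reg 9 = T2.mat 2 0 v + 1 := by rw [Cmd.run_reg rfl, k5]
  set T6 := denseCmd.run n w T5
  clear_value T6
  have c7 : (labelCmd.run n w T6).mat 2 = T2.mat 2 := by rw [Cmd.run_mat rfl, c6]
  have k7 : (labelCmd.run n w T6).reg 9 = T2.mat 2 0 v + 1 := by rw [Cmd.run_reg rfl, k6]
  have l7 : ∀ u < n, (labelCmd.run n w T6).mat 12 0 u =
      if T6.reg 20 ≠ 0 then T6.mat 8 0 (T4.mat 3 0 u) else if u = 0 then 1 else 0 := by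
    intro u hu
    rw [labelCmd, Cmd.run_seq, Cmd.run_mat rfl, Cmd.fill_mat rfl _ hu]
    simp [f6]
  have h7 : (labelCmd.run n w T6).reg 20 = if T6.reg 20 ≠ 0 then T6.reg 20 else 1 := by
    rw [labelCmd, Cmd.run_seq, Cmd.run_set]
    have : ∀ T, Ex.size.holds n w T := fun T => hn.ne'
    have h' : ((Cmd.fill 12 1 (.ite (.reg 20) (.vec 8 (.vec 3 (.reg 1)))
      (.ind (.eq (.reg 1) (.const 0))))).run n w T6).reg 20 = T6.reg 20 := Cmd.run_reg rfl T6
    simp [this, h']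
  refine ⟨T1.mat 1 0, hrk', by rwa [c7], fun u hu => ?_, ?_, ?_, fun _ => ?_, ?_, m, q, ?_, hq, ?_⟩
  · rw [c7, k7]
    exact Nat.lt_succ_of_le (hmax u hu)
  · rw [k7]
    exact (hcol v hv (hrk'.pos v hv)).1
  · rw [h7]
    by_cases h : T6.reg 20 = 0
    · rw [if_neg (by simpa using h)]
      refine ⟨fun i hi => ?_, fun i j hij hj => by omega⟩
      have : i = 0 := by omega
      subst this
      convert ConnOn.singleton A 0 using 1
      ext u
      simp only [Set.mem_ofPred_eq, Set.mem_Iio, Set.mem_singleton_iff]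
      constructor
      · rintro ⟨hu, h1⟩
        rw [l7 u hu, if_neg (by simpa using h)] at h1
        by_contra hne
        rw [if_neg hne] at h1
        omega
      · rintro rfl
        exact ⟨hn, by rw [l7 0 hn, if_neg (by simpa using h), if_pos rfl]⟩
    · rw [if_pos h]
      exact hbr.isCliqueLabelling hcon4 (fun _ _ h => h.1) hHB fun u hu => by
        rw [l7 u hu, if_pos h]
  · rw [h7]; split_ifs <;> omega
  · rw [h7]
    have := hbr.le_size
    split_ifs <;> omega
  · rw [k7]
    intro h2
    exact hdm (by omega)
  · rw [h7]
    intro hlt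
    have := hlarge hlt
    split_ifs with h
    · exact this
    · rw [not_not.1 h, zero_mul] at this
      exact absurd this (Nat.not_lt_zero _)

end Bounded

/-! ### The quality of the clique minor -/

/-- The square of the reciprocal is `log t / t ^ 2`, which is antitone from `exp (1 / 2) ≤ 2` on. -/
theorem div_sqrt_log_mono {x y : ℝ} (hx : 2 ≤ x) (hxy : x ≤ y) :
    x / √(Real.log x) ≤ y / √(Real.log y) := by
  have hlx : 0 < Real.log x := Real.log_pos (by linarith)
  have hly : 0 < Real.log y := Real.log_pos (by linarith)
  have hexp : Real.exp (1 / 2) ≤ 2 := by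
    rw [← Real.le_log_iff_exp_le (by norm_num)]
    linarith [Real.log_two_gt_d9]
  rw [one_div] at hexp
  have h := Real.log_div_self_rpow_antitoneOn (a := 2) (by norm_num)
    (Set.mem_Ici.2 (hexp.trans hx)) (Set.mem_Ici.2 (hexp.trans (hx.trans hxy))) hxy
  simp only [Real.rpow_ofNat] at h
  have hx0 : 0 < x := by linarith
  have hy0 : 0 < y := by linarith
  rw [div_le_div_iff₀ (by positivity) (by positivity)] at h
  rw [div_le_div_iff₀ (by positivity) (by positivity)]
  have h1 : x * √(Real.log y) = √(Real.log y * x ^ 2) := by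
    rw [Real.sqrt_mul hly.le, Real.sqrt_sq (by linarith), mul_comm]
  have h2 : y * √(Real.log x) = √(Real.log x * y ^ 2) := by
    rw [Real.sqrt_mul hlx.le, Real.sqrt_sq (by linarith), mul_comm]
  rw [h1, h2]
  exact Real.sqrt_le_sqrt h

theorem size_mul_log_two_le {m : ℕ} (hm : 1 ≤ m) :
    (Nat.size m : ℝ) * Real.log 2 ≤ Real.log (2 * m) := by
  have h1 : 2 ^ (Nat.size m - 1) ≤ m := by
    rw [← Nat.lt_size]
    have := Nat.size_pos.2 hm
    omega
  have h2 : 2 ^ Nat.size m ≤ 2 * m := by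
    have := Nat.size_pos.2 hm
    calc 2 ^ Nat.size m = 2 * 2 ^ (Nat.size m - 1) := by
          rw [← pow_succ', Nat.sub_add_cancel this]
      _ ≤ _ := Nat.mul_le_mul_left 2 h1
  have h3 : ((2 : ℝ) ^ Nat.size m) ≤ 2 * m := by exact_mod_cast h2
  rw [← Real.log_pow]
  exact Real.log_le_log (by positivity) h3

/-- If the hypothesis of `hl` fails, `m` is bounded by a multiple of the cost `a` of one branch set,
and a single branch set is enough. -/
theorem le_of_large {m a h : ℕ} (hh : 1 ≤ h) (ha : 1 ≤ a)
    (hl : m / 8192 + a < m / 2048 → m / 8192 < h * a) : m ≤ 16384 * (h * a) := by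
  have h1 : 1 * a ≤ h * a := Nat.mul_le_mul_right _ hh
  generalize h * a = t at *
  by_cases hc : m / 8192 + a < m / 2048
  · have := hl hc
    omega
  · omega

/-- The ratio between the guaranteed and the optimal size of the clique minor. -/
noncomputable def minorConst : ℝ := 1 / 4000000000

theorem minorConst_pos : 0 < minorConst := by norm_num [minorConst]

/-- Here `x` stands for the number of colors that actually occur, of which only `x ≤ K` is used;
monotonicity leads from `x` to `2 * m`. -/
theorem minorConst_mul_le {K m q h : ℕ} (hh : 1 ≤ h) (hKm : K ≤ 2 * m)
    (hq : (q - 1) ^ 2 ≤ Nat.size m)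
    (hl : m / 8192 + 1 + 3072 * (q + 10) < m / 2048 → m / 8192 < h * (1 + 3072 * (q + 10)))
    {x : ℕ} (hx : 2 ≤ x) (hxK : x ≤ K) :
    minorConst * (x / √(Real.log x)) ≤ h := by
  have hm : 1 ≤ m := by omega
  have hm' : (1 : ℝ) ≤ m := by exact_mod_cast hm
  set l := Real.log (2 * m) with hldef
  have hl2 : Real.log 2 ≤ l := Real.log_le_log (by norm_num) (by linarith)
  have hlog2 := Real.log_two_gt_d9
  have hs : 0.83 ≤ √l := Real.le_sqrt_of_sq_le (by norm_num; linarith)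
  have hsize : (Nat.size m : ℝ) ≤ 2 * l := by
    have := size_mul_log_two_le hm
    have h0 : (0 : ℝ) ≤ Nat.size m := by positivity
    nlinarith
  have hq1 : (q : ℝ) ≤ 1 + 1.5 * √l := by
    have h1 : ((q - 1 : ℕ) : ℝ) ^ 2 ≤ (1.5 * √l) ^ 2 := by
      rw [mul_pow, Real.sq_sqrt (by linarith)]
      have : (((q - 1) ^ 2 : ℕ) : ℝ) ≤ Nat.size m := by exact_mod_cast hq
      push_cast at this
      linarith
    have h2 := (sq_le_sq₀ (by positivity) (by positivity)).1 h1
    have h3 : (q : ℝ) ≤ ((q - 1 : ℕ) : ℝ) + 1 := by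
      exact_mod_cast (by omega : q ≤ q - 1 + 1)
    linarith
  -- The constant part is `1 + 3072 * 11`, which is absorbed into the multiple of `√l` because `√l ≥
  -- 0.83`.
  have ha : (1 + 3072 * (q + 10) : ℝ) ≤ 50000 * √l := by linarith
  have hmain : (m : ℝ) ≤ 16384 * (h * (1 + 3072 * (q + 10))) := by
    exact_mod_cast le_of_large hh (Nat.le_add_right 1 _) fun hlt => hl (by rwa [add_assoc])
  have hmain' : (m : ℝ) ≤ 16384 * (h * (50000 * √l)) :=
    hmain.trans (by gcongr)
  have hmono : (x : ℝ) / √(Real.log x) ≤ (2 * m : ℝ) / √l :=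
    div_sqrt_log_mono (by exact_mod_cast hx) (by exact_mod_cast hxK.trans hKm)
  calc minorConst * (x / √(Real.log x)) ≤ minorConst * ((2 * m : ℝ) / √l) := by
        have := minorConst_pos
        gcongr
    _ ≤ h := by
        rw [mul_div_assoc', div_le_iff₀ (by linarith)]
        -- The constants multiply to `2 * 16384 * 50000 < 4000000000`.
        unfold minorConst
        have : 0 ≤ h * √l := by positivity
        linarith

theorem IsAnalysis.minorConst_mul_le {n : ℕ} {A : ℕ → ℕ → Prop} {rk col lab : ℕ → ℕ} {K h : ℕ}
    (hr : IsAnalysis n A rk col lab K h) {x : ℕ} (hx : 2 ≤ x) (hxK : x ≤ K) :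
    minorConst * (x / √(Real.log x)) ≤ h := by
  obtain ⟨m, q, h1, h2, h3⟩ := hr.large
  have := hr.colors_le
  exact _root_.minorConst_mul_le (hr.pos (by omega)) (h1 (by omega)) h2 h3 hx hxK

theorem IsAnalysis.minorConst_mul_colors_le {n : ℕ} {A : ℕ → ℕ → Prop} {rk col lab : ℕ → ℕ}
    {K h : ℕ} (hr : IsAnalysis n A rk col lab K h) (hn : 2 ≤ n) :
    minorConst * K ≤ h * √(Real.log n) := by
  have hh : (1 : ℝ) ≤ h := by exact_mod_cast hr.pos (by omega)
  have hlog : Real.log 2 ≤ Real.log n := Real.log_le_log (by norm_num) (by exact_mod_cast hn)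
  have hlog2 := Real.log_two_gt_d9
  have hs : 0.83 ≤ √(Real.log n) := Real.le_sqrt_of_sq_le (by norm_num; linarith)
  by_cases hK : 2 ≤ K
  · have h1 := hr.minorConst_mul_le hK le_rfl
    have hKpos : 0 < Real.log K := Real.log_pos (by exact_mod_cast hK)
    rw [mul_div_assoc', div_le_iff₀ (Real.sqrt_pos.2 hKpos)] at h1
    refine h1.trans ?_
    gcongr
    exact hr.colors_le
  · have : (K : ℝ) ≤ 1 := by exact_mod_cast (by omega : K ≤ 1)
    unfold minorConst
    nlinarith

/-! ### The choice between the coloring and the clique minor -/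

/-- The powers of `n` with a real exponent and with the rational number that presents it agree up to a
constant factor. -/
theorem rpow_le_of_presents {n : ℕ} (hn : 2 ≤ n) {r : ℚ} {ε : ℝ} (hp : Presents n r ε) :
    (n : ℝ) ^ (r : ℝ) ≤ Real.exp 1 * (n : ℝ) ^ ε ∧ (n : ℝ) ^ ε ≤ Real.exp 1 * (n : ℝ) ^ (r : ℝ) := by
  obtain ⟨-, -, h⟩ := hp
  have hpos : (0 : ℝ) < n := by positivity
  have hlog : 0 < Real.log n := Real.log_pos (by exact_mod_cast hn)
  rw [Real.rpow_def_of_pos hpos, Real.rpow_def_of_pos hpos, ← Real.exp_add, ← Real.exp_add,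
    Real.exp_le_exp, Real.exp_le_exp]
  have h1 : |(ε - r) * Real.log n| ≤ 1 := by rwa [abs_mul, abs_of_pos hlog]
  rw [abs_le] at h1
  constructor <;> nlinarith [h1.1, h1.2]

/-- With `t` the integer part of `Nat.size n * r`, the computable number `2 ^ t` replaces `n ^ r` up
to a factor of two either way. In this direction the factor comes from `2 ^ Nat.size n ≤ 2 * n` and
`r ≤ 1`. -/
theorem two_pow_le_rpow {n t : ℕ} (hn : 1 ≤ n) {r : ℝ} (h0 : 0 ≤ r) (h1 : r ≤ 1)
    (ht : (t : ℝ) ≤ Nat.size n * r) : (2 : ℝ) ^ t ≤ 2 * (n : ℝ) ^ r := by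
  have hlog : (0 : ℝ) < n := by positivity
  have hs := size_mul_log_two_le hn
  rw [Real.log_mul (by norm_num) hlog.ne'] at hs
  have h2 := Real.log_pos one_lt_two
  rw [← Real.rpow_natCast, Real.rpow_def_of_pos (by norm_num), Real.rpow_def_of_pos hlog]
  nth_rewrite 2 [← Real.exp_log (by norm_num : (0 : ℝ) < 2)]
  rw [← Real.exp_add, Real.exp_le_exp]
  nlinarith [mul_le_mul_of_nonneg_left ht h2.le, mul_le_mul_of_nonneg_right hs h0]

/-- Since `n ≤ 2 ^ Nat.size n`, the factor two comes only from rounding the exponent. -/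
theorem rpow_le_two_pow {n t : ℕ} (hn : 1 ≤ n) {r : ℝ} (h0 : 0 ≤ r)
    (ht : Nat.size n * r ≤ (t : ℝ) + 1) : (n : ℝ) ^ r ≤ 2 * 2 ^ t := by
  have hlog : (0 : ℝ) < n := by positivity
  have hs : Real.log n ≤ Nat.size n * Real.log 2 := by
    rw [← Real.log_pow]
    refine Real.log_le_log hlog ?_
    exact_mod_cast (Nat.lt_size_self n).le
  have h2 := Real.log_pos one_lt_two
  rw [mul_comm, ← pow_succ, ← Real.rpow_natCast, Real.rpow_def_of_pos hlog,
    Real.rpow_def_of_pos (by norm_num), Real.exp_le_exp]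
  push_cast
  nlinarith [mul_le_mul_of_nonneg_left ht h2.le, mul_le_mul_of_nonneg_right hs h0]

/-- The constant in the approximation ratio. -/
noncomputable def ratioConst : ℝ := 8 * Real.exp 1 / √minorConst

theorem ratioConst_pos : 0 < ratioConst := by
  have := minorConst_pos
  unfold ratioConst
  positivity

theorem rpow_quarter_sq {x : ℝ} (hx : 0 ≤ x) : (x ^ (1 / 4 : ℝ)) ^ 2 = √x := by
  rw [← Real.rpow_natCast, ← Real.rpow_mul hx, Real.sqrt_eq_rpow]
  norm_num

/-- Both outcomes are estimated through squares; taking roots turns `√l` into the fourth root. -/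
theorem le_ratioConst_mul {a b l : ℝ} (hb : 0 ≤ b) (hl : 0 ≤ l)
    (h : minorConst * a ^ 2 ≤ (8 * Real.exp 1 * b) ^ 2 * √l) :
    a ≤ ratioConst * (b * l ^ (1 / 4 : ℝ)) := by
  have hc := minorConst_pos
  have hr := ratioConst_pos
  refine le_of_abs_le (abs_le_of_sq_le_sq ?_ (by positivity))
  rw [mul_pow, mul_pow, rpow_quarter_sq hl, ratioConst, div_pow, Real.sq_sqrt hc.le, div_mul_eq_mul_div,
    le_div_iff₀ hc]
  linarith

/-- The lengths give `K * h ≤ 4 ^ t`, and `minorConst * K ^ 2 ≤ K * h * √(log n)`. -/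
theorem colors_le_of_size {n K h t : ℕ} (hn : 2 ≤ n) (hKh : minorConst * K ≤ h * √(Real.log n))
    {r : ℚ} (hr0 : 0 ≤ r) (hr1 : r ≤ 1) (ht : (t : ℝ) ≤ Nat.size n * r)
    (hs : Nat.size K + Nat.size h ≤ 2 * t) {ε : ℝ} (hp : Presents n r ε) :
    (K : ℝ) ≤ ratioConst * ((n : ℝ) ^ ε * Real.log n ^ (1 / 4 : ℝ)) := by
  have hlog : 0 ≤ Real.log n := Real.log_nonneg (by exact_mod_cast (by omega : 1 ≤ n))
  refine le_ratioConst_mul (by positivity) hlog ?_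
  have h1 : (K : ℝ) * h ≤ (2 ^ t) ^ 2 := by
    have : K * h ≤ 2 ^ Nat.size K * 2 ^ Nat.size h :=
      Nat.mul_le_mul (Nat.lt_size_self K).le (Nat.lt_size_self h).le
    rw [← pow_add] at this
    have h2 : K * h ≤ (2 ^ t) ^ 2 := by
      rw [← pow_mul, mul_comm t 2]
      exact this.trans (Nat.pow_le_pow_right (by norm_num) hs)
    exact_mod_cast h2
  have h2 := two_pow_le_rpow (n := n) (by omega) (by exact_mod_cast hr0) (by exact_mod_cast hr1) ht
  have h3 := (rpow_le_of_presents hn hp).1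
  have h4 : (2 : ℝ) ^ t ≤ 8 * Real.exp 1 * (n : ℝ) ^ ε := by
    have : 0 < Real.exp 1 * (n : ℝ) ^ ε := by positivity
    linarith
  calc minorConst * (K : ℝ) ^ 2 = (minorConst * K) * K := by ring
    _ ≤ (h * √(Real.log n)) * K := by gcongr
    _ = (K * h) * √(Real.log n) := by ring
    _ ≤ (2 ^ t) ^ 2 * √(Real.log n) := by gcongr
    _ ≤ _ := by gcongr

/-- The lengths give `4 ^ t ≤ 2 * (K * h)`, as each number is at least half of the power of two
given by its length, and `minorConst * K * h ≤ h ^ 2 * √(log n)`. -/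
theorem rpow_le_of_size {n K h t : ℕ} (hn : 2 ≤ n) (hKh : minorConst * K ≤ h * √(Real.log n))
    (hK : 1 ≤ K) (hh : 1 ≤ h)
    {r : ℚ} (hr0 : 0 ≤ r) (ht : Nat.size n * r ≤ (t : ℝ) + 1)
    (hs : 2 * t < Nat.size K + Nat.size h) {ε : ℝ} (hp : Presents n r ε) :
    (n : ℝ) ^ ε ≤ ratioConst * (h * Real.log n ^ (1 / 4 : ℝ)) := by
  have hlog : 0 ≤ Real.log n := Real.log_nonneg (by exact_mod_cast (by omega : 1 ≤ n))
  refine le_ratioConst_mul (by positivity) hlog ?_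
  have h1 : ((2 : ℝ) ^ t) ^ 2 ≤ 2 * (K * h) := by
    have hK' : 2 ^ (Nat.size K - 1) ≤ K := by
      rw [← Nat.lt_size]; have := Nat.size_pos.2 hK; omega
    have hh' : 2 ^ (Nat.size h - 1) ≤ h := by
      rw [← Nat.lt_size]; have := Nat.size_pos.2 hh; omega
    have := Nat.mul_le_mul hK' hh'
    rw [← pow_add] at this
    have h2 : (2 ^ t) ^ 2 ≤ 2 * (K * h) := by
      rw [← pow_mul]
      refine le_trans ?_ (Nat.mul_le_mul_left 2 this)
      rw [← pow_succ']
      refine Nat.pow_le_pow_right (by norm_num) ?_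
      have := Nat.size_pos.2 hh
      have := Nat.size_pos.2 hK
      omega
    exact_mod_cast h2
  have h2 := rpow_le_two_pow (n := n) (by omega) (r := r) (by exact_mod_cast hr0) ht
  have h3 := (rpow_le_of_presents hn hp).2
  have hc := minorConst_pos
  have h4 : (n : ℝ) ^ ε ≤ 2 * Real.exp 1 * 2 ^ t := by
    have : 0 < Real.exp 1 := by positivity
    nlinarith
  calc minorConst * ((n : ℝ) ^ ε) ^ 2 ≤ minorConst * (2 * Real.exp 1 * 2 ^ t) ^ 2 := by gcongr
    _ = minorConst * (4 * Real.exp 1 ^ 2 * ((2 : ℝ) ^ t) ^ 2) := by ring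
    _ ≤ minorConst * (4 * Real.exp 1 ^ 2 * (2 * (K * h))) := by gcongr
    _ = 8 * Real.exp 1 ^ 2 * h * (minorConst * K) := by ring
    _ ≤ 8 * Real.exp 1 ^ 2 * h * (h * √(Real.log n)) := by gcongr
    _ = 8 * (Real.exp 1 * h) ^ 2 * √(Real.log n) := by ring
    _ ≤ 64 * (Real.exp 1 * h) ^ 2 * √(Real.log n) := by gcongr; norm_num
    _ = _ := by ring

/-! ### Graphs on `Fin n` -/

/-- The adjacency relation as a relation on the natural numbers. -/
def natAdj {n : ℕ} (G : SimpleGraph (Fin n)) (u v : ℕ) : Prop :=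
  ∃ (hu : u < n) (hv : v < n), G.Adj ⟨u, hu⟩ ⟨v, hv⟩

section

variable {n : ℕ} {G : SimpleGraph (Fin n)}

theorem natAdj_val (u v : Fin n) : natAdj G u v ↔ G.Adj u v :=
  ⟨fun ⟨_, _, h⟩ => h, fun h => ⟨u.2, v.2, h⟩⟩

theorem natAdj_isGraph (G : SimpleGraph (Fin n)) : IsGraph n (natAdj G) :=
  ⟨fun _ _ ⟨hu, hv, h⟩ => ⟨hv, hu, h.symm⟩, fun _ ⟨_, _, h⟩ => G.loopless.irrefl _ h,
    fun _ _ ⟨hu, _, _⟩ => hu⟩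

theorem IsPartialGreedy.ne_of_adj {rk col : ℕ → ℕ} (hrk : IsRemovalRank n (natAdj G) rk)
    (hcol : IsPartialGreedy n (natAdj G) rk 0 col) {u v : Fin n} (h : G.Adj u v) :
    col u ≠ col v := by
  have hne : rk u ≠ rk v := fun he => h.ne (Fin.ext (hrk.inj u u.2 v v.2 he))
  rcases lt_or_gt_of_ne hne with hlt | hlt
  · exact fun he => (hcol u u.2 (hrk.pos u u.2)).2.1 v v.2 ((natAdj_val u v).2 h) hlt he.symm
  · exact (hcol v v.2 (hrk.pos v v.2)).2.1 u u.2 ((natAdj_val v u).2 h.symm) hlt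

/-- The coloring that the algorithm finds. -/
def greedyColoring {rk col : ℕ → ℕ} (hrk : IsRemovalRank n (natAdj G) rk)
    (hcol : IsPartialGreedy n (natAdj G) rk 0 col) : G.Coloring ℕ :=
  SimpleGraph.Coloring.mk (fun v => col v) fun h => hcol.ne_of_adj hrk h

theorem cnt_eq_ncard (σ : Equiv.Perm (Fin n)) (p : ℕ → Prop) :
    cnt n p = {l : Fin n | p (σ l)}.ncard := by
  classical
  rw [Set.ncard_eq_toFinset_card', cnt]
  symm
  refine Finset.card_bij (fun l _ => (σ l : ℕ)) (fun l hl => ?_) (fun l _ l' _ h => ?_) fun v hv => ?_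
  · simpa using hl
  · exact σ.injective (Fin.ext h)
  · simp only [Finset.mem_filter, Finset.mem_range] at hv
    exact ⟨σ.symm ⟨v, hv.1⟩, by simpa using hv.2, by simp⟩

theorem isSmallestLastGreedy_greedyColoring {rk col : ℕ → ℕ}
    (hrk : IsRemovalRank n (natAdj G) rk) (hcol : IsPartialGreedy n (natAdj G) rk 0 col) :
    IsSmallestLastGreedy (greedyColoring hrk hcol) := by
  -- Ranks start with `1` for the vertex removed first, which has to come last in the order.
  let g : Fin n → Fin n := fun v => ⟨n - rk v, by
    have := hrk.pos v v.2
    have := v.2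
    omega⟩
  have hg : Function.Injective g := by
    intro u v h
    have h1 : n - rk u = n - rk v := congrArg Fin.val h
    have h2 := hrk.le u u.2
    have h3 := hrk.le v v.2
    exact Fin.ext (hrk.inj u u.2 v v.2 (by omega))
  let τ : Fin n ≃ Fin n := Equiv.ofBijective g (Finite.injective_iff_bijective.1 hg)
  have hσ : ∀ i, rk (τ.symm i) + i = n := by
    intro i
    have h1 : g (τ.symm i) = i := τ.apply_symm_apply i
    have h2 : n - rk (τ.symm i) = i := congrArg Fin.val h1
    have := hrk.le (τ.symm i) (τ.symm i).2
    omega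
  have hcard : ∀ i j : Fin n, {l | l ≤ i ∧ G.Adj (τ.symm j) (τ.symm l)}.ncard =
      cnt n fun y => rk (τ.symm i) ≤ rk y ∧ natAdj G (τ.symm j) y := by
    intro i j
    rw [cnt_eq_ncard τ.symm]
    congr 1
    ext l
    simp only [Set.mem_ofPred_eq, natAdj_val, Fin.le_def]
    have := hσ i
    have := hσ l
    exact and_congr_left fun _ => by omega
  refine ⟨τ.symm, fun i j hji => ?_, fun i => ?_⟩
  · rw [hcard, hcard]
    refine hrk.min _ (τ.symm i).2 _ (τ.symm j).2 ?_
    have := hσ i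
    have := hσ j
    rw [Fin.le_def] at hji
    omega
  · have h1 := (hcol _ (τ.symm i).2 (hrk.pos _ (τ.symm i).2)).2
    change IsLeast _ (col (τ.symm i))
    convert h1 using 1
    ext c
    simp only [Set.mem_ofPred_eq]
    constructor
    · intro h u hu ha hlt
      have h2 := h (τ ⟨u, hu⟩) ?_ ?_
      · rwa [Equiv.symm_apply_apply] at h2
      · have h3 := hσ (τ ⟨u, hu⟩)
        rw [Equiv.symm_apply_apply] at h3
        have := hσ i
        rw [Fin.lt_def]
        simp only at h3
        omega
      · rw [Equiv.symm_apply_apply]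
        exact (natAdj_val _ ⟨u, hu⟩).1 ha
    · intro h j hji ha
      refine h _ (τ.symm j).2 ((natAdj_val _ _).2 ha) ?_
      have := hσ i
      have := hσ j
      rw [Fin.lt_def] at hji
      omega

theorem colorsUsed_le {col : G.Coloring ℕ} {K : ℕ} (h : ∀ v, col v < K) : colorsUsed col ≤ K := by
  have : Set.range col ⊆ (Finset.range K : Set ℕ) := by
    rintro _ ⟨v, rfl⟩
    simpa using h v
  have h1 := Set.ncard_le_ncard this (Finset.finite_toSet _)
  rwa [Set.ncard_coe_finset, Finset.card_range] at h1

theorem ConnOn.connected {p : ℕ → Prop} (h : ConnOn (natAdj G) {v | v ∈ Set.Iio n ∧ p v}) :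
    (G.induce {v : Fin n | p v}).Connected := by
  obtain ⟨⟨x, hx⟩, hconn⟩ := h
  rw [SimpleGraph.connected_iff]
  refine ⟨?_, ⟨⟨⟨x, hx.1⟩, hx.2⟩⟩⟩
  rintro ⟨u, hu⟩ ⟨v, hv⟩
  have h1 := hconn u ⟨u.2, hu⟩ v ⟨v.2, hv⟩
  have key : ∀ y, Relation.ReflTransGen (fun a b => a ∈ {v | v ∈ Set.Iio n ∧ p v} ∧
      b ∈ {v | v ∈ Set.Iio n ∧ p v} ∧ natAdj G a b) u y → ∀ (hy : y < n) (hp : p y),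
      (G.induce {v : Fin n | p v}).Reachable ⟨u, hu⟩ ⟨⟨y, hy⟩, hp⟩ := by
    intro y hy
    induction hy with
    | refl => exact fun _ _ => SimpleGraph.Reachable.refl _
    | tail _ hbc ih =>
      intro hy hp
      obtain ⟨hb, -, ha⟩ := hbc
      refine (ih hb.1 hb.2).trans (SimpleGraph.Adj.reachable ?_)
      rw [SimpleGraph.comap_adj]
      exact (natAdj_val ⟨_, hb.1⟩ ⟨_, hy⟩).1 ha
  exact key v h1 v.2 hv

/-- The clique minor that the labels mark. -/
def labelMinor {lab : ℕ → ℕ} {h : ℕ} (hl : IsCliqueLabelling n (natAdj G) lab h) :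
    CliqueMinor G h where
  branch i := {v : Fin n | lab v = i + 1}
  connected i := (hl.conn i i.2).connected
  disjoint i j hij := by
    rw [Set.disjoint_left]
    intro v hi hj
    exact hij (Fin.ext (by
      have h1 : lab v = i + 1 := hi
      have h2 : lab v = j + 1 := hj
      omega))
  adjacent i j hij := by
    have hij' : (i : ℕ) ≠ j := fun h => hij (Fin.ext h)
    rcases lt_or_gt_of_ne hij' with hlt | hlt
    · obtain ⟨u, hu, v, hv, h1, h2, h3⟩ := hl.joined i j hlt j.2
      exact ⟨⟨u, hu⟩, h1, ⟨v, hv⟩, h2, (natAdj_val ⟨u, hu⟩ ⟨v, hv⟩).1 h3⟩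
    · obtain ⟨u, hu, v, hv, h1, h2, h3⟩ := hl.joined j i hlt i.2
      exact ⟨⟨v, hv⟩, h2, ⟨u, hu⟩, h1, ((natAdj_val ⟨u, hu⟩ ⟨v, hv⟩).1 h3).symm⟩

theorem hadwigerNumber_le (G : SimpleGraph (Fin n)) : hadwigerNumber G ≤ n := by
  refine csSup_le' ?_
  rintro h ⟨M⟩
  have hne : ∀ i, (M.branch i).Nonempty := fun i =>
    Set.nonempty_coe_sort.1 (M.connected i).nonempty
  choose f hf using hne
  have hinj : Function.Injective f := by
    intro i j hij
    by_contra hne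
    exact Set.disjoint_left.1 (M.disjoint i j hne) (hf i) (hij ▸ hf j)
  simpa using Fintype.card_le_of_injective f hinj

theorem one_le_chromaticNumber (hn : 0 < n) : 1 ≤ G.chromaticNumber.toNat := by
  have hc : G.Colorable n := by simpa using G.colorable_of_fintype
  have hne : G.chromaticNumber ≠ ⊤ := SimpleGraph.chromaticNumber_ne_top_iff_exists.2 ⟨n, hc⟩
  have : Nonempty (Fin n) := ⟨⟨0, hn⟩⟩
  have hpos : 0 < G.chromaticNumber := hc.chromaticNumber_pos
  rw [Nat.one_le_iff_ne_zero]
  intro h0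
  rcases ENat.toNat_eq_zero.1 h0 with h | h
  · exact hpos.ne' h
  · exact hne h

/-! ### Encodings -/

theorem flatMap_getD {α : Type} (l : List α) (f : α → List ℕ) {k : ℕ} (hf : ∀ x ∈ l, (f x).length = k)
    {i j : ℕ} (hi : i < l.length) (hj : j < k) :
    (l.flatMap f).getD (k * i + j) 0 = (f l[i]).getD j 0 := by
  induction l generalizing i with
  | nil => simp at hi
  | cons a l ih =>
    have ha := hf a (by simp)
    rw [List.flatMap_cons]
    cases i with
    | zero =>
      rw [List.getD_append _ _ _ _ (by omega)]
      simp
    | succ i =>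
      rw [List.getD_append_right _ _ _ _ (by rw [ha]; nlinarith), ha,
        show k * (i + 1) + j - k = k * i + j by rw [Nat.mul_succ]; omega,
        ih (fun x hx => hf x (by simp [hx])) (by simpa using hi)]
      simp

theorem flatMap_length {α : Type} (l : List α) (f : α → List ℕ) {k : ℕ}
    (hf : ∀ x ∈ l, (f x).length = k) : (l.flatMap f).length = l.length * k := by
  induction l with
  | nil => simp
  | cons a l ih =>
    rw [List.flatMap_cons, List.length_append, hf a (by simp), ih fun x hx => hf x (by simp [hx]),
      List.length_cons]
    ring

open Classical in
theorem encodeGraph_getD (G : SimpleGraph (Fin n)) {u v : ℕ} (hu : u < n) (hv : v < n) :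
    (encodeGraph ⟨n, G⟩).getD (n * u + v + 1) 0 = if natAdj G u v then 1 else 0 := by
  unfold encodeGraph
  rw [List.getD_cons_succ, flatMap_getD _ _ (k := n) (by simp) (by simpa using hu) hv]
  have : natAdj G u v ↔ G.Adj ⟨u, hu⟩ ⟨v, hv⟩ := natAdj_val ⟨u, hu⟩ ⟨v, hv⟩
  simp [List.getD_eq_getElem?_getD, hv, this]

theorem length_le_wordSize (l : List ℕ) : l.length ≤ RAM.wordSize l := by
  unfold RAM.wordSize
  induction l with
  | nil => simp
  | cons a l ih =>
    simp only [List.map_cons, List.sum_cons, List.length_cons]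
    omega

/-- The `n * n` entries of the matrix make the word longer than `n`, so time polynomial in `n` is
polynomial in the input size although `n` itself is written in binary. -/
theorem size_le_length_encodeGraph (G : InputGraph) : G.1 ≤ (encodeGraph G).length := by
  unfold encodeGraph
  rw [List.length_cons, flatMap_length _ _ (k := G.1) (by simp), List.length_finRange]
  nlinarith

theorem map_range_eq_map_finRange (n : ℕ) (g : ℕ → ℕ) :
    (List.range n).map g = (List.finRange n).map fun v : Fin n => g v := by
  rw [← List.map_coe_finRange_eq_range, List.map_map]
  rfl

end

/-! ### Input, output and the choice between the two results as programs. -/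

namespace Bounded

variable {n : ℕ} {w : ℕ → ℕ}

/-- Matrix `0` receives the adjacency matrix, which stands after position `p` of the input. -/
def inputCmd (p : ℕ) : Cmd :=
  .fill₂ 0 0 1 (.input (.add (.add (.sum 10 (.reg 0)) (.reg 1)) (.const (p + 1))))

theorem inputCmd_spec {G : SimpleGraph (Fin n)} {p : ℕ} [DecidableRel (natAdj G)]
    (hw : ∀ u < n, ∀ v < n, w (n * u + v + (p + 1)) = if natAdj G u v then 1 else 0) (u v : ℕ) :
    ((inputCmd p).run n w St.init).mat 0 u v ≠ 0 ↔ natAdj G u v := by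
  by_cases h : u < n ∧ v < n
  · rw [inputCmd, Cmd.fill₂_mat (by decide) rfl _ h.1 h.2]
    simp [hw u h.1 v h.2]
  · rw [inputCmd, Cmd.fill₂_mat_of_le (by decide) _ (by omega)]
    simp only [St.init, ne_eq, not_true_eq_false, false_iff]
    rintro ⟨hu, hv, -⟩
    exact h ⟨hu, hv⟩

def prepareCmd (p : ℕ) : Cmd := .seq (inputCmd p) analyzeCmd

theorem prepareCmd_spec {G : SimpleGraph (Fin n)} {p : ℕ} [DecidableRel (natAdj G)]
    (hw : ∀ u < n, ∀ v < n, w (n * u + v + (p + 1)) = if natAdj G u v then 1 else 0) :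
    (∃ rk, IsAnalysis n (natAdj G) rk (((prepareCmd p).run n w St.init).mat 2 0)
      (((prepareCmd p).run n w St.init).mat 12 0) (((prepareCmd p).run n w St.init).reg 9)
      (((prepareCmd p).run n w St.init).reg 20)) ∧ ((prepareCmd p).run n w St.init).out = [] := by
  refine ⟨?_, (Cmd.run_out rfl _).trans rfl⟩
  rw [prepareCmd, Cmd.run_seq]
  refine analyzeCmd_spec _ (natAdj_isGraph G) (inputCmd_spec hw) (fun a ha u v => ?_) ?_
  · rw [Cmd.run_mat (by simp [inputCmd, Cmd.fill₂, Cmd.setsMat, ha.symm])]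
    rfl
  · exact (Cmd.run_reg rfl _).trans rfl

def emitColorCmd : Cmd := .forTo 0 (.emit (.vec 2 (.reg 0)))

theorem emitColorCmd_spec (S : St) :
    (emitColorCmd.run n w S).out = S.out ++ (List.finRange n).map fun v : Fin n => S.mat 2 0 v := by
  rw [emitColorCmd, Cmd.run_for_emit S (S.mat 2 0), map_range_eq_map_finRange]
  intro v _ T _ hT
  simp [hT]

/-- The encoding of a clique minor with `h` vertices that is given by labels. -/
def minorWord (n : ℕ) (lab : ℕ → ℕ) (h : ℕ) : List ℕ :=
  h :: (List.range h).flatMap fun i => (List.range n).map fun v => if lab v = i + 1 then 1 else 0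

def emitMinorCmd : Cmd :=
  .seq (.emit (.reg 20)) <|
  .forTo 0 (.ite (.lt (.reg 0) (.reg 20))
    (.forTo 1 (.emit (.ind (.eq (.vec 12 (.reg 1)) (.add (.reg 0) (.const 1)))))) .skip)

theorem emitMinorCmd_spec (S : St) (h20 : S.reg 20 ≤ n) :
    (emitMinorCmd.run n w S).out = S.out ++ minorWord n (S.mat 12 0) (S.reg 20) := by
  classical
  rw [emitMinorCmd, Cmd.run_seq]
  set T0 := (Cmd.emit (.reg 20)).run n w S with hT0
  have key := Cmd.run_forTo_induct (n := n) (w := w) (i := 0) (S := T0)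
    (P := .ite (.lt (.reg 0) (.reg 20))
      (.forTo 1 (.emit (.ind (.eq (.vec 12 (.reg 1)) (.add (.reg 0) (.const 1)))))) .skip)
    (fun j T => T.mat 12 = S.mat 12 ∧ T.reg 20 = S.reg 20 ∧ T.out = T0.out ++
      (List.range (min j (S.reg 20))).flatMap fun i => (List.range n).map fun v =>
        if S.mat 12 0 v = i + 1 then 1 else 0) ⟨rfl, rfl, by simp⟩ ?_
  · rw [key.2.2, min_eq_right h20]
    simp [hT0, Cmd.run, minorWord]
  · rintro j hj T ⟨h1, h2, h3⟩
    refine ⟨(Cmd.run_mat rfl _).trans h1, (Cmd.run_reg rfl _).trans (by simp [h2]), ?_⟩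
    rw [Cmd.run_ite]
    simp only [Ex.holds_lt, Ex.eval_reg, St.reg_setReg, if_true, show (20 : ℕ) ≠ 0 by decide,
      if_false, h2]
    split_ifs with h
    · rw [Cmd.run_for_emit _ fun v => if S.mat 12 0 v = j + 1 then 1 else 0]
      · rw [St.out_setReg, h3, show min (j + 1) (S.reg 20) = min j (S.reg 20) + 1 by omega,
          List.range_succ, List.flatMap_append, List.append_assoc,
          show min j (S.reg 20) = j by omega]
        simp
      · intro v hv T' hr hm
        have := hr 0 (by decide)
        simp only [Ex.eval_ind, Ex.holds_eq, Ex.eval_vec, Ex.eval_add, Ex.eval_reg, Ex.eval_const,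
          St.mat_setReg, St.reg_setReg, hm, if_true, show (0 : ℕ) ≠ 1 by decide, if_false, this, h1]
    · rw [show min (j + 1) (S.reg 20) = min j (S.reg 20) by omega, ← h3]
      rfl

/-- Register `35` receives the threshold for the choice between the coloring and the clique minor,
and the registers `33` and `34` the binary lengths of their sizes. -/
def chooseCmd : Cmd :=
  .seq (sizeCmd 30 31 .size) <| .seq (sizeCmd 33 31 (.reg 9)) <| .seq (sizeCmd 34 31 (.reg 20)) <|
  .set 35 (.cnt 10 (.le (.add (.sum 11 (.ite (.lt (.reg 11) (.reg 10)) (.input (.const 1)) (.const 0)))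
    (.input (.const 1))) (.sum 11 (.ite (.lt (.reg 11) (.reg 30)) (.input (.const 0)) (.const 0)))))

/-- Division by counting: the quotient is the number of `i` for which `i + 1` times the denominator
is at most the dividend. It does not exceed `n` because `w 0 ≤ w 1`, so the count is complete. -/
theorem chooseCmd_spec (S : St) (h9 : S.reg 9 ≤ n) (h20 : S.reg 20 ≤ n) (hw : w 0 ≤ w 1)
    (hw1 : 0 < w 1) :
    (chooseCmd.run n w S).reg 33 = Nat.size (S.reg 9) ∧
    (chooseCmd.run n w S).reg 34 = Nat.size (S.reg 20) ∧
    (chooseCmd.run n w S).reg 35 = Nat.size n * w 0 / w 1 := by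
  classical
  rw [chooseCmd, Cmd.run_seq]
  have a1 := sizeCmd_spec (n := n) (w := w) (d := 30) (t := 31) (e := .size) S (by decide) (by decide)
    (by decide) le_rfl
  have a9 : ((sizeCmd 30 31 .size).run n w S).reg 9 = S.reg 9 := Cmd.run_reg rfl S
  have a20 : ((sizeCmd 30 31 .size).run n w S).reg 20 = S.reg 20 := Cmd.run_reg rfl S
  set T1 := (sizeCmd 30 31 .size).run n w S
  clear_value T1
  rw [Cmd.run_seq]
  have b1 := sizeCmd_spec (n := n) (w := w) (d := 33) (t := 31) (e := .reg 9) T1 (by decide)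
    (by decide) (by decide) (by simpa [a9] using h9)
  have b30 : ((sizeCmd 33 31 (.reg 9)).run n w T1).reg 30 = Nat.size n := by
    rw [Cmd.run_reg rfl, a1, Ex.eval_size]
  have b20 : ((sizeCmd 33 31 (.reg 9)).run n w T1).reg 20 = S.reg 20 := by
    rw [Cmd.run_reg rfl, a20]
  set T2 := (sizeCmd 33 31 (.reg 9)).run n w T1
  clear_value T2
  rw [Cmd.run_seq]
  have c1 := sizeCmd_spec (n := n) (w := w) (d := 34) (t := 31) (e := .reg 20) T2 (by decide)
    (by decide) (by decide) (by simpa [b20] using h20)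
  have c30 : ((sizeCmd 34 31 (.reg 20)).run n w T2).reg 30 = Nat.size n := by
    rw [Cmd.run_reg rfl, b30]
  have c33 : ((sizeCmd 34 31 (.reg 20)).run n w T2).reg 33 = Nat.size (S.reg 9) := by
    rw [Cmd.run_reg rfl, b1, Ex.eval_reg, a9]
  set T3 := (sizeCmd 34 31 (.reg 20)).run n w T2
  clear_value T3
  rw [Cmd.run_set]
  refine ⟨by simp [c33], by simp [c1, b20], ?_⟩
  rw [St.reg_setReg, if_pos rfl, Ex.eval_cnt]
  have hle : Nat.size n * w 0 / w 1 ≤ n := by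
    refine (Nat.div_le_of_le_mul ?_).trans (size_le_self n)
    rw [mul_comm]
    exact Nat.mul_le_mul_right _ hw
  trans cnt n fun i => i < Nat.size n * w 0 / w 1
  · refine cnt_congr fun i hi => ?_
    simp only [Ex.holds_le, Ex.eval_add, Ex.eval_sum, Ex.eval_ite, Ex.holds_lt, Ex.eval_reg,
      St.reg_setReg, Ex.eval_input, Ex.eval_const, if_true, show (10 : ℕ) ≠ 11 by decide,
      show (30 : ℕ) ≠ 10 by decide, show (30 : ℕ) ≠ 11 by decide, if_false, c30, sum_ite_lt]
    rw [min_eq_right hi.le, min_eq_right (size_le_self n), ← Nat.succ_le_iff,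
      Nat.le_div_iff_mul_le hw1, Nat.succ_mul]
  · rw [cnt_lt, min_eq_right hle]

/-- The program for the coloring together with the clique minor. -/
def bothCmd : Cmd := .seq (prepareCmd 0) <| .seq emitColorCmd emitMinorCmd

/-- The program for the coloring or the clique minor. -/
def eitherCmd : Cmd :=
  .seq (prepareCmd 2) <| .seq chooseCmd <|
  .ite (.le (.add (.reg 33) (.reg 34)) (.add (.reg 35) (.reg 35)))
    (.seq (.emit (.const 0)) emitColorCmd) (.seq (.emit (.const 1)) emitMinorCmd)

end Bounded

/-! ### The two algorithms. -/

open Bounded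

theorem encodeMinor_labelMinor {n : ℕ} {G : SimpleGraph (Fin n)} {lab : ℕ → ℕ} {h : ℕ}
    (hl : IsCliqueLabelling n (natAdj G) lab h) :
    encodeMinor (labelMinor hl) = minorWord n lab h := by
  unfold encodeMinor labelMinor minorWord
  rw [← List.map_coe_finRange_eq_range (n := h), List.flatMap_map]
  simp only [Set.mem_ofPred_eq, map_range_eq_map_finRange]
  congr!

theorem coloringAndMinor_solvable :
    RAM.SolvableInPolyTime encodeGraph (IsColoringAndMinor minorConst) := by
  classical
  refine solvableInPolyTime_of_run bothCmd 0 (fun G => ?_) ?_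
  · exact (size_le_length_encodeGraph G).trans (length_le_wordSize _)
  rintro ⟨n, G⟩
  change IsColoringAndMinor minorConst ⟨n, G⟩
    (bothCmd.run n (fun j => (encodeGraph ⟨n, G⟩).getD j 0) St.init).out
  set w := fun j => (encodeGraph ⟨n, G⟩).getD j 0 with hw
  obtain ⟨⟨rk, hr⟩, hout⟩ := prepareCmd_spec (w := w) (p := 0) (G := G) fun u hu v hv =>
    encodeGraph_getD G hu hv
  rw [bothCmd, Cmd.run_seq, Cmd.run_seq]
  set T := (prepareCmd 0).run n w St.init
  have h20 : (emitColorCmd.run n w T).reg 20 = T.reg 20 := Cmd.run_reg rfl T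
  have h12 : (emitColorCmd.run n w T).mat 12 = T.mat 12 := Cmd.run_mat rfl T
  have hk : colorsUsed (greedyColoring hr.rank hr.greedy) ≤ T.reg 9 :=
    colorsUsed_le fun v => hr.color_lt v v.2
  refine ⟨greedyColoring hr.rank hr.greedy, T.reg 20, labelMinor hr.label, ?_,
    isSmallestLastGreedy_greedyColoring _ _, fun h => ?_, fun h => hr.minorConst_mul_le h hk⟩
  · rw [emitMinorCmd_spec _ (h20.trans_le hr.le), emitColorCmd_spec, hout, encodeMinor_labelMinor,
      h20, h12]
    rfl
  · have := hr.colors_le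
    exact hr.pos (by omega)

/-- The optima enter only through trivial bounds: the chromatic number is at least `1`, and the
Hadwiger number is at most `n`. -/
theorem pairedApproximation_solvable :
    RAM.SolvableInPolyTime encodeGraphParam (IsPairedApproximation ratioConst) := by
  classical
  -- The number of vertices stands at position `2`, behind numerator and denominator.
  refine solvableInPolyTime_of_run eitherCmd 2 (fun x => ?_) ?_
  · refine le_trans ?_ (length_le_wordSize _)
    exact (size_le_length_encodeGraph x.1).trans (by simp only [encodeGraphParam, List.length_cons]; omega)
  rintro ⟨⟨n, G⟩, r, hr0, hr1⟩
  set x : InputGraph × Set.Ioo (0 : ℚ) 1 := (⟨n, G⟩, ⟨r, hr0, hr1⟩) with hx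
  change IsPairedApproximation ratioConst x
    (eitherCmd.run n (fun j => (encodeGraphParam x).getD j 0) St.init).out
  set w := fun j => (encodeGraphParam x).getD j 0 with hw
  obtain ⟨⟨rk, hr⟩, hout⟩ := prepareCmd_spec (w := w) (p := 2) (G := G) fun u hu v hv =>
    encodeGraph_getD G hu hv
  rw [eitherCmd, Cmd.run_seq, Cmd.run_seq]
  set T := (prepareCmd 2).run n w St.init
  have w0 : w 0 = r.num.toNat := rfl
  have w1 : w 1 = r.den := rfl
  have hnum : 0 < r.num := Rat.num_pos.2 hr0
  have hnd : r.num.toNat ≤ r.den := by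
    have : r.num < r.den := Rat.num_lt_denom_iff.2 hr1
    omega
  obtain ⟨s33, s34, s35⟩ := chooseCmd_spec (w := w) T hr.colors_le hr.le (by rw [w0, w1]; exact hnd)
    (by rw [w1]; exact r.den_pos)
  have hrcast : (r : ℝ) = (r.num.toNat : ℝ) / r.den := by
    have h1 : ((r.num.toNat : ℤ) : ℝ) = (r.num : ℝ) := by rw [Int.toNat_of_nonneg hnum.le]
    rw [Rat.cast_def, ← h1, Int.cast_natCast]
  set t := Nat.size n * w 0 / w 1 with ht
  have ht1 : (t : ℝ) ≤ Nat.size n * r := by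
    rw [hrcast, ht, w0, w1, ← mul_div_assoc]
    exact_mod_cast Nat.cast_div_le
  have ht2 : Nat.size n * (r : ℝ) ≤ (t : ℝ) + 1 := by
    have hd : (0 : ℝ) < r.den := by exact_mod_cast r.den_pos
    rw [hrcast, ht, w0, w1, ← mul_div_assoc, div_le_iff₀ hd]
    have := (Nat.lt_mul_of_div_lt (Nat.lt_succ_self (Nat.size n * r.num.toNat / r.den)) r.den_pos).le
    exact_mod_cast this
  have hout' : (chooseCmd.run n w T).out = [] := (Cmd.run_out rfl T).trans hout
  have h2 : (chooseCmd.run n w T).mat 2 = T.mat 2 := Cmd.run_mat rfl T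
  have h12 : (chooseCmd.run n w T).mat 12 = T.mat 12 := Cmd.run_mat rfl T
  have h20 : (chooseCmd.run n w T).reg 20 = T.reg 20 := Cmd.run_reg rfl T
  set T' := chooseCmd.run n w T
  rw [Cmd.run_ite]
  simp only [Ex.holds_le, Ex.eval_add, Ex.eval_reg, s33, s34, s35]
  split_ifs with hle
  · refine Or.inl ⟨greedyColoring hr.rank hr.greedy, ?_, fun ε hp hn => ?_⟩
    · rw [Cmd.run_seq, emitColorCmd_spec]
      simp only [Cmd.run, hout', h2]
      rfl
    · change 2 ≤ n at hn
      have h1 := colors_le_of_size hn (hr.minorConst_mul_colors_le hn) hr0.le hr1.le ht1 (by omega) hp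
      have hk : colorsUsed (greedyColoring hr.rank hr.greedy) ≤ T.reg 9 :=
        colorsUsed_le fun v => hr.color_lt v v.2
      have hk' : (colorsUsed (greedyColoring hr.rank hr.greedy) : ℝ) ≤ T.reg 9 := by exact_mod_cast hk
      have hchi : (1 : ℝ) ≤ G.chromaticNumber.toNat := by
        exact_mod_cast one_le_chromaticNumber (G := G) (by omega : 0 < n)
      refine (hk'.trans h1).trans (le_mul_of_one_le_right ?_ hchi)
      exact (Nat.cast_nonneg _).trans h1
  · refine Or.inr ⟨T.reg 20, labelMinor hr.label, ?_, fun ε hp hn => ?_⟩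
    · rw [Cmd.run_seq, emitMinorCmd_spec _ (by exact h20.trans_le hr.le), encodeMinor_labelMinor]
      simp only [Cmd.run, hout', h20, h12]
      rfl
    · change 2 ≤ n at hn
      have hn0 : 0 < n := by omega
      have hK : 1 ≤ T.reg 9 := Nat.one_le_iff_ne_zero.2 fun h => by
        have := hr.color_lt 0 hn0
        omega
      have h1 := rpow_le_of_size hn (hr.minorConst_mul_colors_le hn) hK (hr.pos hn0) hr0.le ht2
        (by omega) hp
      have h3 : (hadwigerNumber G : ℝ) ≤ n := by exact_mod_cast hadwigerNumber_le G
      refine h3.trans ?_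
      have hnpos : (0 : ℝ) < n := by exact_mod_cast hn0
      calc (n : ℝ) = (n : ℝ) ^ (1 - ε) * (n : ℝ) ^ ε := by
            rw [← Real.rpow_add hnpos]; simp
        _ ≤ (n : ℝ) ^ (1 - ε) * (ratioConst * (T.reg 20 * Real.log n ^ (1 / 4 : ℝ))) := by gcongr
        _ = _ := by ring

theorem theorem7 :
    (∃ c : ℝ, 0 < c ∧ RAM.SolvableInPolyTime encodeGraph (IsColoringAndMinor c)) ∧
    (∃ C : ℝ, 0 < C ∧ RAM.SolvableInPolyTime encodeGraphParam (IsPairedApproximation C)) := by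
  exact ⟨⟨minorConst, minorConst_pos, coloringAndMinor_solvable⟩,
    ⟨ratioConst, ratioConst_pos, pairedApproximation_solvable⟩⟩
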